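/- Let $k$ be a positive integer not divisible by $12$. Let $\mathbb H$ be the upper half-plane, $z=x+iy$, with measure $d\mu=dx\,dy/y^2$, and $\Gamma=\mathrm{SL}(2,\mathbb Z)$. Let $v=v_\eta^{2k}:\Gamma\to S^1$ be the multiplier system of weight $k$ determined by the Dedekind eta function via $\eta(Az)^2=v_\eta(A)^2(cz+d)\eta(z)^2$ for $A=\left(\begin{smallmatrix}a&b\\c&d\end{smallmatrix}\right)$, and put $\xi=v\left(\begin{smallmatrix}1&1\\0&1\end{smallmatrix}\right)=e^{2\pi i k/12}$. Let $$\Delta_k=y^2\left(\frac{\partial^2}{\partial x^2}+\frac{\partial^2}{\partial y^2}\right)-iky\frac{\partial}{\partial x}.$$ For $R\in\mathbb R$ let $\mathcal M(\Gamma,v,k,R)$ be the space of smooth $f:\mathbb H\to\mathbb C$ with $e^{-ik\mathrm{Arg}(cz+d)}f(Az)=v(A)f(z)$ for all $A\in\Gamma$, with $(\Delta_k+\tfrac14+R^2)f=0$ and $\int_{\Gamma\backslash\mathbb H}|f|^2\,d\mu<\infty$. Let $\mathcal M(\Gamma,v,k)$ be the linear span of all $\mathcal M(\Gamma,v,k,R)$,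 $R\in\mathbb R$, with the Petersson inner product $(f,g)=\int_{\Gamma\backslash\mathbb H}f\,\overline g\,d\mu$. Put $\chi_k(d)=i^{k(d-1)}$ and, for a positive integer $m$ and $|\zeta|=1$, $$(H_{m,\zeta}f)(z)=\frac1{\sqrt m}\sum_{ad=m,\ d>0}\chi_k(d)\sum_{b=0}^{d-1}\zeta^{-bd}f\!\left(\frac{az+b}{d}\right).$$ For $kn\equiv k \pmod{12}$ let $T_n=H_{n,\xi}$. Let $E_j^-=(z-\overline z)\frac{\partial}{\partial\overline z}+\frac j2$, $(Jf)(z)=f(-\overline z)$ and $\Theta=J\,E_{2-k}^-\circ\cdots\circ E_{k-2}^-\circ E_k^-$. For $km\equiv-k\pmod{12}$ let $T_m^\Theta=H_{m,\overline\xi}\,\Theta$. **Lemma.** Every operator in the family $$\mathcal T=\{T_n: n\ge1,\ kn\equiv k \bmod 12\}\cup\{T^\Theta_m: m\ge1,\ km\equiv-k\bmod 12\}$$ maps $\mathcal M(\Gamma,v,k)$ linearly into itself, maps $\mathcal M(\Gamma,v,k,R)$ into itself for every $R\in\mathbb R$, and is self-adjoint on $\mathcal M(\Gamma,v,k)$: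 $(Af,g)=(f,Ag)$ for all $f,g\in\mathcal M(\Gamma,v,k)$ and $A\in\mathcal T$. Any two operators in $\mathcal T$ commute on $\mathcal M(\Gamma,v,k)$, and each of them commutes there with $\Delta_k$. -/

import Mathlib

open scoped UpperHalfPlane MatrixGroups ContDiff ComplexConjugate

noncomputable section

namespace EtaMaass

/-! ### Partial derivatives, the Laplacian, lowering operators and the operator `Θ`

A function `f : ℍ → ℂ` is differentiated through its extension `f ∘ ofComplex` to `ℂ`; only the
values on the open upper half-plane matter. -/

/-- `f` is of class `C^∞` on the upper half-plane (in the real sense). -/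
def Smooth (f : ℍ → ℂ) : Prop :=
  ContDiffOn ℝ ∞ (f ∘ UpperHalfPlane.ofComplex) {z : ℂ | 0 < z.im}

/-- The partial derivative `∂f/∂x`, where `z = x + iy`. -/
def dX (f : ℍ → ℂ) (z : ℍ) : ℂ := fderiv ℝ (f ∘ UpperHalfPlane.ofComplex) (z : ℂ) 1

/-- The partial derivative `∂f/∂y`, where `z = x + iy`. -/
def dY (f : ℍ → ℂ) (z : ℍ) : ℂ := fderiv ℝ (f ∘ UpperHalfPlane.ofComplex) (z : ℂ) Complex.I

/-- The Wirtinger derivative `∂f/∂z̄ = (∂f/∂x + i ∂f/∂y) / 2`. -/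
def dZbar (f : ℍ → ℂ) (z : ℍ) : ℂ := (dX f z + Complex.I * dY f z) / 2

/-- The weight `k` Laplacian `Δ_k = y² (∂²/∂x² + ∂²/∂y²) - i k y ∂/∂x`. -/
def laplacian (k : ℤ) (f : ℍ → ℂ) (z : ℍ) : ℂ :=
  (z.im : ℂ) ^ 2 * (dX (dX f) z + dY (dY f) z) - Complex.I * k * z.im * dX f z

/-- The lowering operator `E_k⁻ = (z - z̄) ∂/∂z̄ + k/2`, from weight `k` to weight `k - 2`. -/
def lowering (k : ℤ) (f : ℍ → ℂ) (z : ℍ) : ℂ :=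
  ((z : ℂ) - conj (z : ℂ)) * dZbar f z + (k : ℂ) / 2 * f z

/-- `loweringIter k n = E_{k-2(n-1)}⁻ ∘ ⋯ ∘ E_{k-2}⁻ ∘ E_k⁻` (`n` factors). -/
def loweringIter (k : ℤ) : ℕ → (ℍ → ℂ) → (ℍ → ℂ)
  | 0, f => f
  | n + 1, f => lowering (k - 2 * n) (loweringIter k n f)

/-- The reflection `(J f)(z) = f(-z̄)`. -/
def reflect (f : ℍ → ℂ) (z : ℍ) : ℂ :=
  f ⟨-conj (z : ℂ), by simpa using z.im_pos⟩

/-- `Θ = J ∘ E_{2-k}⁻ ∘ ⋯ ∘ E_{k-2}⁻ ∘ E_k⁻`. -/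
def Theta (k : ℕ) (f : ℍ → ℂ) : ℍ → ℂ := reflect (loweringIter k k f)

/-! ### The multiplier system and Maass waveforms -/

/-- The multiplier system `v_η^{2k}` of weight `k`, where
`η(Az)² = v_η(A)² (cz + d) η(z)²` for `A = (a, b; c, d)`; the factor `v_η(A)²` does not depend on
`z` and is read off at `z = i`. -/
def vEta (k : ℕ) (A : SL(2, ℤ)) : ℂ :=
  (ModularForm.eta ((A • UpperHalfPlane.I : ℍ) : ℂ) ^ 2 /
    (((A 1 0 : ℂ) * Complex.I + (A 1 1 : ℂ)) * ModularForm.eta Complex.I ^ 2)) ^ k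

/-- `j_A(z; k) = exp(i k Arg(cz + d))` for `A = (a, b; c, d)`. -/
def autFactor (k : ℤ) (A : SL(2, ℤ)) (z : ℍ) : ℂ :=
  Complex.exp (Complex.I * k * Complex.arg ((A 1 0 : ℂ) * z + (A 1 1 : ℂ)))

/-- Maass waveforms on `SL(2, ℤ)` of weight `k`, multiplier `v` and spectral parameter `R`.
The last condition is square integrability over the standard fundamental domain with respect to
`dx dy / y²`, which is the canonical measure on `ℍ`. -/
structure IsMaassForm (k : ℤ) (v : SL(2, ℤ) → ℂ) (R : ℝ) (f : ℍ → ℂ) : Prop where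
  smooth : Smooth f
  slash : ∀ (A : SL(2, ℤ)) (z : ℍ), (autFactor k A z)⁻¹ * f (A • z) = v A * f z
  eigen : ∀ z : ℍ, laplacian k f z + (1 / 4 + (R : ℂ) ^ 2) * f z = 0
  memLp : MeasureTheory.MemLp f 2 (MeasureTheory.volume.restrict ModularGroup.fd)

/-- The space of Maass waveforms of weight `k` and multiplier `v`, with any real spectral
parameter: the linear span of all the `IsMaassForm k v R`, `R ∈ ℝ`. -/
def maassSpace (k : ℤ) (v : SL(2, ℤ) → ℂ) : Submodule ℂ (ℍ → ℂ) :=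
  Submodule.span ℂ {f | ∃ R : ℝ, IsMaassForm k v R f}

/-- The Petersson inner product `∫_{Γ\ℍ} f ḡ dx dy / y²`. -/
def petersson (f g : ℍ → ℂ) : ℂ :=
  ∫ z in ModularGroup.fd, f z * conj (g z)

theorem memLp_of_mem_maassSpace {k : ℤ} {v : SL(2, ℤ) → ℂ} {f : ℍ → ℂ}
    (hf : f ∈ maassSpace k v) :
    MeasureTheory.MemLp f 2 (MeasureTheory.volume.restrict ModularGroup.fd) := by
  induction hf using Submodule.span_induction with
  | mem f hf => exact hf.choose_spec.memLp
  | zero => exact MeasureTheory.MemLp.zero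
  | add f g _ _ hf hg => exact hf.add hg
  | smul c f _ hf => exact hf.const_smul c

/-- The integral defining the Petersson inner product converges absolutely on the space of
Maass waveforms. -/
theorem integrableOn_petersson {k : ℤ} {v : SL(2, ℤ) → ℂ} {f g : ℍ → ℂ}
    (hf : f ∈ maassSpace k v) (hg : g ∈ maassSpace k v) :
    MeasureTheory.IntegrableOn (fun z => f z * conj (g z)) ModularGroup.fd :=
  (memLp_of_mem_maassSpace hf).integrable_mul (memLp_of_mem_maassSpace hg).star

/-! ### Hecke operators -/

/-- `χ_k(d) = i^{k(d-1)}`. -/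
def chi (k d : ℕ) : ℂ := Complex.I ^ ((k : ℤ) * ((d : ℤ) - 1))

/-- `ξ = v_η^{2k}(1, 1; 0, 1) = exp(2πik/12)`. -/
def xi (k : ℕ) : ℂ := Complex.exp (2 * Real.pi * Complex.I * ((k : ℂ) / 12))

theorem vEta_T (k : ℕ) : vEta k ModularGroup.T = xi k := by
  have hq : ∀ (n : ℕ) (z : ℂ), ModularForm.eta_q n (1 + z) = ModularForm.eta_q n z := by
    intro n z
    rw [ModularForm.eta_q_eq_pow, ModularForm.eta_q_eq_pow, mul_add, Complex.exp_add, mul_one,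
      Complex.exp_two_pi_mul_I, one_mul]
  have he : ModularForm.eta (1 + Complex.I)
      = Complex.exp (2 * Real.pi * Complex.I / 24) * ModularForm.eta Complex.I := by
    simp only [ModularForm.eta, hq, Function.Periodic.qParam]
    rw [← mul_assoc, ← Complex.exp_add]
    congr 2
    push_cast
    ring
  have h0 : ModularForm.eta Complex.I ≠ 0 := ModularForm.eta_ne_zero (by simp)
  have hI : ((ModularGroup.T • UpperHalfPlane.I : ℍ) : ℂ) = 1 + Complex.I := by
    rw [UpperHalfPlane.modular_T_smul]
    simp
  have h10 : (ModularGroup.T 1 0 : ℤ) = 0 := by simp [ModularGroup.T]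
  have h11 : (ModularGroup.T 1 1 : ℤ) = 1 := by simp [ModularGroup.T]
  rw [vEta, hI, he, h10, h11, xi, mul_pow, ← Complex.exp_nat_mul]
  simp only [Int.cast_zero, zero_mul, zero_add, Int.cast_one, one_mul]
  rw [mul_div_cancel_right₀ _ (pow_ne_zero 2 h0), ← Complex.exp_nat_mul]
  congr 1
  push_cast
  ring

/-- The Hecke sum
`m^{-1/2} ∑_{ad = m, d > 0} χ_k(d) ∑_{b mod d} ζ^{-bd} f((az + b)/d)`. -/
def heckeSum (k : ℕ) (ζ : ℂ) (m : ℕ) (f : ℍ → ℂ) (z : ℍ) : ℂ :=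
  ((Real.sqrt m : ℝ) : ℂ)⁻¹ * ∑ d ∈ m.divisors, chi k d * ∑ b ∈ Finset.range d,
    ζ ^ (-((b : ℤ) * (d : ℤ))) *
      f (UpperHalfPlane.ofComplex ((((m / d : ℕ) : ℂ) * z + (b : ℂ)) / (d : ℂ)))

/-- The Hecke operator `T_m` for the multiplier `v = v_η^{2k}`. -/
def heckeT (k m : ℕ) (f : ℍ → ℂ) : ℍ → ℂ := heckeSum k (xi k) m f

/-- The Hecke operator `T_m` for the conjugate multiplier: `ξ` is replaced by its conjugate. -/
def heckeTbar (k m : ℕ) (f : ℍ → ℂ) : ℍ → ℂ := heckeSum k (conj (xi k)) m f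

/-- The Hecke-like operator `T_m^Θ`: first `Θ`, then `T_m` for the conjugate multiplier. -/
def heckeTheta (k m : ℕ) (f : ℍ → ℂ) : ℍ → ℂ := heckeTbar k m (Theta k f)

/-- The family of all `T_n` with `kn ≡ k mod 12` and all `T_m^Θ` with `km ≡ -k mod 12`. -/
def heckeFamily (k : ℕ) : Set ((ℍ → ℂ) → (ℍ → ℂ)) :=
  {F | ∃ n : ℕ, 0 < n ∧ (k : ℤ) * n ≡ k [ZMOD 12] ∧ F = heckeT k n} ∪
  {F | ∃ m : ℕ, 0 < m ∧ (k : ℤ) * m ≡ -k [ZMOD 12] ∧ F = heckeTheta k m}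

/-- `F` restricts to a linear operator `M → M` that equals its own adjoint with respect to the
Petersson inner product. -/
structure IsSelfAdjointOn (M : Submodule ℂ (ℍ → ℂ)) (F : (ℍ → ℂ) → (ℍ → ℂ)) : Prop where
  mapsTo : ∀ f ∈ M, F f ∈ M
  map_add : ∀ f ∈ M, ∀ g ∈ M, F (f + g) = F f + F g
  map_smul : ∀ (c : ℂ), ∀ f ∈ M, F (c • f) = c • F f
  adjoint : ∀ f ∈ M, ∀ g ∈ M, petersson (F f) g = petersson f (F g)

end EtaMaass

end

noncomputable section

namespace EtaMaass

open UpperHalfPlane (ofComplex ofComplex_apply)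
open Filter Topology MeasureTheory

/-! ### Differential calculus on the upper half-plane -/

/-! The multiplier of `η²` is a character of SL(2, ℤ). Explicit formulas modulo 3 and modulo 4
extend its `k`-th power to a function `nu` on integral matrices that is multiplicative wherever `k ·
det M ≡ k mod 12` (`nu_mul`, `vEta_eq_nu`). Hence `conj (nu M) · f|M` depends only on the coset
SL(2, ℤ)M, and at a triangular representative it is a summand of `T_n`. So `T_n` is a sum over all
cosets of determinant `n` (`IsHeckeWeight.heckeSum_eq`); right multiplication by SL(2, ℤ) permutes
them, which gives modularity. If `km ≡ -k`, one evaluates `nu` at `diag(-1, 1) M`, of determinant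
`-m`, and the sum turns the multiplier `v̄` into `v`. `Θ` does the opposite: `k` lowering steps lead
from weight `k` to `-k` and keep `v`, and the reflection restores the weight and conjugates `v`.

The spectral parameter survives because lowering intertwines the Laplacians and both are compatible
with reflection and with `z ↦ (az + b)/d`. Square integrability of a lowered form comes from
`raising_lowering`: raising undoes lowering up to a nonnegative constant, so Stokes' theorem with
cut-offs bounds the norm of the lowered form by that of `f`. For Hecke sums it comes from unfolding.

Self-adjointness also rests on unfolding (`sum_integral_adjKernel`). A sum of integrals over cosets
is half the sum, over all `M` of determinant `m`, of integrals over `fd ∩ M⁻¹ fd`; the substitution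
`w = Mz` together with `M ↦ adj M` permutes these terms. So the adjoint has the weights `conj (wt
(adj M))`. Since `adj M · M = m`, multiplicativity compares them with the original weights: they
agree for `T_n`, and for `T_m^Θ` a factor `(-1)^k` appears. The `k` integrations by parts that move
`Θ` across the inner product produce a second `(-1)^k`, and the two cancel.

For commutativity, a composition of Hecke sums is a sum over cosets of matrices `D` of determinant
`mn`, where `D` counts as often as it has right divisors of determinant `m` up to SL(2, ℤ). This
count is the same for `m` and `n`: it is invariant on both sides, so `D` may be taken diagonal, and
transposing a factorization of `D` exchanges the two factors (`divCount_eq`). `Θ` is moved past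
Hecke sums by `IsHeckeWeight.Theta`. The Laplacian commutes with the family because every eigenspace
is preserved. -/

theorem Smooth.contDiffAt {f : ℍ → ℂ} (hf : Smooth f) (z : ℍ) :
    ContDiffAt ℝ ∞ (f ∘ ofComplex) (z : ℂ) :=
  ContDiffOn.contDiffAt hf (UpperHalfPlane.isOpen_upperHalfPlaneSet.mem_nhds z.im_pos)

theorem smooth_iff {f : ℍ → ℂ} :
    Smooth f ↔ ∀ z : ℍ, ContDiffAt ℝ ∞ (f ∘ ofComplex) (z : ℂ) :=
  ⟨fun hf => hf.contDiffAt, fun h z hz => (h ⟨z, hz⟩).contDiffWithinAt⟩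

theorem Smooth.differentiableAt {f : ℍ → ℂ} (hf : Smooth f) (z : ℍ) :
    DifferentiableAt ℝ (f ∘ ofComplex) (z : ℂ) :=
  (hf.contDiffAt z).differentiableAt (by simp)

theorem eventually_im_pos (z : ℍ) : ∀ᶠ w : ℂ in 𝓝 (z : ℂ), 0 < w.im :=
  UpperHalfPlane.isOpen_upperHalfPlaneSet.mem_nhds z.im_pos

/-- A function on `ℍ` given by the restriction of `F : ℂ → ℂ`. -/
theorem restrict_comp_ofComplex (F : ℂ → ℂ) (z : ℍ) :
    (fun w : ℍ => F w) ∘ ofComplex =ᶠ[𝓝 (z : ℂ)] F := by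
  filter_upwards [eventually_im_pos z] with w hw
  simp [UpperHalfPlane.ofComplex_apply_of_im_pos hw]

theorem smooth_of_contDiffAt {F : ℂ → ℂ} (hF : ∀ z : ℍ, ContDiffAt ℝ ∞ F (z : ℂ)) :
    Smooth (fun z : ℍ => F z) :=
  smooth_iff.2 fun z => (hF z).congr_of_eventuallyEq (restrict_comp_ofComplex F z)

theorem smooth_const (c : ℂ) : Smooth (fun _ : ℍ => c) :=
  smooth_of_contDiffAt (F := fun _ => c) fun _ => contDiffAt_const

theorem smooth_ofReal_im {ψ : ℝ → ℝ} (hψ : ContDiff ℝ ∞ ψ) :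
    Smooth (fun z : ℍ => (ψ z.im : ℂ)) :=
  smooth_of_contDiffAt (F := fun w => (ψ w.im : ℂ)) fun _ =>
    (Complex.ofRealCLM.contDiff.comp (hψ.comp Complex.imCLM.contDiff)).contDiffAt

theorem smooth_im : Smooth (fun z : ℍ => (z.im : ℂ)) := smooth_ofReal_im contDiff_id

section
variable {f g : ℍ → ℂ} (hf : Smooth f) (hg : Smooth g)
include hf

theorem Smooth.conj : Smooth (fun z => conj (f z)) :=
  Complex.conjCLE.contDiff.comp_contDiffOn hf

theorem Smooth.const_smul (c : ℂ) : Smooth (c • f) := ContDiffOn.const_smul c hf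

include hg

theorem Smooth.add : Smooth (f + g) := ContDiffOn.add hf hg

theorem Smooth.mul : Smooth (f * g) := ContDiffOn.mul hf hg

end

theorem smooth_sum {ι : Type*} (s : Finset ι) {f : ι → ℍ → ℂ} (hf : ∀ i ∈ s, Smooth (f i)) :
    Smooth (∑ i ∈ s, f i) := by
  classical
  induction s using Finset.induction_on with
  | empty => exact smooth_const 0
  | insert i s hi ih =>
    rw [Finset.sum_insert hi]
    exact (hf i (by simp)).add (ih fun j hj => hf j (by simp [hj]))

theorem Smooth.continuous {f : ℍ → ℂ} (hf : Smooth f) : Continuous f := by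
  have h : Continuous fun z : ℍ => (f ∘ ofComplex) (z : ℂ) :=
    continuous_iff_continuousAt.2 fun z =>
      ContinuousAt.comp (f := fun z : ℍ => (z : ℂ)) (hf.contDiffAt z).continuousAt
        UpperHalfPlane.continuous_coe.continuousAt
  simpa using h

/-- The real derivative of `f` at `z`. -/
def deriv₂ (f : ℍ → ℂ) (z : ℍ) : ℂ →L[ℝ] ℂ := fderiv ℝ (f ∘ ofComplex) (z : ℂ)

theorem dX_eq (f : ℍ → ℂ) (z : ℍ) : dX f z = deriv₂ f z 1 := rfl

theorem dY_eq (f : ℍ → ℂ) (z : ℍ) : dY f z = deriv₂ f z Complex.I := rfl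

theorem deriv₂_apply (f : ℍ → ℂ) (z : ℍ) (w : ℂ) :
    deriv₂ f z w = w.re * dX f z + w.im * dY f z := by
  have hw : w = w.re • (1 : ℂ) + w.im • Complex.I := by simp
  conv_lhs => rw [hw]
  rw [map_add, map_smul, map_smul, dX_eq, dY_eq, Complex.real_smul, Complex.real_smul]

theorem Smooth.hasFDerivAt {f : ℍ → ℂ} (hf : Smooth f) (z : ℍ) :
    HasFDerivAt (f ∘ ofComplex) (deriv₂ f z) (z : ℂ) :=
  (hf.differentiableAt z).hasFDerivAt

theorem deriv₂_restrict {F : ℂ → ℂ} {L : ℂ →L[ℝ] ℂ} {z : ℍ} (h : HasFDerivAt F L (z : ℂ)) :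
    deriv₂ (fun w : ℍ => F w) z = L :=
  (h.congr_of_eventuallyEq (restrict_comp_ofComplex F z)).fderiv

theorem deriv₂_add {f g : ℍ → ℂ} (hf : Smooth f) (hg : Smooth g) (z : ℍ) :
    deriv₂ (f + g) z = deriv₂ f z + deriv₂ g z :=
  ((hf.hasFDerivAt z).add (hg.hasFDerivAt z)).fderiv

theorem deriv₂_const_smul {f : ℍ → ℂ} (hf : Smooth f) (c : ℂ) (z : ℍ) :
    deriv₂ (c • f) z = c • deriv₂ f z :=
  ((hf.hasFDerivAt z).const_smul c).fderiv

theorem deriv₂_mul {f g : ℍ → ℂ} (hf : Smooth f) (hg : Smooth g) (z : ℍ) :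
    deriv₂ (f * g) z = f z • deriv₂ g z + g z • deriv₂ f z := by
  have h := ((hf.hasFDerivAt z).mul (hg.hasFDerivAt z)).fderiv
  rw [Function.comp_apply, Function.comp_apply, ofComplex_apply] at h
  exact h

theorem deriv₂_conj {f : ℍ → ℂ} (hf : Smooth f) (z : ℍ) (w : ℂ) :
    deriv₂ (fun z => conj (f z)) z w = conj (deriv₂ f z w) := by
  have h := ((Complex.conjCLE : ℂ →L[ℝ] ℂ).hasFDerivAt.comp (z : ℂ) (hf.hasFDerivAt z)).fderiv
  change fderiv ℝ (Complex.conjCLE ∘ (f ∘ ofComplex)) (z : ℂ) w = _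
  erw [h]
  rfl

/-- The chain rule for a map `Φ : ℍ → ℍ` that extends to a differentiable map `G`. -/
theorem deriv₂_comp {f : ℍ → ℂ} (hf : Smooth f) {Φ : ℍ → ℍ} {G : ℂ → ℂ} {L : ℂ →L[ℝ] ℂ} {z : ℍ}
    (hG : ∀ z : ℍ, (Φ z : ℂ) = G z) (hL : HasFDerivAt G L (z : ℂ)) :
    deriv₂ (f ∘ Φ) z = (deriv₂ f (Φ z)).comp L := by
  have h1 := hf.hasFDerivAt (Φ z)
  rw [hG z] at h1
  refine ((h1.comp (z : ℂ) hL).congr_of_eventuallyEq ?_).fderiv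
  filter_upwards [eventually_im_pos z] with w hw
  have := hG ⟨w, hw⟩
  simp only [Function.comp_apply, UpperHalfPlane.ofComplex_apply_of_im_pos hw]
  rw [← this, ofComplex_apply]

theorem Smooth.comp {f : ℍ → ℂ} (hf : Smooth f) {Φ : ℍ → ℍ} {G : ℂ → ℂ}
    (hG : ∀ z : ℍ, (Φ z : ℂ) = G z) (hG' : ∀ z : ℍ, ContDiffAt ℝ ∞ G (z : ℂ)) :
    Smooth (f ∘ Φ) := by
  refine smooth_iff.2 fun z => ?_
  have h1 := hf.contDiffAt (Φ z)
  rw [hG z] at h1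
  refine (h1.comp (z : ℂ) (hG' z)).congr_of_eventuallyEq ?_
  filter_upwards [eventually_im_pos z] with w hw
  have := hG ⟨w, hw⟩
  simp only [Function.comp_apply, UpperHalfPlane.ofComplex_apply_of_im_pos hw]
  rw [← this, ofComplex_apply]

theorem Smooth.deriv₂_smooth {f : ℍ → ℂ} (hf : Smooth f) (w : ℂ) :
    Smooth (fun z => deriv₂ f z w) := by
  refine smooth_of_contDiffAt (F := fun z => fderiv ℝ (f ∘ ofComplex) z w) fun z => ?_
  exact ((hf.contDiffAt z).fderiv_right (m := ∞) (by simp)).clm_apply contDiffAt_const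

theorem Smooth.dX {f : ℍ → ℂ} (hf : Smooth f) : Smooth (dX f) := hf.deriv₂_smooth 1

theorem Smooth.dY {f : ℍ → ℂ} (hf : Smooth f) : Smooth (dY f) := hf.deriv₂_smooth Complex.I

theorem dX_dY {f : ℍ → ℂ} (hf : Smooth f) (z : ℍ) : dX (dY f) z = dY (dX f) z := by
  have h : ∀ w : ℂ, deriv₂ (fun z => deriv₂ f z w) z =
      (fderiv ℝ (fderiv ℝ (f ∘ ofComplex)) (z : ℂ)).flip w := by
    intro w
    refine deriv₂_restrict (F := fun z => fderiv ℝ (f ∘ ofComplex) z w) ?_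
    have hd : DifferentiableAt ℝ (fderiv ℝ (f ∘ ofComplex)) (z : ℂ) :=
      ((hf.contDiffAt z).fderiv_right (m := ∞) (by simp)).differentiableAt (by simp)
    convert! hd.hasFDerivAt.clm_apply (hasFDerivAt_const w (z : ℂ)) using 1
    ext
    all_goals simp
  have hs : IsSymmSndFDerivAt ℝ (f ∘ ofComplex) (z : ℂ) :=
    (hf.contDiffAt z).isSymmSndFDerivAt (by
      rw [minSmoothness_of_isRCLikeNormedField]
      exact WithTop.coe_le_coe.2 (le_top : (2 : ℕ∞) ≤ ⊤))
  change deriv₂ (fun z => deriv₂ f z Complex.I) z 1 = deriv₂ (fun z => deriv₂ f z 1) z Complex.I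
  rw [h, h]
  exact hs 1 Complex.I

section
variable {f g : ℍ → ℂ} (hf : Smooth f) (hg : Smooth g) (z : ℍ)
include hf

theorem dX_const_smul (c : ℂ) : dX (c • f) z = c * dX f z := by
  simp [dX_eq, deriv₂_const_smul hf]

theorem dY_const_smul (c : ℂ) : dY (c • f) z = c * dY f z := by
  simp [dY_eq, deriv₂_const_smul hf]

theorem dX_conj : dX (fun z => conj (f z)) z = conj (dX f z) := deriv₂_conj hf z 1

theorem dY_conj : dY (fun z => conj (f z)) z = conj (dY f z) := deriv₂_conj hf z Complex.I

include hg

theorem dX_add : dX (f + g) z = dX f z + dX g z := by simp [dX_eq, deriv₂_add hf hg]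

theorem dY_add : dY (f + g) z = dY f z + dY g z := by simp [dY_eq, deriv₂_add hf hg]

theorem dX_mul : dX (f * g) z = f z * dX g z + g z * dX f z := by
  simp [dX_eq, deriv₂_mul hf hg]

theorem dY_mul : dY (f * g) z = f z * dY g z + g z * dY f z := by
  simp [dY_eq, deriv₂_mul hf hg]

end

theorem deriv₂_ofReal_im {ψ : ℝ → ℝ} {z : ℍ} (hψ : DifferentiableAt ℝ ψ z.im) (w : ℂ) :
    deriv₂ (fun z : ℍ => (ψ z.im : ℂ)) z w = w.im * deriv ψ z.im := by
  have h : HasFDerivAt (fun w : ℂ => (ψ w.im : ℂ))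
      (Complex.ofRealCLM.comp ((deriv ψ z.im) • Complex.imCLM)) (z : ℂ) :=
    Complex.ofRealCLM.hasFDerivAt.comp (z : ℂ)
      (HasDerivAt.comp_hasFDerivAt (z : ℂ) hψ.hasDerivAt Complex.imCLM.hasFDerivAt)
  have h2 := deriv₂_restrict (F := fun w : ℂ => (ψ w.im : ℂ)) h
  simp only [UpperHalfPlane.coe_im] at h2
  rw [h2]
  simp [mul_comm]

theorem dX_ofReal_im {ψ : ℝ → ℝ} {z : ℍ} (hψ : DifferentiableAt ℝ ψ z.im) :
    dX (fun z : ℍ => (ψ z.im : ℂ)) z = 0 := by simp [dX_eq, deriv₂_ofReal_im hψ]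

theorem dY_ofReal_im {ψ : ℝ → ℝ} {z : ℍ} (hψ : DifferentiableAt ℝ ψ z.im) :
    dY (fun z : ℍ => (ψ z.im : ℂ)) z = deriv ψ z.im := by simp [dY_eq, deriv₂_ofReal_im hψ]

theorem dX_im (z : ℍ) : dX (fun z : ℍ => (z.im : ℂ)) z = 0 :=
  dX_ofReal_im (ψ := fun t => t) differentiableAt_id

theorem dY_im (z : ℍ) : dY (fun z : ℍ => (z.im : ℂ)) z = 1 :=
  (dY_ofReal_im (ψ := fun t => t) differentiableAt_id).trans (by simp)

/-! ### The lowering and raising operators -/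

/-- The raising operator `E_k⁺ = (z - z̄) ∂/∂z + k/2`, from weight `k` to weight `k + 2`. -/
def raising (k : ℤ) (f : ℍ → ℂ) (z : ℍ) : ℂ :=
  Complex.I * z.im * dX f z + z.im * dY f z + (k : ℂ) / 2 * f z

theorem lowering_apply (k : ℤ) (f : ℍ → ℂ) (z : ℍ) :
    lowering k f z = Complex.I * z.im * dX f z - z.im * dY f z + (k : ℂ) / 2 * f z := by
  have h : (z : ℂ) - conj (z : ℂ) = 2 * z.im * Complex.I := by
    rw [Complex.sub_conj]; simp
  rw [lowering, dZbar, h]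
  linear_combination (z.im * dY f z) * Complex.I_sq

theorem lowering_eq (k : ℤ) (f : ℍ → ℂ) :
    lowering k f = (fun z : ℍ => (z.im : ℂ)) * (Complex.I • dX f + (-1 : ℂ) • dY f) +
      ((k : ℂ) / 2) • f := by
  ext z
  rw [lowering_apply]
  simp
  ring

theorem Smooth.lowering {f : ℍ → ℂ} (hf : Smooth f) (k : ℤ) : Smooth (lowering k f) := by
  rw [lowering_eq]
  exact (smooth_im.mul ((hf.dX.const_smul _).add (hf.dY.const_smul _))).add (hf.const_smul _)

theorem Smooth.laplacian {f : ℍ → ℂ} (hf : Smooth f) (k : ℤ) : Smooth (laplacian k f) := by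
  have h : EtaMaass.laplacian k f = (fun z : ℍ => (z.im : ℂ)) * (fun z : ℍ => (z.im : ℂ)) *
      (EtaMaass.dX (EtaMaass.dX f) + EtaMaass.dY (EtaMaass.dY f)) +
      (-(Complex.I * k)) • ((fun z : ℍ => (z.im : ℂ)) * EtaMaass.dX f) := by
    ext z
    simp [EtaMaass.laplacian]
    ring
  rw [h]
  exact ((smooth_im.mul smooth_im).mul (hf.dX.dX.add hf.dY.dY)).add
    ((smooth_im.mul hf.dX).const_smul _)

section
variable {f g : ℍ → ℂ} (hf : Smooth f) (hg : Smooth g)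
include hf

theorem lowering_const_smul (k : ℤ) (c : ℂ) : lowering k (c • f) = c • lowering k f := by
  ext z
  simp only [lowering_apply, dX_const_smul hf, dY_const_smul hf, Pi.smul_apply, smul_eq_mul]
  ring

theorem dX_lowering (k : ℤ) : dX (lowering k f) = lowering k (dX f) := by
  ext z
  have hX := hf.dX
  have hY := hf.dY
  rw [lowering_eq, dX_add (smooth_im.mul ((hX.const_smul _).add (hY.const_smul _)))
    (hf.const_smul _), dX_mul smooth_im ((hX.const_smul _).add (hY.const_smul _)),
    dX_add (hX.const_smul _) (hY.const_smul _), dX_const_smul hX, dX_const_smul hY,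
    dX_const_smul hf, dX_im, lowering_apply, dX_dY hf]
  ring

/-- The extra terms come from differentiating the factor `y`, the only nonconstant coefficient of
the operator. -/
theorem dY_lowering (k : ℤ) :
    dY (lowering k f) = lowering k (dY f) + Complex.I • dX f + (-1 : ℂ) • dY f := by
  ext z
  have hX := hf.dX
  have hY := hf.dY
  rw [lowering_eq, dY_add (smooth_im.mul ((hX.const_smul _).add (hY.const_smul _)))
    (hf.const_smul _), dY_mul smooth_im ((hX.const_smul _).add (hY.const_smul _)),
    dY_add (hX.const_smul _) (hY.const_smul _), dY_const_smul hX, dY_const_smul hY,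
    dY_const_smul hf, dY_im]
  simp only [Pi.add_apply, lowering_apply, dX_dY hf, Pi.smul_apply, smul_eq_mul]
  ring

theorem lowering_im_mul (k : ℤ) (z : ℍ) :
    lowering k ((fun z : ℍ => (z.im : ℂ)) * f) z = z.im * lowering k f z - z.im * f z := by
  rw [lowering_apply, lowering_apply, dX_mul smooth_im hf, dY_mul smooth_im hf, dX_im, dY_im]
  simp
  ring

/-- Factorization of the Laplacian into first order operators. On an eigenfunction it becomes a
scalar, which controls the norm of the lowered function once raising is known to be the adjoint of
lowering. -/
theorem raising_lowering (k : ℤ) (z : ℍ) :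
    raising (k - 2) (lowering k f) z = -laplacian k f z + (k : ℂ) / 2 * ((k : ℂ) / 2 - 1) * f z := by
  rw [raising, dX_lowering hf, dY_lowering hf, Pi.add_apply, Pi.add_apply, lowering_apply,
    lowering_apply, lowering_apply, dX_dY hf, laplacian]
  simp
  linear_combination ((z.im : ℂ) ^ 2 * dX (dX f) z) * Complex.I_sq

include hg

theorem lowering_add (k : ℤ) : lowering k (f + g) = lowering k f + lowering k g := by
  ext z
  simp only [lowering_apply, dX_add hf hg, dY_add hf hg, Pi.add_apply]
  ring

theorem laplacian_add (k : ℤ) : laplacian k (f + g) = laplacian k f + laplacian k g := by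
  have hx : dX (f + g) = dX f + dX g := funext fun z => dX_add hf hg z
  have hy : dY (f + g) = dY f + dY g := funext fun z => dY_add hf hg z
  ext z
  simp only [laplacian, hx, hy, dX_add hf.dX hg.dX, dY_add hf.dY hg.dY, Pi.add_apply]
  ring

/-- Product rule for the lowering operator of weight `2`. -/
theorem lowering_mul_conj (k : ℤ) (z : ℍ) :
    lowering 2 (f * fun z => conj (g z)) z =
      lowering k f z * conj (g z) - f z * conj (raising (k - 2) g z) := by
  rw [lowering_apply, lowering_apply, raising, dX_mul hf hg.conj, dY_mul hf hg.conj, dX_conj hg,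
    dY_conj hg]
  simp only [Pi.mul_apply, map_add, map_sub, map_mul, map_div₀, Complex.conj_I, Complex.conj_ofReal, map_intCast,
    Complex.conj_ofNat, Int.cast_sub, Int.cast_ofNat]
  ring

end

theorem laplacian_const_smul {f : ℍ → ℂ} (hf : Smooth f) (k : ℤ) (c : ℂ) :
    laplacian k (c • f) = c • laplacian k f := by
  have hx : dX (c • f) = c • dX f := funext fun z => dX_const_smul hf z c
  have hy : dY (c • f) = c • dY f := funext fun z => dY_const_smul hf z c
  ext z
  simp only [laplacian, hx, hy, dX_const_smul hf.dX, dY_const_smul hf.dY, Pi.smul_apply,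
    smul_eq_mul]
  ring

/-- This keeps the spectral parameter fixed along all factors of `Θ`. The operator is commuted past
each factor `y` and each derivative separately. -/
theorem laplacian_lowering {f : ℍ → ℂ} (hf : Smooth f) (k : ℤ) :
    laplacian (k - 2) (lowering k f) = lowering k (laplacian k f) := by
  have hX := hf.dX
  have hY := hf.dY
  set y : ℍ → ℂ := fun z : ℍ => (z.im : ℂ) with hy
  -- The factors `y` are nested rather than squared so that `lowering_im_mul` removes them one at a
  -- time.
  have h : laplacian k f = y * (y * (dX (dX f) + dY (dY f))) +
      (-(Complex.I * k)) • (y * dX f) := by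
    ext z
    simp [laplacian, hy]
    ring
  have hs := hX.dX.add hY.dY
  ext z
  rw [h, lowering_add (smooth_im.mul (smooth_im.mul hs)) ((smooth_im.mul hX).const_smul _),
    lowering_const_smul (smooth_im.mul hX), Pi.add_apply, Pi.smul_apply,
    lowering_im_mul (smooth_im.mul hs), lowering_im_mul hs, lowering_im_mul hX,
    lowering_add hX.dX hY.dY, laplacian, dX_lowering hf, dX_lowering hX, dY_lowering hf,
    dY_add ((hY.lowering k).add (hX.const_smul _)) (hY.const_smul _),
    dY_add (hY.lowering k) (hX.const_smul _), dY_const_smul hX, dY_const_smul hY,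
    dY_lowering hY, Pi.add_apply, Pi.add_apply, Pi.add_apply, lowering_apply k (dX f)]
  simp only [Pi.add_apply, Pi.smul_apply, Pi.mul_apply, smul_eq_mul, dX_dY hf, Int.cast_sub,
    Int.cast_ofNat]
  linear_combination (2 * (z.im : ℂ) ^ 2 * dX (dX f) z) * Complex.I_sq

theorem lowering_ofReal_im_mul {f : ℍ → ℂ} (hf : Smooth f) {ψ : ℝ → ℝ} (hψ : ContDiff ℝ ∞ ψ)
    (k : ℤ) (z : ℍ) :
    lowering k ((fun z : ℍ => (ψ z.im : ℂ)) * f) z =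
      ψ z.im * lowering k f z - z.im * deriv ψ z.im * f z := by
  have hd : DifferentiableAt ℝ ψ z.im := (hψ.differentiable (by simp)) _
  rw [lowering_apply, lowering_apply, dX_mul (smooth_ofReal_im hψ) hf,
    dY_mul (smooth_ofReal_im hψ) hf, dX_ofReal_im hd, dY_ofReal_im hd]
  simp
  ring

/-! ### The reflection -/

/-- The map `z ↦ -z̄` of the upper half-plane. -/
def negConj (z : ℍ) : ℍ := ⟨-conj (z : ℂ), by simpa using z.im_pos⟩

theorem coe_negConj (z : ℍ) : (negConj z : ℂ) = -conj (z : ℂ) := rfl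

theorem reflect_eq (f : ℍ → ℂ) : reflect f = f ∘ negConj := rfl

theorem reflect_apply (f : ℍ → ℂ) (z : ℍ) : reflect f z = f (negConj z) := rfl

theorem negConj_negConj (z : ℍ) : negConj (negConj z) = z :=
  UpperHalfPlane.ext (by simp [coe_negConj])

theorem im_negConj (z : ℍ) : (negConj z).im = z.im := by
  rw [← UpperHalfPlane.coe_im, coe_negConj]; simp

theorem reflect_add (f g : ℍ → ℂ) : reflect (f + g) = reflect f + reflect g := rfl

theorem reflect_smul (c : ℂ) (f : ℍ → ℂ) : reflect (c • f) = c • reflect f := rfl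

theorem Smooth.reflect {f : ℍ → ℂ} (hf : Smooth f) : Smooth (reflect f) :=
  hf.comp (Φ := negConj) (G := fun w => -conj w) (fun _ => rfl)
    fun _ => (Complex.conjCLE.contDiff.neg).contDiffAt

theorem deriv₂_reflect {f : ℍ → ℂ} (hf : Smooth f) (z : ℍ) (w : ℂ) :
    deriv₂ (reflect f) z w = deriv₂ f (negConj z) (-conj w) := by
  rw [reflect_eq, deriv₂_comp hf (Φ := negConj) (G := fun w => -conj w) (fun _ => rfl)
    ((Complex.conjCLE : ℂ →L[ℝ] ℂ).hasFDerivAt.neg)]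
  rfl

theorem dX_reflect {f : ℍ → ℂ} (hf : Smooth f) :
    dX (reflect f) = (-1 : ℂ) • reflect (dX f) := by
  ext z
  rw [dX_eq, deriv₂_reflect hf]
  simp [reflect_apply, dX_eq]

theorem dY_reflect {f : ℍ → ℂ} (hf : Smooth f) : dY (reflect f) = reflect (dY f) := by
  ext z
  rw [dY_eq, deriv₂_reflect hf]
  simp [reflect_apply, dY_eq]

/-- Reflection changes the sign of `∂/∂x` only, and the weight enters the Laplacian only through its
term linear in `∂/∂x`. -/
theorem laplacian_reflect {f : ℍ → ℂ} (hf : Smooth f) (k : ℤ) :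
    laplacian (-k) (reflect f) = reflect (laplacian k f) := by
  ext z
  rw [reflect_apply, laplacian, laplacian, dX_reflect hf, dY_reflect hf, dY_reflect hf.dY,
    dX_const_smul hf.dX.reflect, dX_reflect hf.dX, im_negConj]
  simp [reflect_apply]

/-- The sign found here occurs once for each factor of `Θ` and builds up the `(-1)^k` of
`petersson_Theta`. -/
theorem raising_reflect {f : ℍ → ℂ} (hf : Smooth f) (k : ℤ) :
    raising k (reflect f) = (-1 : ℂ) • reflect (lowering (-k) f) := by
  ext z
  rw [Pi.smul_apply, reflect_apply, raising, lowering_apply, dX_reflect hf, dY_reflect hf,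
    im_negConj]
  simp [reflect_apply]
  ring

/-! ### The action of integral matrices of positive determinant -/

/-- Integral `2 × 2` matrices. -/
abbrev Mat := Matrix (Fin 2) (Fin 2) ℤ

/-- An integral matrix of positive determinant as an element of `GL₂(ℝ)`. -/
def glOf (M : Mat) : GL (Fin 2) ℝ :=
  if h : 0 < M.det then
    Matrix.GeneralLinearGroup.mkOfDetNeZero (M.map (Int.castRingHom ℝ)) (by
      rw [← RingHom.mapMatrix_apply, ← RingHom.map_det]
      simpa using h.ne')
  -- The default is again a group element, so `act M` preserves the measure for every `M` without a
  -- condition on the determinant.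
  else 1

/-- The action of an integral matrix of positive determinant on the upper half-plane. -/
def act (M : Mat) (z : ℍ) : ℍ := glOf M • z

/-- The denominator `cz + d`. -/
def den (M : Mat) (z : ℍ) : ℂ := M 1 0 * z + M 1 1

/-- The automorphy factor `(cz + d) / |cz + d|`. -/
def uden (M : Mat) (z : ℍ) : ℂ := den M z * ((‖den M z‖⁻¹ : ℝ) : ℂ)

theorem coe_glOf {M : Mat} (hM : 0 < M.det) :
    (glOf M : Matrix (Fin 2) (Fin 2) ℝ) = M.map (Int.castRingHom ℝ) := by
  rw [glOf, dif_pos hM]; rfl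

theorem det_glOf {M : Mat} (hM : 0 < M.det) : (glOf M).det.val = (M.det : ℝ) := by
  rw [Matrix.GeneralLinearGroup.val_det_apply, coe_glOf hM, ← RingHom.mapMatrix_apply,
    ← RingHom.map_det]
  rfl

theorem glOf_mul {M N : Mat} (hM : 0 < M.det) (hN : 0 < N.det) :
    glOf (M * N) = glOf M * glOf N := by
  have h : 0 < (M * N).det := by rw [Matrix.det_mul]; positivity
  apply Units.ext
  rw [Units.val_mul, coe_glOf h, coe_glOf hM, coe_glOf hN, Matrix.map_mul]

theorem act_mul {M N : Mat} (hM : 0 < M.det) (hN : 0 < N.det) (z : ℍ) :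
    act (M * N) z = act M (act N z) := by
  rw [act, glOf_mul hM hN, mul_smul]; rfl

theorem denom_glOf {M : Mat} (hM : 0 < M.det) (z : ℍ) :
    UpperHalfPlane.denom (glOf M) z = den M z := by
  simp [UpperHalfPlane.denom, coe_glOf hM, den]

theorem den_ne_zero {M : Mat} (hM : 0 < M.det) (z : ℍ) : den M z ≠ 0 := by
  rw [← denom_glOf hM]; exact UpperHalfPlane.denom_ne_zero _ _

theorem coe_act {M : Mat} (hM : 0 < M.det) (z : ℍ) :
    (act M z : ℂ) = (M 0 0 * z + M 0 1) / (M 1 0 * z + M 1 1) := by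
  rw [act, UpperHalfPlane.coe_smul_of_det_pos (by rw [det_glOf hM]; exact_mod_cast hM)]
  simp [UpperHalfPlane.num, UpperHalfPlane.denom, coe_glOf hM]

theorem im_act {M : Mat} (hM : 0 < M.det) (z : ℍ) :
    (act M z).im = M.det * z.im / Complex.normSq (den M z) := by
  rw [act, UpperHalfPlane.im_smul_eq_div_normSq, det_glOf hM, denom_glOf hM,
    abs_of_pos (by exact_mod_cast hM)]

theorem den_mul {M N : Mat} (hM : 0 < M.det) (hN : 0 < N.det) (z : ℍ) :
    den (M * N) z = den M (act N z) * den N z := by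
  have h : 0 < (M * N).det := by rw [Matrix.det_mul]; positivity
  have h1 := UpperHalfPlane.denom_cocycle_σ (glOf M) (glOf N) z
  have h2 : UpperHalfPlane.σ (glOf N) = .refl ℝ ℂ := by
    rw [UpperHalfPlane.σ, if_pos]
    rw [det_glOf hN]; exact_mod_cast hN
  rw [← glOf_mul hM hN, denom_glOf h, denom_glOf hN, h2] at h1
  rw [h1, ← denom_glOf hM]
  rfl

theorem uden_mul {M N : Mat} (hM : 0 < M.det) (hN : 0 < N.det) (z : ℍ) :
    uden (M * N) z = uden M (act N z) * uden N z := by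
  rw [uden, uden, uden, den_mul hM hN, norm_mul, mul_inv]
  push_cast
  ring

theorem uden_ne_zero {M : Mat} (hM : 0 < M.det) (z : ℍ) : uden M z ≠ 0 :=
  mul_ne_zero (den_ne_zero hM z) (by simpa using den_ne_zero hM z)

theorem norm_uden {M : Mat} (hM : 0 < M.det) (z : ℍ) : ‖uden M z‖ = 1 := by
  have := norm_ne_zero_iff.2 (den_ne_zero hM z)
  simp [uden, this]

theorem conj_uden {M : Mat} (hM : 0 < M.det) (z : ℍ) : conj (uden M z) = (uden M z)⁻¹ := by
  rw [Complex.inv_def, Complex.normSq_eq_norm_sq, norm_uden hM]; simp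

/-- With `u = w/|w|` one has `u² = w/w̄`. This relation contains no absolute value, so it can be
differentiated algebraically. -/
theorem uden_sq_mul {M : Mat} (hM : 0 < M.det) (z : ℍ) :
    uden M z * uden M z * conj (den M z) = den M z := by
  have h := norm_ne_zero_iff.2 (den_ne_zero hM z)
  have h2 : den M z * conj (den M z) = (‖den M z‖ : ℂ) ^ 2 := by
    rw [Complex.mul_conj, Complex.normSq_eq_norm_sq]; simp
  have h3 : (‖den M z‖ : ℂ) ≠ 0 := by exact_mod_cast h
  rw [uden]
  push_cast
  field_simp
  linear_combination (den M z) * h2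

theorem det_SL (A : SL(2, ℤ)) : 0 < (A : Mat).det := by rw [A.det_coe]; exact one_pos

theorem act_SL (A : SL(2, ℤ)) (z : ℍ) : act A z = A • z := by
  refine UpperHalfPlane.ext ?_
  rw [coe_act (det_SL A), UpperHalfPlane.coe_specialLinearGroup_apply]
  simp

theorem autFactor_eq (k : ℤ) (A : SL(2, ℤ)) (z : ℍ) : autFactor k A z = uden A z ^ k := by
  have h : uden A z = Complex.exp (Complex.I * Complex.arg (den A z)) := by
    have h0 := den_ne_zero (det_SL A) z
    have h1 := Complex.norm_mul_exp_arg_mul_I (den A z)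
    have h2 : (‖den A z‖ : ℂ) ≠ 0 := by exact_mod_cast norm_ne_zero_iff.2 h0
    rw [uden]
    push_cast
    rw [mul_comm Complex.I]
    field_simp
    exact h1.symm
  rw [h, ← Complex.exp_int_mul, autFactor, den]
  congr 1
  ring

/-- The transformation law under `SL(2, ℤ)` in terms of `uden`. -/
theorem slash_iff {k : ℤ} {v : SL(2, ℤ) → ℂ} {f : ℍ → ℂ} (A : SL(2, ℤ)) (z : ℍ) :
    (autFactor k A z)⁻¹ * f (A • z) = v A * f z ↔ f (act A z) = v A * uden A z ^ k * f z := by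
  have h := zpow_ne_zero k (uden_ne_zero (det_SL A) z)
  rw [autFactor_eq, act_SL, inv_mul_eq_iff_eq_mul₀ h]
  constructor <;> intro h <;> rw [h] <;> ring

theorem IsMaassForm.map_act {k : ℤ} {v : SL(2, ℤ) → ℂ} {R : ℝ} {f : ℍ → ℂ}
    (hf : IsMaassForm k v R f) (A : SL(2, ℤ)) (z : ℍ) :
    f (act A z) = v A * uden A z ^ k * f z :=
  (slash_iff A z).1 (hf.slash A z)

/-! ### Differentiation and the matrix action -/

theorem hasDerivAt_moebius {M : Mat} (hM : 0 < M.det) (z : ℍ) :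
    HasDerivAt (fun w : ℂ => (M 0 0 * w + M 0 1) / (M 1 0 * w + M 1 1))
      (M.det / den M z ^ 2) (z : ℂ) := by
  have h1 : HasDerivAt (fun w : ℂ => M 0 0 * w + M 0 1) (M 0 0 : ℂ) (z : ℂ) := by
    simpa using ((hasDerivAt_id (z : ℂ)).const_mul (M 0 0 : ℂ)).add_const (M 0 1 : ℂ)
  have h2 : HasDerivAt (fun w : ℂ => M 1 0 * w + M 1 1) (M 1 0 : ℂ) (z : ℂ) := by
    simpa using ((hasDerivAt_id (z : ℂ)).const_mul (M 1 0 : ℂ)).add_const (M 1 1 : ℂ)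
  convert! h1.div h2 (den_ne_zero hM z) using 1
  rw [Matrix.det_fin_two]
  push_cast
  rw [den]
  ring

theorem Smooth.comp_act {f : ℍ → ℂ} (hf : Smooth f) {M : Mat} (hM : 0 < M.det) :
    Smooth (f ∘ act M) := by
  refine hf.comp (G := fun w : ℂ => (M 0 0 * w + M 0 1) / (M 1 0 * w + M 1 1)) (coe_act hM)
    fun z => ?_
  have h : ContDiffAt ℂ ∞ (fun w : ℂ => (M 0 0 * w + M 0 1) / (M 1 0 * w + M 1 1)) (z : ℂ) :=
    (by fun_prop : ContDiffAt ℂ ∞ (fun w : ℂ => M 0 0 * w + M 0 1) (z : ℂ)).div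
      (by fun_prop) (den_ne_zero hM z)
  exact h.restrict_scalars ℝ

theorem deriv₂_comp_act {f : ℍ → ℂ} (hf : Smooth f) {M : Mat} (hM : 0 < M.det) (z : ℍ) (w : ℂ) :
    deriv₂ (f ∘ act M) z w = deriv₂ f (act M z) (M.det / den M z ^ 2 * w) := by
  rw [deriv₂_comp hf (coe_act hM) ((hasDerivAt_moebius hM z).hasFDerivAt.restrictScalars ℝ)]
  simp [mul_comm]

/-- In weight 0 the operator is `2iy ∂/∂z̄`, a derivation that kills holomorphic functions. The
behaviour in weight `k` is deduced from it. -/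
theorem lowering_zero_apply (f : ℍ → ℂ) (z : ℍ) :
    lowering 0 f z = Complex.I * z.im * (dX f z + Complex.I * dY f z) := by
  rw [lowering_apply]
  push_cast
  linear_combination (-z.im * dY f z) * Complex.I_sq

/-- For the holomorphic map `M`, `∂/∂z̄` picks up the conjugate of `M'(z) = det M/(cz + d)²`. Since
`Im Mz = det M · y/|cz + d|²`, what is left over is `(cz + d)/conj(cz + d) = u²`. -/
theorem lowering_zero_comp_act {f : ℍ → ℂ} (hf : Smooth f) {M : Mat} (hM : 0 < M.det) (z : ℍ) :
    lowering 0 (f ∘ act M) z = uden M z ^ 2 * lowering 0 f (act M z) := by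
  have h1 : ∀ g : ℂ, deriv₂ f (act M z) (g * 1) + Complex.I * deriv₂ f (act M z) (g * Complex.I) =
      conj g * (dX f (act M z) + Complex.I * dY f (act M z)) := by
    intro g
    rw [deriv₂_apply, deriv₂_apply]
    have hg : conj g = g.re - g.im * Complex.I := by
      apply Complex.ext <;> simp
    rw [hg]
    simp
    linear_combination (g.im * dY f (act M z)) * Complex.I_sq
  have h0 := den_ne_zero hM z
  have h0' : conj (den M z) ≠ 0 := by simpa using h0
  have h2 := uden_sq_mul hM z
  have h3 : uden M z ^ 2 = den M z / conj (den M z) := by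
    rw [eq_div_iff h0', sq, h2]
  rw [lowering_zero_apply, dX_eq, dY_eq, deriv₂_comp_act hf hM, deriv₂_comp_act hf hM, h1,
    lowering_zero_apply, im_act hM, h3]
  have h4 : (Complex.normSq (den M z) : ℂ) = den M z * conj (den M z) := (Complex.mul_conj _).symm
  rw [Complex.ofReal_div, h4, Complex.ofReal_mul, Complex.ofReal_intCast, map_div₀, map_pow,
    map_intCast]
  field_simp

theorem lowering_zero_mul {f g : ℍ → ℂ} (hf : Smooth f) (hg : Smooth g) (z : ℍ) :
    lowering 0 (f * g) z = f z * lowering 0 g z + g z * lowering 0 f z := by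
  rw [lowering_zero_apply, lowering_zero_apply, lowering_zero_apply, dX_mul hf hg, dY_mul hf hg]
  ring

theorem smooth_den (M : Mat) : Smooth (den M) :=
  smooth_of_contDiffAt (F := fun w => M 1 0 * w + M 1 1) fun z => by fun_prop

theorem smooth_uden {M : Mat} (hM : 0 < M.det) : Smooth (uden M) := by
  refine (smooth_den M).mul (g := fun z => ((‖den M z‖⁻¹ : ℝ) : ℂ)) ?_
  refine smooth_of_contDiffAt (F := fun w : ℂ => ((‖M 1 0 * w + M 1 1‖⁻¹ : ℝ) : ℂ)) fun z => ?_
  refine Complex.ofRealCLM.contDiff.contDiffAt.comp (z : ℂ)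
    (f := fun w : ℂ => ‖(M 1 0 : ℂ) * w + M 1 1‖⁻¹) (ContDiffAt.inv ?_ ?_)
  · exact ContDiffAt.norm ℝ (by fun_prop) (den_ne_zero hM z)
  · exact norm_ne_zero_iff.2 (den_ne_zero hM z)

theorem lowering_zero_den (M : Mat) (z : ℍ) : lowering 0 (den M) z = 0 := by
  have h : HasFDerivAt (fun w : ℂ => M 1 0 * w + M 1 1)
      ((M 1 0 : ℂ) • ContinuousLinearMap.id ℝ ℂ) (z : ℂ) :=
    ((hasFDerivAt_id (𝕜 := ℝ) (z : ℂ)).const_mul (M 1 0 : ℂ)).add_const (M 1 1 : ℂ)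
  have h2 : deriv₂ (den M) z = _ := deriv₂_restrict h
  rw [lowering_zero_apply, dX_eq, dY_eq, h2]
  simp
  right
  linear_combination (M 1 0 : ℂ) * Complex.I_sq

theorem lowering_zero_conj_den (M : Mat) (z : ℍ) :
    lowering 0 (fun z => conj (den M z)) z = den M z - conj (den M z) := by
  have h : HasFDerivAt (fun w : ℂ => M 1 0 * w + M 1 1)
      ((M 1 0 : ℂ) • ContinuousLinearMap.id ℝ ℂ) (z : ℂ) :=
    ((hasFDerivAt_id (𝕜 := ℝ) (z : ℂ)).const_mul (M 1 0 : ℂ)).add_const (M 1 1 : ℂ)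
  have h2 : deriv₂ (den M) z = _ := deriv₂_restrict h
  rw [lowering_zero_apply, dX_conj (smooth_den M), dY_conj (smooth_den M), dX_eq, dY_eq, h2, den]
  have h3 : conj (z : ℂ) = z - 2 * z.im * Complex.I := by
    have := Complex.sub_conj (z : ℂ)
    rw [UpperHalfPlane.coe_im] at this
    push_cast at this
    linear_combination -this
  simp [h3]
  linear_combination (-(M 1 0 : ℂ) * z.im * Complex.I) * Complex.I_sq

/-- Apply the derivation to `u² · conj(cz + d) = cz + d`. The right side is holomorphic, so the
identity can be solved for the derivative of `u`. -/
theorem lowering_zero_uden {M : Mat} (hM : 0 < M.det) (z : ℍ) :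
    lowering 0 (uden M) z = -(uden M z * (uden M z ^ 2 - 1) / 2) := by
  have hu := smooth_uden hM
  have hd := (smooth_den M).conj
  have h1 : uden M * uden M * (fun z => conj (den M z)) = den M :=
    funext fun z => uden_sq_mul hM z
  have h2 := lowering_zero_mul (hu.mul hu) hd z
  rw [h1, lowering_zero_mul hu hu, lowering_zero_den, lowering_zero_conj_den] at h2
  have h0 := den_ne_zero hM z
  have h0' : conj (den M z) ≠ 0 := by simpa using h0
  have hu0 := uden_ne_zero hM z
  have h3 := uden_sq_mul hM z
  have h4 : 2 * uden M z * conj (den M z) *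
      (lowering 0 (uden M) z + uden M z * (uden M z ^ 2 - 1) / 2) = 0 := by
    simp only [Pi.mul_apply] at h2
    linear_combination -h2 + (uden M z * uden M z) * h3
  rcases mul_eq_zero.1 h4 with h5 | h5
  · simp [hu0, h0] at h5
  · linear_combination h5

theorem smooth_zpow {h : ℍ → ℂ} (hh : Smooth h) (h0 : ∀ z, h z ≠ 0) (k : ℤ) :
    Smooth (fun z => h z ^ k) := by
  refine smooth_iff.2 fun z => ?_
  have h1 : (h ∘ ofComplex) (z : ℂ) ≠ 0 := by simpa using h0 z
  rcases k with n | n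
  · simpa [Function.comp_def] using (hh.contDiffAt z).pow n
  · simp only [Function.comp_def, zpow_negSucc]
    exact ((hh.contDiffAt z).pow (n + 1)).inv (pow_ne_zero _ h1)

theorem lowering_zero_zpow {h : ℍ → ℂ} (hh : Smooth h) (h0 : ∀ z, h z ≠ 0) (k : ℤ) (z : ℍ) :
    lowering 0 (fun z => h z ^ k) z = k * h z ^ (k - 1) * lowering 0 h z := by
  have h1 : deriv₂ (fun z => h z ^ k) z = (k * h z ^ (k - 1)) • deriv₂ h z := by
    have h2 : h (ofComplex z) ≠ 0 := by simpa using h0 z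
    have h3 := ((hasDerivAt_zpow k (h (ofComplex z)) (Or.inl h2)).hasFDerivAt.restrictScalars
      ℝ).comp (z : ℂ) (hh.hasFDerivAt z)
    refine h3.fderiv.trans ?_
    ext w
    simp [mul_comm]
  rw [lowering_zero_apply, lowering_zero_apply, dX_eq, dY_eq, h1, dX_eq, dY_eq]
  simp
  ring

theorem lowering_eq_zero (k : ℤ) (f : ℍ → ℂ) (z : ℍ) :
    lowering k f z = lowering 0 f z + (k : ℂ) / 2 * f z := by
  rw [lowering_apply, lowering_apply]; push_cast; ring

/-- The lowering operator maps weight `k` to weight `k - 2`. -/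
theorem lowering_map_act {f : ℍ → ℂ} (hf : Smooth f) {M : Mat} (hM : 0 < M.det) {k : ℤ} {c : ℂ}
    (h : ∀ z, f (act M z) = c * uden M z ^ k * f z) (z : ℍ) :
    lowering k f (act M z) = c * uden M z ^ (k - 2) * lowering k f z := by
  have hu := smooth_uden hM
  have hu0 := uden_ne_zero hM
  have hk := smooth_zpow hu hu0 k
  have h1 : f ∘ act M = c • ((fun z => uden M z ^ k) * f) := by
    ext z
    simp [h z, mul_assoc]
  -- Both sides of `f ∘ M = c u^k f` are differentiated in weight 0. The derivative of `u^k` is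
  -- `-(k/2) u^k (u² - 1)`; its two parts supply the terms `k/2 · f` at `Mz` and at `z`.
  have h2 := lowering_zero_comp_act hf hM z
  rw [h1, lowering_const_smul (hk.mul hf), Pi.smul_apply, lowering_zero_mul hk hf,
    lowering_zero_zpow hu hu0, lowering_zero_uden hM] at h2
  rw [lowering_eq_zero k f (act M z), lowering_eq_zero k f z, h z]
  have h3 := hu0 z
  rw [zpow_sub₀ h3, zpow_ofNat]
  rw [zpow_sub_one₀ h3] at h2
  simp only [smul_eq_mul] at h2
  field_simp at h2 ⊢
  linear_combination -h2

/-! ### Stokes' theorem on the fundamental domain -/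

/-- The height `√(1 - x²)` of the unit circle. -/
def arc (x : ℝ) : ℝ := √(1 - x ^ 2)

theorem arc_neg (x : ℝ) : arc (-x) = arc x := by simp [arc]

theorem arc_pos {x : ℝ} (hx : |x| ≤ 1 / 2) : 0 < arc x :=
  Real.sqrt_pos.2 (by nlinarith [abs_le.1 hx])

theorem arc_sq {x : ℝ} (hx : |x| ≤ 1 / 2) : arc x ^ 2 = 1 - x ^ 2 :=
  Real.sq_sqrt (by nlinarith [abs_le.1 hx])

theorem continuous_arc : Continuous arc := by unfold arc; fun_prop

theorem hasDerivAt_arc {x : ℝ} (hx : |x| ≤ 1 / 2) : HasDerivAt arc (-x / arc x) x := by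
  have h0 : 1 - x ^ 2 ≠ 0 := by nlinarith [abs_le.1 hx]
  have h := ((hasDerivAt_id x).pow 2).const_sub 1 |>.sqrt h0
  have h1 := (arc_pos hx).ne'
  convert! h using 1
  change -x / arc x = _ / (2 * arc x)
  simp
  field_simp

/-- Coordinates in which the fundamental domain becomes a half-strip. -/
def coord (p : ℝ × ℝ) : ℂ := p.1 + (arc p.1 + p.2 : ℝ) * Complex.I

theorem coord_re (p : ℝ × ℝ) : (coord p).re = p.1 := by simp [coord]

theorem coord_im (p : ℝ × ℝ) : (coord p).im = arc p.1 + p.2 := by simp [coord]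

def shear : ℝ × ℝ ≃ᵐ ℝ × ℝ where
  toFun p := (p.1, arc p.1 + p.2)
  invFun p := (p.1, p.2 - arc p.1)
  left_inv p := by simp
  right_inv p := by simp
  measurable_toFun := by
    have := continuous_arc.measurable
    simp only [Equiv.coe_fn_mk]
    fun_prop
  measurable_invFun := by
    have := continuous_arc.measurable
    simp only [Equiv.coe_fn_symm_mk]
    fun_prop

/-- Every vertical line is merely translated, so no Jacobian appears when the arc is straightened to
`t = 0`. -/
theorem measurePreserving_shear : MeasurePreserving shear := by
  refine (MeasurePreserving.id (volume : Measure ℝ)).skew_product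
    (g := fun x t => arc x + t) ?_ (Eventually.of_forall fun x => ?_)
  · have := continuous_arc.measurable
    fun_prop
  · exact (measurePreserving_add_left volume (arc x)).map_eq

def coordEquiv : ℝ × ℝ ≃ᵐ ℂ := shear.trans Complex.measurableEquivRealProd.symm

theorem coordEquiv_apply (p : ℝ × ℝ) : coordEquiv p = coord p := by
  change Complex.measurableEquivRealProd.symm (shear p) = _
  rw [Complex.measurableEquivRealProd_symm_apply]
  apply Complex.ext
  · rw [coord_re]; rfl
  · rw [coord_im]; rfl

theorem measurePreserving_coordEquiv : MeasurePreserving coordEquiv :=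
  Complex.volume_preserving_equiv_real_prod.symm.comp measurePreserving_shear

/-- Integrals over the upper half-plane as integrals over `ℂ`. -/
theorem setIntegral_upperHalfPlane (h : ℍ → ℂ) {s : Set ℍ} (hs : MeasurableSet s) :
    ∫ z in s, h z = ∫ w in UpperHalfPlane.coe '' s, ((w.im ^ 2)⁻¹ : ℝ) • (h ∘ ofComplex) w := by
  have hp : MeasurePreserving UpperHalfPlane.coe (volume.comap UpperHalfPlane.coe)
      (volume.restrict (.range UpperHalfPlane.coe)) :=
    ⟨UpperHalfPlane.measurable_coe, by rw [UpperHalfPlane.measurableEmbedding_coe.map_comap]⟩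
  have h1 := hp.setIntegral_image_emb UpperHalfPlane.measurableEmbedding_coe
    (fun w => ((w.im ^ 2)⁻¹ : ℝ) • (h ∘ ofComplex) w) s
  rw [Measure.restrict_restrict' UpperHalfPlane.measurableEmbedding_coe.measurableSet_range,
    Set.inter_eq_self_of_subset_left (Set.image_subset_range _ _)] at h1
  rw [h1, UpperHalfPlane.volume_def, setIntegral_withDensity_eq_setIntegral_smul _ _ hs]
  · refine integral_congr_ae (Eventually.of_forall fun z => ?_)
    simp [NNReal.smul_def]
  · have : Continuous fun z : ℍ => (1 / NNReal.mk z.im z.im_pos.le) ^ 2 := by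
      refine .pow (.div₀ continuous_const ?_ ?_) _
      · exact UpperHalfPlane.continuous_im.subtype_mk _
      · exact fun x ↦ NNReal.ne_iff.mp x.im_ne_zero
    exact this.measurable

theorem measurableSet_fd : MeasurableSet ModularGroup.fd := by
  refine IsClosed.measurableSet (IsClosed.inter ?_ ?_)
  · exact isClosed_le continuous_const (Complex.continuous_normSq.comp UpperHalfPlane.continuous_coe)
  · exact isClosed_le UpperHalfPlane.continuous_re.abs continuous_const

theorem mem_image_fd_iff {p : ℝ × ℝ} :
    coord p ∈ UpperHalfPlane.coe '' ModularGroup.fd ↔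
      p ∈ Set.Icc (-(1 / 2) : ℝ) (1 / 2) ×ˢ Set.Ici (0 : ℝ) := by
  simp only [Set.mem_prod, Set.mem_Icc, ← abs_le, Set.mem_Ici]
  constructor
  · rintro ⟨z, ⟨h1, h2⟩, h3⟩
    have hre : z.re = p.1 := by rw [← UpperHalfPlane.coe_re, h3, coord_re]
    have him : z.im = arc p.1 + p.2 := by rw [← UpperHalfPlane.coe_im, h3, coord_im]
    rw [Complex.normSq_apply, UpperHalfPlane.coe_re, UpperHalfPlane.coe_im] at h1
    rw [hre] at h2
    refine ⟨h2, ?_⟩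
    have h4 := arc_sq h2
    have h5 := arc_pos h2
    have h6 := z.im_pos
    rw [hre] at h1
    by_contra! h7
    have : z.im < arc p.1 := by linarith
    nlinarith
  · rintro ⟨h1, h2⟩
    have h4 := arc_sq h1
    have h5 := arc_pos h1
    have h6 : 0 < (coord p).im := by rw [coord_im]; linarith
    refine ⟨⟨coord p, h6⟩, ⟨?_, ?_⟩, rfl⟩
    · rw [UpperHalfPlane.coe_mk, Complex.normSq_apply, coord_re, coord_im]
      nlinarith
    · change |(coord p).re| ≤ 1 / 2
      rwa [coord_re]

/-- The function vanishes for `z.im ≥ Y` while the box ends at `t = Y`. This suffices because `z.im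
= arc x + t ≥ t`. -/
theorem setIntegral_fd_eq {h : ℍ → ℂ} (hc : Continuous h) {Y : ℝ} (hY : 0 ≤ Y)
    (h0 : ∀ z : ℍ, Y ≤ z.im → h z = 0) :
    ∫ z in ModularGroup.fd, h z = ∫ x in (-(1 / 2) : ℝ)..(1 / 2), ∫ t in (0 : ℝ)..Y,
      (((coord (x, t)).im ^ 2)⁻¹ : ℝ) • (h ∘ ofComplex) (coord (x, t)) := by
  rw [setIntegral_upperHalfPlane h measurableSet_fd,
    ← measurePreserving_coordEquiv.setIntegral_preimage_emb coordEquiv.measurableEmbedding]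
  have h1 : coordEquiv ⁻¹' (UpperHalfPlane.coe '' ModularGroup.fd) =
      Set.Icc (-(1 / 2) : ℝ) (1 / 2) ×ˢ Set.Ici (0 : ℝ) := by
    ext p
    rw [Set.mem_preimage, coordEquiv_apply, mem_image_fd_iff]
  have him : ∀ p ∈ Set.Icc (-(1 / 2) : ℝ) (1 / 2) ×ˢ Set.Ici (0 : ℝ), 0 < (coord p).im := by
    rintro p ⟨h2, h3⟩
    have h4 := arc_pos (abs_le.2 h2)
    rw [coord_im]
    simp only [Set.mem_Ici] at h3
    linarith
  have hsub : Set.Icc (-(1 / 2) : ℝ) (1 / 2) ×ˢ Set.Icc (0 : ℝ) Y ⊆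
      Set.Icc (-(1 / 2) : ℝ) (1 / 2) ×ˢ Set.Ici (0 : ℝ) :=
    Set.prod_mono_right Set.Icc_subset_Ici_self
  rw [h1, setIntegral_eq_of_subset_of_forall_sdiff_eq_zero
    (measurableSet_Icc.prod measurableSet_Ici) hsub]
  · rw [Measure.volume_eq_prod, setIntegral_prod]
    · rw [intervalIntegral.integral_of_le (by norm_num), integral_Icc_eq_integral_Ioc]
      refine integral_congr_ae (Eventually.of_forall fun x => ?_)
      simp only
      rw [intervalIntegral.integral_of_le hY, integral_Icc_eq_integral_Ioc]
      simp only [coordEquiv_apply]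
    · refine ContinuousOn.integrableOn_compact (isCompact_Icc.prod isCompact_Icc) ?_
      simp only [coordEquiv_apply]
      have hcoord : Continuous coord := by
        have := continuous_arc
        unfold coord
        fun_prop
      intro p hp
      have hpos := him p (hsub hp)
      refine ContinuousAt.continuousWithinAt (ContinuousAt.fun_smul ?_ ?_)
      · exact ((Complex.continuous_im.comp hcoord).continuousAt.pow 2).inv₀
          (pow_ne_zero 2 hpos.ne')
      · refine ContinuousAt.comp (f := coord) (g := h ∘ ofComplex) ?_ hcoord.continuousAt
        refine hc.continuousAt.comp ?_
        have := UpperHalfPlane.contMDiffAt_ofComplex (n := 0) hpos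
        exact this.continuousAt
  · rintro p ⟨hp, hp'⟩
    have hpos := him p hp
    have : Y ≤ (coord p).im := by
      by_contra! h3
      refine hp' ⟨hp.1, hp.2, ?_⟩
      rw [coord_im] at h3
      linarith [arc_pos (abs_le.2 hp.1)]
    rw [coordEquiv_apply, Function.comp_apply, h0, smul_zero]
    rwa [UpperHalfPlane.ofComplex_apply_of_im_pos hpos]

theorem hasFDerivAt_coord {p : ℝ × ℝ} (hp : |p.1| ≤ 1 / 2) :
    ∃ L : ℝ × ℝ →L[ℝ] ℂ, HasFDerivAt coord L p ∧
      L (1, 0) = 1 + (-p.1 / arc p.1 : ℝ) * Complex.I ∧ L (0, 1) = Complex.I := by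
  have h1 : HasFDerivAt (fun p : ℝ × ℝ => arc p.1 + p.2)
      ((-p.1 / arc p.1) • ContinuousLinearMap.fst ℝ ℝ ℝ + ContinuousLinearMap.snd ℝ ℝ ℝ) p :=
    ((hasDerivAt_arc hp).comp_hasFDerivAt p hasFDerivAt_fst).add hasFDerivAt_snd
  have h2 := (Complex.ofRealCLM.hasFDerivAt.comp p (hasFDerivAt_fst (𝕜 := ℝ) (p := p))).add
    ((Complex.ofRealCLM.hasFDerivAt.comp p h1).mul_const Complex.I)
  refine ⟨_, h2, ?_, ?_⟩ <;> simp [mul_comm]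

/-- **Stokes' theorem** on `SL(2, ℤ) \ ℍ` for a form of weight `2` that vanishes near the cusp. -/
theorem integral_lowering_two_eq_zero {u : ℍ → ℂ} (hu : Smooth u)
    (hT : ∀ z : ℍ, u (ModularGroup.T • z) = u z)
    (hS : ∀ z : ℍ, Complex.normSq z = 1 → u (ModularGroup.S • z) = (z : ℂ) ^ 2 * u z)
    {Y : ℝ} (hY : 0 ≤ Y) (h0 : ∀ z : ℍ, Y ≤ z.im → u z = 0)
    (h0' : ∀ z : ℍ, Y ≤ z.im → lowering 2 u z = 0) :
    ∫ z in ModularGroup.fd, lowering 2 u z = 0 := by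
  rw [setIntegral_fd_eq (hu.lowering 2).continuous hY h0']
  set q : ℍ → ℂ := fun z => ((z.im⁻¹ : ℝ) : ℂ) with hq
  have hqF : ∀ z : ℍ, HasFDerivAt (fun w : ℂ => ((w.im⁻¹ : ℝ) : ℂ))
      (Complex.ofRealCLM.comp ((-(z.im ^ 2)⁻¹) • Complex.imCLM)) (z : ℂ) := fun z =>
    Complex.ofRealCLM.hasFDerivAt.comp (z : ℂ) ((hasDerivAt_inv z.im_ne_zero).comp_hasFDerivAt
      (z : ℂ) Complex.imCLM.hasFDerivAt)
  have hqs : Smooth q := by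
    refine smooth_of_contDiffAt (F := fun w : ℂ => ((w.im⁻¹ : ℝ) : ℂ)) fun z => ?_
    exact Complex.ofRealCLM.contDiff.contDiffAt.comp (z : ℂ) (f := fun w : ℂ => w.im⁻¹)
      (ContDiffAt.inv Complex.imCLM.contDiff.contDiffAt z.im_ne_zero)
  have hqd : ∀ z : ℍ, deriv₂ q z = _ := fun z => deriv₂_restrict (hqF z)
  set W : ℍ → ℂ := u * q with hW
  have hWs : Smooth W := hu.mul hqs
  -- After division by `y²`, the zeroth order term of the weight 2 operator is exactly what the
  -- derivative of `1/y` contributes. So the integrand is a divergence in terms of `W = u/y`.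
  have key : ∀ z : ℍ, ((z.im ^ 2)⁻¹ : ℝ) • lowering 2 u z = Complex.I * dX W z - dY W z := by
    intro z
    have hz : (z.im : ℂ) ≠ 0 := by exact_mod_cast z.im_ne_zero
    rw [hW, dX_mul hu hqs, dY_mul hu hqs, dX_eq q, dY_eq q, hqd, lowering_apply]
    simp [hq]
    field_simp
    ring
  -- In the coordinates `(x, t)` the `x`-derivative of `W` contains `arc' x` times its
  -- `y`-derivative. The imaginary part of `κ` is this slope `-x / arc x` and cancels that term.
  set κ : ℝ → ℂ := fun x => 1 + (-x / arc x : ℝ) * Complex.I with hκ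
  set f : ℝ × ℝ → ℂ := fun p => Complex.I * (W ∘ ofComplex) (coord p) with hf
  set g : ℝ × ℝ → ℂ := fun p => -(κ p.1 * (W ∘ ofComplex) (coord p)) with hg
  have hx : ∀ p ∈ Set.uIcc (-(1 / 2) : ℝ) (1 / 2) ×ˢ Set.uIcc (0 : ℝ) Y,
      |p.1| ≤ 1 / 2 ∧ 0 < (coord p).im := by
    rintro p ⟨h2, h3⟩
    rw [Set.uIcc_of_le (by norm_num)] at h2
    rw [Set.uIcc_of_le hY] at h3
    have h4 := arc_pos (abs_le.2 h2)
    rw [coord_im]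
    exact ⟨abs_le.2 h2, by linarith [h3.1]⟩
  have hdiff : ∀ p : ℝ × ℝ, |p.1| ≤ 1 / 2 ∧ 0 < (coord p).im →
      ∃ f' g' : ℝ × ℝ →L[ℝ] ℂ, HasFDerivAt f f' p ∧ HasFDerivAt g g' p ∧
      f' (1, 0) + g' (0, 1) =
        (((coord p).im ^ 2)⁻¹ : ℝ) • (lowering 2 u ∘ ofComplex) (coord p) := by
    rintro p ⟨h2, h3⟩
    obtain ⟨L, hL, hL1, hL2⟩ := hasFDerivAt_coord h2
    have hW1 := hWs.hasFDerivAt ⟨coord p, h3⟩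
    have hW2 := hW1.comp p hL
    have hκ1 : HasDerivAt (fun x => -x / arc x) _ p.1 :=
      ((hasDerivAt_id p.1).neg).div (hasDerivAt_arc h2) (arc_pos h2).ne'
    have hκ2 : HasFDerivAt (fun p : ℝ × ℝ => κ p.1) _ p :=
      ((Complex.ofRealCLM.hasFDerivAt.comp p (hκ1.comp_hasFDerivAt p
        (hasFDerivAt_fst (𝕜 := ℝ) (p := p)))).mul_const Complex.I).const_add 1
    refine ⟨_, _, hW2.const_mul Complex.I, (hκ2.mul hW2).neg, ?_⟩
    rw [show (lowering 2 u ∘ ofComplex) (coord p) = lowering 2 u ⟨coord p, h3⟩ by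
      rw [Function.comp_apply, UpperHalfPlane.ofComplex_apply_of_im_pos h3]]
    have h4 := key ⟨coord p, h3⟩
    rw [show UpperHalfPlane.im ⟨coord p, h3⟩ = (coord p).im from rfl] at h4
    rw [h4]
    have h5 : ∀ a : ℂ, deriv₂ W ⟨coord p, h3⟩ a = _ := deriv₂_apply W ⟨coord p, h3⟩
    simp [hL1, hL2, h5, hκ]
    ring
  choose! f' g' hf' hg' hfg using hdiff
  have hdiv := integral2_divergence_prod_of_hasFDerivAt_off_countable f g f' g'
    (-(1 / 2)) 0 (1 / 2) Y ∅ Set.countable_empty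
    (fun p hp => (hf' p (hx p hp)).continuousAt.continuousWithinAt)
    (fun p hp => (hg' p (hx p hp)).continuousAt.continuousWithinAt)
    (fun p hp => hf' p (hx p ⟨Set.Ioo_subset_Icc_self hp.1.1, Set.Ioo_subset_Icc_self hp.1.2⟩))
    (fun p hp => hg' p (hx p ⟨Set.Ioo_subset_Icc_self hp.1.1, Set.Ioo_subset_Icc_self hp.1.2⟩))
    ?_
  · have hl : (∫ x in (-(1 / 2) : ℝ)..(1 / 2), ∫ t in (0 : ℝ)..Y,
        (((coord (x, t)).im ^ 2)⁻¹ : ℝ) • (lowering 2 u ∘ ofComplex) (coord (x, t))) =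
        ∫ x in (-(1 / 2) : ℝ)..(1 / 2), ∫ t in (0 : ℝ)..Y,
          f' (x, t) (1, 0) + g' (x, t) (0, 1) := by
      refine intervalIntegral.integral_congr fun x hx' => ?_
      refine intervalIntegral.integral_congr fun t ht' => ?_
      exact (hfg (x, t) (hx _ ⟨hx', ht'⟩)).symm
    have htop : ∫ x in (-(1 / 2) : ℝ)..(1 / 2), g (x, Y) = 0 := by
      refine (intervalIntegral.integral_congr (g := fun _ => (0 : ℂ)) fun x hx' => ?_).trans
        (by simp)
      have h2 := hx (x, Y) ⟨hx', Set.right_mem_uIcc⟩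
      have h3 : u ⟨coord (x, Y), h2.2⟩ = 0 := by
        refine h0 _ ?_
        change Y ≤ (coord (x, Y)).im
        rw [coord_im]
        linarith [arc_pos h2.1]
      simp [hg, hW, UpperHalfPlane.ofComplex_apply_of_im_pos h2.2, h3]
    -- The integrand is odd: `S` maps the point `z` of the arc over `x` to the one over `-x`, and `κ
    -- x = -iz / arc x` with `|z| = 1` gives `κ(-x) z² = -κ x`.
    have hbot : ∫ x in (-(1 / 2) : ℝ)..(1 / 2), g (x, 0) = 0 := by
      have h1 := intervalIntegral.integral_comp_neg (a := -(1 / 2)) (b := 1 / 2)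
        (fun x => g (x, 0))
      rw [neg_neg] at h1
      have h2 : ∫ x in (-(1 / 2) : ℝ)..(1 / 2), g (-x, 0) =
          ∫ x in (-(1 / 2) : ℝ)..(1 / 2), -g (x, 0) := by
        refine intervalIntegral.integral_congr fun x hx' => ?_
        have hx1 := hx (x, 0) ⟨hx', Set.left_mem_uIcc⟩
        have hx2 : |-x| ≤ 1 / 2 ∧ 0 < (coord (-x, 0)).im := by
          refine ⟨by simpa using hx1.1, ?_⟩
          have := hx1.2
          rw [coord_im] at this ⊢
          rwa [arc_neg]
        have hn : Complex.normSq (coord (x, 0)) = 1 := by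
          have := arc_sq hx1.1
          rw [Complex.normSq_apply, coord_re, coord_im]
          simp only [add_zero] at this ⊢
          linarith
        have hc : coord (x, 0) ≠ 0 := by
          intro h
          rw [h] at hn
          simp at hn
        have hSz : ModularGroup.S • (⟨coord (x, 0), hx1.2⟩ : ℍ) = ⟨coord (-x, 0), hx2.2⟩ := by
          refine UpperHalfPlane.ext ?_
          rw [UpperHalfPlane.modular_S_smul]
          change (-coord (x, 0))⁻¹ = coord (-x, 0)
          rw [inv_neg, Complex.inv_def, hn]
          apply Complex.ext <;> simp [coord, arc_neg]
        have hS1 := hS ⟨coord (x, 0), hx1.2⟩ hn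
        rw [hSz] at hS1
        have ha : (arc x : ℂ) ≠ 0 := by exact_mod_cast (arc_pos hx1.1).ne'
        have ha2 : (arc x : ℂ) ^ 2 = 1 - x ^ 2 := by exact_mod_cast arc_sq hx1.1
        have hcx : coord (x, 0) = x + arc x * Complex.I := by simp [coord]
        simp only [hg, hW, hq, Function.comp_apply,
          UpperHalfPlane.ofComplex_apply_of_im_pos hx1.2,
          UpperHalfPlane.ofComplex_apply_of_im_pos hx2.2, Pi.mul_apply, hS1, hκ]
        rw [show UpperHalfPlane.im ⟨coord (x, 0), hx1.2⟩ = (coord (x, 0)).im from rfl,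
          show UpperHalfPlane.im ⟨coord (-x, 0), hx2.2⟩ = (coord (-x, 0)).im from rfl]
        generalize u ⟨coord (x, 0), hx1.2⟩ = U
        rw [coord_im, coord_im, arc_neg, hcx]
        push_cast
        rw [add_zero]
        have hI := Complex.I_sq
        field_simp
        linear_combination (exp := 1) (-U * (x + arc x * Complex.I) * x * arc x - U * arc x) * hI -
          U * (x + arc x * Complex.I) * Complex.I * ha2
      rw [h2, intervalIntegral.integral_neg] at h1
      linear_combination (-1 / 2 : ℂ) * h1
    have hsides : ∫ y in (0 : ℝ)..Y, f (1 / 2, y) = ∫ y in (0 : ℝ)..Y, f (-(1 / 2), y) := by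
      refine intervalIntegral.integral_congr fun t ht => ?_
      have h1 := hx (-(1 / 2), t) ⟨Set.left_mem_uIcc, ht⟩
      have h2 := hx (1 / 2, t) ⟨Set.right_mem_uIcc, ht⟩
      have h3 : ModularGroup.T • (⟨coord (-(1 / 2), t), h1.2⟩ : ℍ) = ⟨coord (1 / 2, t), h2.2⟩ := by
        refine UpperHalfPlane.ext ?_
        rw [UpperHalfPlane.modular_T_smul]
        simp only [UpperHalfPlane.coe_vadd, coord, arc_neg]
        push_cast
        ring
      have h4 := hT ⟨coord (-(1 / 2), t), h1.2⟩
      rw [h3] at h4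
      simp only [hf, hW, hq, Function.comp_apply, UpperHalfPlane.ofComplex_apply_of_im_pos h1.2,
        UpperHalfPlane.ofComplex_apply_of_im_pos h2.2, Pi.mul_apply, h4]
      generalize u ⟨coord (-(1 / 2), t), h1.2⟩ = U
      rw [show UpperHalfPlane.im ⟨coord (-(1 / 2), t), h1.2⟩ = (coord (-(1 / 2), t)).im from rfl,
        show UpperHalfPlane.im ⟨coord (1 / 2, t), h2.2⟩ = (coord (1 / 2, t)).im from rfl,
        coord_im, coord_im, arc_neg]
    rw [hl, hdiv, htop, hbot, hsides]
    simp
  · have hcoord : Continuous coord := by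
      have := continuous_arc
      unfold coord
      fun_prop
    have hcont : ContinuousOn (fun p => (((coord p).im ^ 2)⁻¹ : ℝ) •
        (lowering 2 u ∘ ofComplex) (coord p))
        (Set.uIcc (-(1 / 2) : ℝ) (1 / 2) ×ˢ Set.uIcc (0 : ℝ) Y) := by
      intro p hp
      have hpos := (hx p hp).2
      refine ContinuousAt.continuousWithinAt (ContinuousAt.fun_smul ?_ ?_)
      · exact ((Complex.continuous_im.comp hcoord).continuousAt.pow 2).inv₀
          (pow_ne_zero 2 hpos.ne')
      · exact ContinuousAt.comp (f := coord) (g := lowering 2 u ∘ ofComplex)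
          ((hu.lowering 2).contDiffAt ⟨coord p, hpos⟩).continuousAt hcoord.continuousAt
    refine (hcont.congr fun p hp => hfg p (hx p hp)).integrableOn_compact
      (isCompact_uIcc.prod isCompact_uIcc)

/-! ### Cut-off functions -/

/-- A cut-off function equal to `1` on `(-∞, Y]` and to `0` on `[2Y, ∞)`. -/
def cutoff (Y t : ℝ) : ℝ := Real.smoothTransition (2 - t / Y)

theorem contDiff_cutoff (Y : ℝ) : ContDiff ℝ ∞ (cutoff Y) :=
  Real.smoothTransition.contDiff.comp (contDiff_const.sub (contDiff_id.div_const Y))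

theorem cutoff_nonneg (Y t : ℝ) : 0 ≤ cutoff Y t := Real.smoothTransition.nonneg _

theorem cutoff_le_one (Y t : ℝ) : cutoff Y t ≤ 1 := Real.smoothTransition.le_one _

theorem cutoff_eq_one {Y t : ℝ} (hY : 0 < Y) (h : t ≤ Y) : cutoff Y t = 1 :=
  Real.smoothTransition.one_of_one_le (by have := (div_le_one hY).2 h; linarith)

theorem cutoff_eq_zero {Y t : ℝ} (hY : 0 < Y) (h : 2 * Y ≤ t) : cutoff Y t = 0 :=
  Real.smoothTransition.zero_of_nonpos (by have := (le_div_iff₀ hY).2 h; linarith)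

theorem deriv_cutoff_eq_zero {Y t : ℝ} (hY : 0 < Y) (h : t < Y) : deriv (cutoff Y) t = 0 := by
  have : cutoff Y =ᶠ[𝓝 t] fun _ => 1 := by
    filter_upwards [eventually_lt_nhds h] with s hs using cutoff_eq_one hY hs.le
  rw [this.deriv_eq, deriv_const]

/-- The quantity depends on `t / Y` alone and vanishes for `t / Y` outside `[1, 2]`. Uniformity in
`Y` is what controls the error terms in the integrations by parts. -/
theorem exists_bound_cutoff : ∃ C : ℝ, 0 ≤ C ∧ ∀ Y t : ℝ, 0 < Y →
    |t * deriv (cutoff Y) t| ≤ C := by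
  have hc : Continuous fun s : ℝ => s * deriv Real.smoothTransition (2 - s) :=
    continuous_id.mul ((Real.smoothTransition.contDiff (n := 1)).continuous_deriv_one.comp
      (by fun_prop))
  obtain ⟨C, hC⟩ := (isCompact_Icc (a := (1 : ℝ)) (b := 2)).exists_bound_of_continuousOn
    hc.continuousOn
  have hC0 : 0 ≤ C := (norm_nonneg _).trans (hC 1 ⟨le_rfl, by norm_num⟩)
  refine ⟨C, hC0, fun Y t hY => ?_⟩
  have hd : deriv (cutoff Y) t = deriv Real.smoothTransition (2 - t / Y) * (-(1 / Y)) := by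
    have h1 : HasDerivAt (fun t : ℝ => 2 - t / Y) (-(1 / Y)) t :=
      ((hasDerivAt_id t).div_const Y).const_sub 2
    have h2 : HasDerivAt Real.smoothTransition (deriv Real.smoothTransition (2 - t / Y))
        (2 - t / Y) :=
      (((Real.smoothTransition.contDiff (n := 1)).differentiable (by simp)) _).hasDerivAt
    exact (h2.comp t h1).deriv
  have he : t * deriv (cutoff Y) t =
      -(t / Y * deriv Real.smoothTransition (2 - t / Y)) := by rw [hd]; ring
  rw [he, abs_neg]
  by_cases h1 : t / Y ∈ Set.Icc (1 : ℝ) 2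
  · exact hC _ h1
  · have h0 : deriv Real.smoothTransition (2 - t / Y) = 0 := by
      rw [Set.mem_Icc, not_and_or, not_le, not_le] at h1
      rcases h1 with h1 | h1
      · have : Real.smoothTransition =ᶠ[𝓝 (2 - t / Y)] fun _ => 1 := by
          filter_upwards [eventually_gt_nhds (show 1 < 2 - t / Y by linarith)] with s hs using
            Real.smoothTransition.one_of_one_le hs.le
        rw [this.deriv_eq, deriv_const]
      · have : Real.smoothTransition =ᶠ[𝓝 (2 - t / Y)] fun _ => 0 := by
          filter_upwards [eventually_lt_nhds (show 2 - t / Y < 0 by linarith)] with s hs using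
            Real.smoothTransition.zero_of_nonpos hs.le
        rw [this.deriv_eq, deriv_const]
    rw [h0, mul_zero, abs_zero]
    exact hC0

/-! ### Integration by parts on the fundamental domain -/

/-- `f` transforms with weight `k` and multiplier `v` under `SL(2, ℤ)`. -/
def IsModular (k : ℤ) (v : SL(2, ℤ) → ℂ) (f : ℍ → ℂ) : Prop :=
  ∀ (A : SL(2, ℤ)) (z : ℍ), f (act A z) = v A * uden A z ^ k * f z

theorem IsMaassForm.isModular {k : ℤ} {v : SL(2, ℤ) → ℂ} {R : ℝ} {f : ℍ → ℂ}
    (hf : IsMaassForm k v R f) : IsModular k v f := hf.map_act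

theorem IsModular.lowering {k : ℤ} {v : SL(2, ℤ) → ℂ} {f : ℍ → ℂ} (hs : Smooth f)
    (hf : IsModular k v f) : IsModular (k - 2) v (lowering k f) :=
  fun A z => lowering_map_act hs (det_SL A) (hf A) z

theorem uden_T (z : ℍ) : uden (ModularGroup.T : SL(2, ℤ)) z = 1 := by
  simp [uden, den, ModularGroup.T]

theorem uden_S (z : ℍ) (hz : Complex.normSq z = 1) :
    uden (ModularGroup.S : SL(2, ℤ)) z = z := by
  have : ‖(z : ℂ)‖ = 1 := by
    rw [Complex.normSq_eq_norm_sq] at hz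
    exact (pow_eq_one_iff_of_nonneg (norm_nonneg _) two_ne_zero).1 hz
  simp [uden, den, ModularGroup.S, this]

theorem integrableOn_fd_of_vanish {E : Type*} [NormedAddCommGroup E] {h : ℍ → E}
    (hc : Continuous h) {Y : ℝ} (h0 : ∀ z : ℍ, Y ≤ z.im → h z = 0) :
    IntegrableOn h ModularGroup.fd := by
  refine IntegrableOn.of_forall_sdiff_eq_zero (s := ModularGroup.truncatedFundamentalDomain Y)
    (hc.continuousOn.integrableOn_compact
      (ModularGroup.isCompact_truncatedFundamentalDomain Y)) measurableSet_fd fun z hz => ?_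
  refine h0 z ?_
  by_contra! h
  exact hz.2 ⟨hz.1, h.le⟩

section
variable {j : ℤ} {v : SL(2, ℤ) → ℂ} (hv : ∀ A, ‖v A‖ = 1) {f g : ℍ → ℂ}
  (hf : Smooth f) (hg : Smooth g) (hfm : IsModular j v f) (hgm : IsModular (j - 2) v g)
include hv hf hg hfm hgm

/-- Stokes' theorem for `ψ(y) f ḡ`, where `f ḡ` has weight 2 and trivial multiplier. The cut-off is
not modular, but it is invariant under `T`, and under `S` on the arc `|z| = 1`; the boundary terms
need no more. -/
theorem integral_cutoff_lowering {ψ : ℝ → ℝ} (hψ : ContDiff ℝ ∞ ψ) {Y : ℝ} (hY : 0 < Y)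
    (h0 : ∀ t, Y ≤ t → ψ t = 0) :
    ∫ z in ModularGroup.fd, ψ z.im *
      (lowering j f z * conj (g z) - f z * conj (raising (j - 2) g z)) =
    ∫ z in ModularGroup.fd, (z.im * deriv ψ z.im : ℝ) * (f z * conj (g z)) := by
  set p : ℍ → ℂ := f * fun z => conj (g z) with hp
  have hps : Smooth p := hf.mul hg.conj
  set u : ℍ → ℂ := (fun z : ℍ => (ψ z.im : ℂ)) * p with hu
  have hus : Smooth u := (smooth_ofReal_im hψ).mul hps
  have hlow : ∀ z, lowering 2 u z = ψ z.im *
      (lowering j f z * conj (g z) - f z * conj (raising (j - 2) g z)) -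
      (z.im * deriv ψ z.im : ℝ) * (f z * conj (g z)) := by
    intro z
    rw [hu, lowering_ofReal_im_mul hps hψ, hp, lowering_mul_conj hf hg j]
    simp
  -- One unit of room leaves a neighbourhood of `t` on which `ψ` vanishes; Stokes' theorem is
  -- therefore used at height `Y + 1`.
  have h0' : ∀ t, Y + 1 ≤ t → deriv ψ t = 0 := by
    intro t ht
    have : ψ =ᶠ[𝓝 t] fun _ => 0 := by
      filter_upwards [eventually_gt_nhds (show Y < t by linarith)] with s hs using h0 s hs.le
    rw [this.deriv_eq, deriv_const]
  have hpm : ∀ (A : SL(2, ℤ)) z, p (A • z) = uden A z ^ 2 * p z := by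
    intro A z
    have hu0 := uden_ne_zero (det_SL A) z
    have hvA : v A * conj (v A) = 1 := by
      rw [Complex.mul_conj, Complex.normSq_eq_norm_sq, hv]; simp
    have h1 : uden A z ^ j * conj (uden A z ^ (j - 2)) = uden A z ^ 2 := by
      rw [map_zpow₀, conj_uden (det_SL A), inv_zpow, zpow_sub₀ hu0, zpow_ofNat]
      have := zpow_ne_zero j hu0
      field_simp
    rw [← act_SL]
    simp only [hp, Pi.mul_apply, hfm A z, hgm A z, map_mul]
    linear_combination (uden A z ^ j * conj (uden A z ^ (j - 2)) * f z * conj (g z)) * hvA +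
      f z * conj (g z) * h1
  have hst := integral_lowering_two_eq_zero hus (Y := Y + 1) ?_ ?_ (by linarith) ?_ ?_
  · simp only [hlow] at hst
    rwa [integral_sub, sub_eq_zero] at hst
    · refine integrableOn_fd_of_vanish (Y := Y) ?_ fun z hz => by rw [h0 _ hz]; simp
      have h1 : ∀ z, (ψ z.im : ℂ) *
          (lowering j f z * conj (g z) - f z * conj (raising (j - 2) g z)) =
          ψ z.im * lowering 2 p z := fun z => by rw [lowering_mul_conj hf hg j]
      simp only [h1]
      exact ((smooth_ofReal_im hψ).mul (hps.lowering 2)).continuous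
    · refine integrableOn_fd_of_vanish (Y := Y + 1) ?_ fun z hz => by rw [h0' _ hz]; simp
      refine (Complex.continuous_ofReal.comp (UpperHalfPlane.continuous_im.mul
        ((hψ.continuous_deriv (by simp)).comp UpperHalfPlane.continuous_im))).mul hps.continuous
  · intro z
    simp only [hu, Pi.mul_apply]
    rw [hpm, uden_T, ModularGroup.im_T_smul]
    simp
  · intro z hz
    have h1 : (ModularGroup.S • z).im = z.im := by
      rw [ModularGroup.im_smul_eq_div_normSq, ModularGroup.denom_S, hz, div_one]
    simp only [hu, Pi.mul_apply]
    rw [hpm, uden_S z hz, h1]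
    ring
  · intro z hz
    simp [hu, h0 z.im (by linarith)]
  · intro z hz
    rw [hlow, h0 _ (by linarith), h0' _ hz]
    simp

/-- The lowering operator is adjoint to the raising operator. -/
theorem petersson_lowering (hf2 : MemLp f 2 (volume.restrict ModularGroup.fd))
    (hg2 : MemLp g 2 (volume.restrict ModularGroup.fd))
    (hf2' : MemLp (lowering j f) 2 (volume.restrict ModularGroup.fd))
    (hg2' : MemLp (raising (j - 2) g) 2 (volume.restrict ModularGroup.fd)) :
    petersson (lowering j f) g = petersson f (raising (j - 2) g) := by
  obtain ⟨C, hC0, hC⟩ := exists_bound_cutoff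
  have i1 := hf2'.integrable_mul hg2.star
  have i2 := hf2.integrable_mul hg2'.star
  have i3 := hf2.integrable_mul hg2.star
  have hpos : ∀ n : ℕ, (0 : ℝ) < n + 1 := fun n => by positivity
  have key := fun n : ℕ => integral_cutoff_lowering hv hf hg hfm hgm
    (contDiff_cutoff ((n : ℝ) + 1)) (Y := 2 * (n + 1)) (by have := hpos n; linarith)
    (fun t ht => cutoff_eq_zero (hpos n) ht)
  have hev : ∀ z : ℍ, ∀ᶠ n : ℕ in atTop, z.im < (n : ℝ) + 1 := by
    intro z
    filter_upwards [eventually_gt_atTop ⌈z.im⌉₊] with n hn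
    have := Nat.le_ceil z.im
    have : (⌈z.im⌉₊ : ℝ) < n := by exact_mod_cast hn
    linarith
  have l1 : Tendsto (fun n : ℕ => ∫ z in ModularGroup.fd, (cutoff ((n : ℝ) + 1) z.im : ℂ) *
      (lowering j f z * conj (g z) - f z * conj (raising (j - 2) g z))) atTop
      (𝓝 (∫ z in ModularGroup.fd,
        (lowering j f z * conj (g z) - f z * conj (raising (j - 2) g z)))) := by
    refine tendsto_integral_of_dominated_convergence
      (fun z => ‖lowering j f z * conj (g z) - f z * conj (raising (j - 2) g z)‖)
      (fun n => ?_) (i1.sub i2).norm (fun n => Eventually.of_forall fun z => ?_)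
      (Eventually.of_forall fun z => ?_)
    · exact (smooth_ofReal_im (contDiff_cutoff _)).continuous.aestronglyMeasurable.mul
        (i1.sub i2).aestronglyMeasurable
    · rw [norm_mul, Complex.norm_real, Real.norm_of_nonneg (cutoff_nonneg _ _)]
      exact mul_le_of_le_one_left (norm_nonneg _) (cutoff_le_one _ _)
    · refine tendsto_const_nhds.congr' ?_
      filter_upwards [hev z] with n hn
      rw [cutoff_eq_one (hpos n) hn.le, Complex.ofReal_one, one_mul]
  -- At a fixed `z` the derivative of the cut-off is eventually zero, and `C · |f ḡ|` dominates
  -- uniformly in `n`.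
  have l2 : Tendsto (fun n : ℕ => ∫ z in ModularGroup.fd,
      ((z.im * deriv (cutoff ((n : ℝ) + 1)) z.im : ℝ) : ℂ) * (f z * conj (g z))) atTop
      (𝓝 (∫ _ in ModularGroup.fd, (0 : ℂ))) := by
    refine tendsto_integral_of_dominated_convergence
      (fun z => C * ‖f z * conj (g z)‖)
      (fun n => ?_) (i3.norm.const_mul C) (fun n => Eventually.of_forall fun z => ?_)
      (Eventually.of_forall fun z => ?_)
    · exact (Complex.continuous_ofReal.comp (UpperHalfPlane.continuous_im.mul
        (((contDiff_cutoff _).continuous_deriv (by simp)).comp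
          UpperHalfPlane.continuous_im))).aestronglyMeasurable.mul i3.aestronglyMeasurable
    · rw [norm_mul, Complex.norm_real]
      exact mul_le_mul_of_nonneg_right (hC _ _ (hpos n)) (norm_nonneg _)
    · refine tendsto_const_nhds.congr' ?_
      filter_upwards [hev z] with n hn
      rw [deriv_cutoff_eq_zero (hpos n) hn, mul_zero, Complex.ofReal_zero, zero_mul]
  simp only [key] at l1
  have h := tendsto_nhds_unique l1 l2
  rw [integral_zero] at h
  exact sub_eq_zero.1 ((integral_sub i1 i2).symm.trans h)

end

/-! ### Square integrability of lowered Maass forms -/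

theorem IsMaassForm.raising_lowering {k : ℤ} {v : SL(2, ℤ) → ℂ} {R : ℝ} {f : ℍ → ℂ}
    (hf : IsMaassForm k v R f) (z : ℍ) :
    raising (k - 2) (lowering k f) z = ((R ^ 2 + (((k : ℝ) - 1) / 2) ^ 2 : ℝ) : ℂ) * f z := by
  rw [EtaMaass.raising_lowering hf.smooth]
  push_cast
  linear_combination -hf.eigen z

/-- The lowering operator preserves square integrability of Maass forms. -/
theorem IsMaassForm.memLp_lowering {k : ℤ} {v : SL(2, ℤ) → ℂ} (hv : ∀ A, ‖v A‖ = 1) {R : ℝ}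
    {f : ℍ → ℂ} (hf : IsMaassForm k v R f) :
    MemLp (EtaMaass.lowering k f) 2 (volume.restrict ModularGroup.fd) := by
  obtain ⟨C, hC0, hC⟩ := exists_bound_cutoff
  set e := EtaMaass.lowering k f with he
  set c : ℝ := R ^ 2 + (((k : ℝ) - 1) / 2) ^ 2 with hc
  have hc0 : 0 ≤ c := by positivity
  have hes : Smooth e := hf.smooth.lowering k
  have if2 : IntegrableOn (fun z => ‖f z‖ ^ 2) ModularGroup.fd :=
    (memLp_two_iff_integrable_sq_norm hf.smooth.continuous.aestronglyMeasurable).1 hf.memLp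
  set N := ∫ z in ModularGroup.fd, ‖f z‖ ^ 2 with hN
  -- A Caccioppoli estimate. Stokes with `ψ = cutoff²` gives `∫ ψ|e|² = c ∫ ψ|f|² + ∫ y ψ' f ē`. As
  -- `ψ'` retains a factor `cutoff`, the last integral is at most `½ ∫ ψ|e|² + 2C² N`; absorbing the
  -- first half on the left gives the constant.
  have bound : ∀ Y : ℝ, 0 < Y → ∫ z in ModularGroup.fd, (cutoff Y z.im * ‖e z‖) ^ 2 ≤
      2 * (c + 2 * C ^ 2) * N := by
    intro Y hY
    have hψ : ContDiff ℝ ∞ (fun t => cutoff Y t ^ 2) := (contDiff_cutoff Y).pow 2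
    have hd : ∀ t, deriv (fun t => cutoff Y t ^ 2) t = 2 * cutoff Y t * deriv (cutoff Y) t := by
      intro t
      have := (((contDiff_cutoff Y).differentiable (by simp)) t).hasDerivAt.pow 2
      rw [HasDerivAt.deriv (f := fun t => cutoff Y t ^ 2) this]
      ring
    have h1 := integral_cutoff_lowering hv hf.smooth hes hf.isModular
      (hf.isModular.lowering hf.smooth) hψ (Y := 2 * Y) (by linarith)
      (fun t ht => by rw [cutoff_eq_zero hY ht]; simp)
    have h2 : ∀ z : ℍ, ((cutoff Y z.im ^ 2 : ℝ) : ℂ) *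
        (e z * conj (e z) - f z * conj (raising (k - 2) e z)) =
        (((cutoff Y z.im * ‖e z‖) ^ 2 - c * (cutoff Y z.im ^ 2 * ‖f z‖ ^ 2) : ℝ) : ℂ) := by
      intro z
      rw [he, hf.raising_lowering, ← he, ← hc, map_mul, Complex.conj_ofReal]
      have ha := Complex.mul_conj (e z)
      have hb := Complex.mul_conj (f z)
      rw [Complex.normSq_eq_norm_sq] at ha hb
      push_cast at ha hb ⊢
      linear_combination (cutoff Y z.im : ℂ) ^ 2 * ha - (cutoff Y z.im : ℂ) ^ 2 * c * hb
    simp only [← he, h2, hd] at h1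
    rw [integral_complex_ofReal] at h1
    have hcut : Continuous fun z : ℍ => cutoff Y z.im :=
      (contDiff_cutoff Y).continuous.comp UpperHalfPlane.continuous_im
    have hdcut : Continuous fun z : ℍ => deriv (cutoff Y) z.im :=
      ((contDiff_cutoff Y).continuous_deriv (by simp)).comp UpperHalfPlane.continuous_im
    have i1 : IntegrableOn (fun z : ℍ => (cutoff Y z.im * ‖e z‖) ^ 2) ModularGroup.fd :=
      integrableOn_fd_of_vanish (Y := 2 * Y) ((hcut.mul hes.continuous.norm).pow 2)
        fun z hz => by rw [cutoff_eq_zero hY hz]; simp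
    have i2 : IntegrableOn (fun z : ℍ => cutoff Y z.im ^ 2 * ‖f z‖ ^ 2) ModularGroup.fd :=
      integrableOn_fd_of_vanish (Y := 2 * Y) ((hcut.pow 2).mul (hf.smooth.continuous.norm.pow 2))
        fun z hz => by rw [cutoff_eq_zero hY hz]; simp
    rw [integral_sub i1 (i2.const_mul c), integral_const_mul] at h1
    have h3 : ∫ z in ModularGroup.fd, cutoff Y z.im ^ 2 * ‖f z‖ ^ 2 ≤ N := by
      refine integral_mono i2 if2 fun z => mul_le_of_le_one_left (by positivity) ?_
      exact pow_le_one₀ (cutoff_nonneg _ _) (cutoff_le_one _ _)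
    have h4 : ‖∫ z in ModularGroup.fd, ((z.im * (2 * cutoff Y z.im * deriv (cutoff Y) z.im) : ℝ)
        : ℂ) * (f z * conj (e z))‖ ≤
        ∫ z in ModularGroup.fd, (1 / 2 * (cutoff Y z.im * ‖e z‖) ^ 2 + 2 * C ^ 2 * ‖f z‖ ^ 2) := by
      refine norm_integral_le_of_norm_le ((i1.const_mul _).add (if2.const_mul _))
        (Eventually.of_forall fun z => ?_)
      rw [norm_mul, norm_mul, Complex.norm_real, RCLike.norm_conj]
      have h5 := hC Y z.im hY
      have h6 : ‖z.im * (2 * cutoff Y z.im * deriv (cutoff Y) z.im)‖ =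
          2 * cutoff Y z.im * |z.im * deriv (cutoff Y) z.im| := by
        rw [show z.im * (2 * cutoff Y z.im * deriv (cutoff Y) z.im) =
          2 * cutoff Y z.im * (z.im * deriv (cutoff Y) z.im) by ring, norm_mul,
          Real.norm_of_nonneg (by have := cutoff_nonneg Y z.im; linarith), Real.norm_eq_abs]
      rw [h6]
      have h7 := cutoff_nonneg Y z.im
      have h8 := norm_nonneg (f z)
      have h9 := norm_nonneg (e z)
      calc 2 * cutoff Y z.im * |z.im * deriv (cutoff Y) z.im| * (‖f z‖ * ‖e z‖)
          ≤ 2 * cutoff Y z.im * C * (‖f z‖ * ‖e z‖) := by gcongr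
        _ ≤ _ := by nlinarith [sq_nonneg (cutoff Y z.im * ‖e z‖ - 2 * C * ‖f z‖)]
    rw [← h1, Complex.norm_real, integral_add (i1.const_mul _) (if2.const_mul _),
      integral_const_mul, integral_const_mul] at h4
    have h5 := (le_abs_self _).trans h4
    have h6 := mul_le_mul_of_nonneg_left h3 hc0
    rw [← hN] at h5
    linarith
  rw [memLp_two_iff_integrable_sq_norm hes.continuous.aestronglyMeasurable]
  refine ⟨(hes.continuous.norm.pow 2).aestronglyMeasurable, ?_⟩
  have hpos : ∀ n : ℕ, (0 : ℝ) < n + 1 := fun n => by positivity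
  have hm : ∀ n : ℕ, Continuous fun z : ℍ => (cutoff ((n : ℝ) + 1) z.im * ‖e z‖) ^ 2 := fun n =>
    ((((contDiff_cutoff _).continuous.comp UpperHalfPlane.continuous_im).mul
      hes.continuous.norm).pow 2)
  -- Fatou's lemma transfers the bound, which does not depend on `Y`, to the limit `Y = n + 1 → ∞`.
  have hF := lintegral_liminf_le (μ := volume.restrict ModularGroup.fd)
    (u := atTop) (f := fun (n : ℕ) (z : ℍ) => ENNReal.ofReal ((cutoff ((n : ℝ) + 1) z.im * ‖e z‖) ^ 2))
    (fun n => (ENNReal.continuous_ofReal.comp (hm n)).measurable)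
  have hlim : ∀ z : ℍ, liminf (fun n : ℕ =>
      ENNReal.ofReal ((cutoff ((n : ℝ) + 1) z.im * ‖e z‖) ^ 2)) atTop = ‖‖e z‖ ^ 2‖ₑ := by
    intro z
    refine Tendsto.liminf_eq (tendsto_const_nhds.congr' ?_)
    filter_upwards [eventually_gt_atTop ⌈z.im⌉₊] with n hn
    have h1 := Nat.le_ceil z.im
    have h2 : (⌈z.im⌉₊ : ℝ) < n := by exact_mod_cast hn
    rw [cutoff_eq_one (hpos n) (by linarith), one_mul, Real.enorm_eq_ofReal (by positivity)]
  simp only [hlim] at hF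
  refine lt_of_le_of_lt hF ?_
  refine lt_of_le_of_lt (liminf_le_of_le (f := atTop) (by isBoundedDefault) (a :=
    ENNReal.ofReal (2 * (c + 2 * C ^ 2) * N)) fun b hb => ?_) ENNReal.ofReal_lt_top
  obtain ⟨n, hn⟩ := hb.exists
  refine hn.trans ?_
  rw [← ofReal_integral_eq_lintegral_ofReal]
  · exact ENNReal.ofReal_le_ofReal (bound _ (hpos n))
  · exact integrableOn_fd_of_vanish (Y := 2 * ((n : ℝ) + 1)) (hm n)
        fun z hz => by rw [cutoff_eq_zero (hpos n) hz]; simp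
  · exact Eventually.of_forall fun z => by positivity

theorem IsModular.slash {k : ℤ} {v : SL(2, ℤ) → ℂ} {f : ℍ → ℂ} (hf : IsModular k v f)
    (A : SL(2, ℤ)) (z : ℍ) : (autFactor k A z)⁻¹ * f (A • z) = v A * f z :=
  (slash_iff A z).2 (hf A z)

theorem IsMaassForm.laplacian_eq {k : ℤ} {v : SL(2, ℤ) → ℂ} {R : ℝ} {f : ℍ → ℂ}
    (hf : IsMaassForm k v R f) : laplacian k f = (-(1 / 4 + (R : ℂ) ^ 2)) • f := by
  ext z
  have := hf.eigen z
  rw [Pi.smul_apply, smul_eq_mul]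
  linear_combination this

theorem eigen_of_laplacian_eq {k : ℤ} {R : ℝ} {f : ℍ → ℂ}
    (h : laplacian k f = (-(1 / 4 + (R : ℂ) ^ 2)) • f) (z : ℍ) :
    laplacian k f z + (1 / 4 + (R : ℂ) ^ 2) * f z = 0 := by
  rw [h, Pi.smul_apply, smul_eq_mul]; ring

theorem IsMaassForm.lowering {k : ℤ} {v : SL(2, ℤ) → ℂ} (hv : ∀ A, ‖v A‖ = 1) {R : ℝ}
    {f : ℍ → ℂ} (hf : IsMaassForm k v R f) :
    IsMaassForm (k - 2) v R (EtaMaass.lowering k f) where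
  smooth := hf.smooth.lowering k
  slash := (hf.isModular.lowering hf.smooth).slash
  eigen := eigen_of_laplacian_eq (by
    rw [laplacian_lowering hf.smooth, hf.laplacian_eq, lowering_const_smul hf.smooth])
  memLp := hf.memLp_lowering hv

/-! ### Reflection of Maass forms -/

/-- Conjugation of an integral matrix by `diag(-1, 1)`. -/
def flip (M : Mat) : Mat := !![M 0 0, -M 0 1; -M 1 0, M 1 1]

theorem det_flip (M : Mat) : (flip M).det = M.det := by
  simp [flip, Matrix.det_fin_two]

theorem flip_flip (M : Mat) : flip (flip M) = M := by
  ext i j; fin_cases i <;> fin_cases j <;> simp [flip]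

theorem flip_mul (M N : Mat) : flip (M * N) = flip M * flip N := by
  ext i j
  fin_cases i <;> fin_cases j <;> simp [flip, Matrix.mul_apply, Fin.sum_univ_two] <;> ring

/-- Conjugation by `diag(-1, 1)` on `SL(2, ℤ)`. -/
def flipSL (A : SL(2, ℤ)) : SL(2, ℤ) := ⟨flip A, by rw [det_flip, A.det_coe]⟩

theorem coe_flipSL (A : SL(2, ℤ)) : (flipSL A : Mat) = flip A := rfl

theorem den_flip (M : Mat) (z : ℍ) : den (flip M) (negConj z) = conj (den M z) := by
  simp [den, flip, coe_negConj]

theorem uden_flip (M : Mat) (z : ℍ) : uden (flip M) (negConj z) = conj (uden M z) := by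
  rw [uden, uden, den_flip, RCLike.norm_conj, map_mul, Complex.conj_ofReal]

theorem act_flip {M : Mat} (hM : 0 < M.det) (z : ℍ) :
    act (flip M) (negConj z) = negConj (act M z) := by
  refine UpperHalfPlane.ext ?_
  rw [coe_act (by rwa [det_flip]), coe_negConj, coe_negConj, coe_act hM]
  simp [flip, ← neg_div]
  ring_nf

/-- Reflection conjugates `A` by `diag(-1, 1)` and complex conjugates the unimodular automorphy
factor, which inverts it. -/
theorem IsModular.reflect {k : ℤ} {v : SL(2, ℤ) → ℂ} {f : ℍ → ℂ} (hf : IsModular k v f) :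
    IsModular (-k) (fun A => v (flipSL A)) (reflect f) := by
  intro A z
  rw [reflect_apply, reflect_apply, ← act_flip (det_SL A), ← coe_flipSL, hf, coe_flipSL, uden_flip,
    conj_uden (det_SL A), inv_zpow, zpow_neg]

theorem measurePreserving_negConj : MeasurePreserving negConj := by
  have h : negConj = fun z => UpperHalfPlane.J • z := by
    ext z
    rw [UpperHalfPlane.coe_J_smul, coe_negConj]
  rw [h]
  exact measurePreserving_smul UpperHalfPlane.J volume

theorem negConj_preimage_fd : negConj ⁻¹' ModularGroup.fd = ModularGroup.fd := by
  ext z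
  have h1 : (negConj z).re = -z.re := by
    rw [← UpperHalfPlane.coe_re, coe_negConj]; simp
  simp only [ModularGroup.fd, Set.mem_preimage, Set.mem_ofPred_eq, h1, coe_negConj, abs_neg,
    Complex.normSq_neg, Complex.normSq_conj]

theorem measurePreserving_negConj_fd : MeasurePreserving negConj
    (volume.restrict ModularGroup.fd) (volume.restrict ModularGroup.fd) := by
  have := measurePreserving_negConj.restrict_preimage measurableSet_fd
  rwa [negConj_preimage_fd] at this

theorem memLp_reflect {f : ℍ → ℂ} (hf : MemLp f 2 (volume.restrict ModularGroup.fd)) :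
    MemLp (reflect f) 2 (volume.restrict ModularGroup.fd) :=
  hf.comp_measurePreserving measurePreserving_negConj_fd

def negConjEquiv : ℍ ≃ᵐ ℍ where
  toFun := negConj
  invFun := negConj
  left_inv := negConj_negConj
  right_inv := negConj_negConj
  measurable_toFun := measurePreserving_negConj.measurable
  measurable_invFun := measurePreserving_negConj.measurable

theorem petersson_reflect (f g : ℍ → ℂ) :
    petersson (reflect f) g = petersson f (reflect g) := by
  have h := measurePreserving_negConj_fd.integral_comp negConjEquiv.measurableEmbedding
    (fun z => f z * conj (reflect g z))
  rw [petersson, petersson, ← h]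
  simp only [reflect_apply, negConj_negConj]

theorem IsMaassForm.reflect {k : ℤ} {v : SL(2, ℤ) → ℂ} {R : ℝ} {f : ℍ → ℂ}
    (hf : IsMaassForm k v R f) :
    IsMaassForm (-k) (fun A => v (flipSL A)) R (reflect f) where
  smooth := hf.smooth.reflect
  slash := hf.isModular.reflect.slash
  eigen := eigen_of_laplacian_eq (by
    rw [laplacian_reflect hf.smooth, hf.laplacian_eq, reflect_smul])
  memLp := memLp_reflect hf.memLp

theorem flipSL_flipSL (A : SL(2, ℤ)) : flipSL (flipSL A) = A :=
  Subtype.ext (flip_flip A)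

/-- Adjointness of lowering operators with respect to the reflected Petersson product. -/
theorem petersson_lowering_reflect {j : ℤ} {v : SL(2, ℤ) → ℂ} (hv : ∀ A, ‖v A‖ = 1) {R R' : ℝ}
    {f g : ℍ → ℂ} (hf : IsMaassForm j v R f)
    (hg : IsMaassForm (2 - j) (fun A => v (flipSL A)) R' g) :
    petersson (lowering j f) (reflect g) = -petersson f (reflect (lowering (2 - j) g)) := by
  have hg' := hg.reflect
  simp only [flipSL_flipSL, neg_sub] at hg'
  have hr := raising_reflect hg.smooth (j - 2)
  rw [neg_sub] at hr
  have hl := memLp_reflect (hg.memLp_lowering fun A => hv _)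
  rw [petersson_lowering hv hf.smooth hg'.smooth hf.isModular hg'.isModular hf.memLp hg'.memLp
    (hf.memLp_lowering hv) (by rw [hr]; exact hl.const_smul _), hr]
  simp [petersson, integral_neg]

/-! ### The operator `Θ` on Maass forms and its adjoint -/

theorem IsMaassForm.loweringIter {k : ℤ} {v : SL(2, ℤ) → ℂ} (hv : ∀ A, ‖v A‖ = 1) {R : ℝ}
    {f : ℍ → ℂ} (hf : IsMaassForm k v R f) (n : ℕ) :
    IsMaassForm (k - 2 * n) v R (EtaMaass.loweringIter k n f) := by
  induction n with
  | zero => simpa [EtaMaass.loweringIter] using hf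
  | succ n ih =>
    have := ih.lowering hv
    rw [show k - 2 * (n : ℤ) - 2 = k - 2 * ((n + 1 : ℕ) : ℤ) by push_cast; ring] at this
    exact this

theorem IsMaassForm.Theta {k : ℕ} {v : SL(2, ℤ) → ℂ} (hv : ∀ A, ‖v A‖ = 1) {R : ℝ}
    {f : ℍ → ℂ} (hf : IsMaassForm k v R f) :
    IsMaassForm k (fun A => v (flipSL A)) R (EtaMaass.Theta k f) := by
  have := (hf.loweringIter hv k).reflect
  rwa [show -((k : ℤ) - 2 * (k : ℕ)) = k by ring] at this

/-- Lowering operators are moved from the left argument to the right one at a time, each at the cost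
of a sign. The condition `n + m = k` makes the weights on the two sides match at every stage. -/
theorem petersson_loweringIter {k : ℕ} {v : SL(2, ℤ) → ℂ} (hv : ∀ A, ‖v A‖ = 1) {R R' : ℝ}
    {f g : ℍ → ℂ} (hf : IsMaassForm k v R f)
    (hg : IsMaassForm k (fun A => v (flipSL A)) R' g) {n m : ℕ} (hnm : n + m = k) :
    petersson (loweringIter k n f) (reflect (loweringIter k m g)) =
      (-1) ^ n * petersson f (reflect (loweringIter k k g)) := by
  induction n generalizing m with
  | zero => simp [loweringIter, ← hnm]
  | succ n ih =>
    have h1 := hf.loweringIter hv n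
    have h2 := hg.loweringIter (fun A => hv _) m
    have h3 : (2 : ℤ) - ((k : ℤ) - 2 * n) = (k : ℤ) - 2 * m := by push_cast [← hnm]; ring
    rw [← h3] at h2
    have h4 := petersson_lowering_reflect hv h1 h2
    rw [h3] at h4
    change petersson (lowering _ (loweringIter k n f)) _ = _
    rw [h4]
    change -petersson _ (reflect (loweringIter k (m + 1) g)) = _
    rw [ih (m := m + 1) (by omega)]
    ring

theorem petersson_Theta {k : ℕ} {v : SL(2, ℤ) → ℂ} (hv : ∀ A, ‖v A‖ = 1) {R R' : ℝ}
    {f g : ℍ → ℂ} (hf : IsMaassForm k v R f)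
    (hg : IsMaassForm k (fun A => v (flipSL A)) R' g) :
    petersson (Theta k f) g = (-1) ^ k * petersson f (Theta k g) := by
  have h := petersson_loweringIter hv hf hg (n := k) (m := 0) (by simp)
  rw [Theta, petersson_reflect]
  exact h

/-- Smoothness of the iterates is carried through the induction because additivity of the next step
requires it. -/
theorem loweringIter_add {k : ℤ} {f g : ℍ → ℂ} (hf : Smooth f) (hg : Smooth g) (n : ℕ) :
    loweringIter k n (f + g) = loweringIter k n f + loweringIter k n g ∧
      Smooth (loweringIter k n f) ∧ Smooth (loweringIter k n g) := by
  induction n with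
  | zero => exact ⟨rfl, hf, hg⟩
  | succ n ih =>
    obtain ⟨h1, h2, h3⟩ := ih
    refine ⟨?_, h2.lowering _, h3.lowering _⟩
    change lowering _ (loweringIter k n (f + g)) = _
    rw [h1, lowering_add h2 h3]
    rfl

theorem Smooth.loweringIter {f : ℍ → ℂ} (hf : Smooth f) (k : ℤ) (n : ℕ) :
    Smooth (loweringIter k n f) := (loweringIter_add hf hf n).2.1

theorem loweringIter_const_smul {k : ℤ} {f : ℍ → ℂ} (hf : Smooth f) (c : ℂ) (n : ℕ) :
    loweringIter k n (c • f) = c • loweringIter k n f := by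
  induction n with
  | zero => rfl
  | succ n ih =>
    change lowering _ (loweringIter k n (c • f)) = _
    rw [ih, lowering_const_smul (hf.loweringIter k n)]
    rfl

theorem Theta_add {k : ℕ} {f g : ℍ → ℂ} (hf : Smooth f) (hg : Smooth g) :
    Theta k (f + g) = Theta k f + Theta k g := by
  rw [Theta, (loweringIter_add hf hg k).1, reflect_add]; rfl

theorem Theta_const_smul {k : ℕ} {f : ℍ → ℂ} (hf : Smooth f) (c : ℂ) :
    Theta k (c • f) = c • Theta k f := by
  rw [Theta, loweringIter_const_smul hf, reflect_smul]; rfl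

/-! ### The character of `η²` -/

/-- The component at `3` of the exponent of the character of `η²`. -/
def expThree (a b c d : ZMod 3) : ZMod 3 := (a + d) * c - b * d * (c ^ 2 - 1)

/-- The component at `4` of the exponent of the character of `η²`. -/
def expFour (a b c d : ZMod 4) : ZMod 4 :=
  -- The branches are the cases `c` odd and `c` even of the classical exponent of the
  -- `η`-multiplier, reduced modulo 4.
  if c = 1 ∨ c = 3 then (a + d + 1) * c else (a + d) * c + b * d - d + 1 + c * d

set_option maxRecDepth 100000 in
theorem expThree_mul : ∀ a b c d : ZMod 3, a * d - b * c = 1 → ∀ a' b' c' d' : ZMod 3,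
    a' * d' - b' * c' = 1 →
    expThree (a * a' + b * c') (a * b' + b * d') (c * a' + d * c') (c * b' + d * d') =
      expThree a b c d + expThree a' b' c' d' := by decide

theorem expFour_mul : ∀ a b c d : ZMod 4, a * d - b * c = 1 → ∀ a' b' c' d' : ZMod 4,
    a' * d' - b' * c' = 1 →
    expFour (a * a' + b * c') (a * b' + b * d') (c * a' + d * c') (c * b' + d * d') =
      expFour a b c d + expFour a' b' c' d' := by decide +kernel

/-- If `k ≡ 2 mod 4`, the condition on the determinant says only that it is odd, so `expFour_mul` is
not available. But then the exponent matters only modulo 2, where it is given by one polynomial,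
additive by `exp_mod_two_mul`. -/
theorem two_mul_expFour : ∀ a b c d : ZMod 4, 2 * (a * d - b * c) = 2 →
    2 * expFour a b c d = 2 * ((a + d + 1) * c + (1 + c) * b) := by decide +kernel

theorem exp_mod_two_mul : ∀ a b c d : ZMod 2, a * d - b * c = 1 → ∀ a' b' c' d' : ZMod 2,
    a' * d' - b' * c' = 1 →
    (a * a' + b * c' + (c * b' + d * d') + 1) * (c * a' + d * c') +
      (1 + (c * a' + d * c')) * (a * b' + b * d') =
      ((a + d + 1) * c + (1 + c) * b) + ((a' + d' + 1) * c' + (1 + c') * b') := by decide +kernel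

theorem expFour_flip : ∀ κ a b c d : ZMod 4,
    κ * (a * d - b * c) = κ ∨ κ * (a * d - b * c) = -κ →
    κ * expFour a (-b) (-c) d = -(κ * expFour a b c d) := by decide +kernel

theorem two_mul_eq_iff_cast (x : ℤ) (y : ℤ) : (2 : ZMod 4) * x = 2 * y ↔ (x : ZMod 2) = y := by
  have h1 : ((2 : ZMod 4) * x = 2 * y) ↔ (((2 * x : ℤ) : ZMod 4) = ((2 * y : ℤ) : ZMod 4)) := by
    push_cast; rfl
  rw [h1, ZMod.intCast_eq_intCast_iff, ZMod.intCast_eq_intCast_iff, Int.modEq_iff_dvd,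
    Int.modEq_iff_dvd]
  push_cast
  omega

/-- `expThree` of an integral matrix. -/
def exp₃ (M : Mat) : ZMod 3 := expThree (M 0 0) (M 0 1) (M 1 0) (M 1 1)

/-- `expFour` of an integral matrix. -/
def exp₄ (M : Mat) : ZMod 4 := expFour (M 0 0) (M 0 1) (M 1 0) (M 1 1)

/-- The extension of the character `v_η^{2k}` to integral matrices with `k det M ≡ k mod 12`. -/
def nu (k : ℕ) (M : Mat) : ℂ :=
  -- The signs reflect `1/12 = 1/3 - 1/4`: a twelfth root of unity is recovered from its exponent
  -- modulo 3 and modulo 4.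
  ZMod.stdAddChar ((k : ZMod 3) * exp₃ M) * ZMod.stdAddChar (-((k : ZMod 4) * exp₄ M))

theorem det_cast {R : Type*} [CommRing R] (M : Mat) :
    ((M.det : ℤ) : R) = M 0 0 * M 1 1 - M 0 1 * M 1 0 := by
  rw [Matrix.det_fin_two]; push_cast; rfl

theorem mul_cast {R : Type*} [CommRing R] (M N : Mat) (i j : Fin 2) :
    (((M * N) i j : ℤ) : R) = M i 0 * N 0 j + M i 1 * N 1 j := by
  rw [Matrix.mul_apply, Fin.sum_univ_two]; push_cast; rfl

/-- Either `k` vanishes modulo 3, or it can be cancelled and both determinants are 1 modulo 3. -/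
theorem mul_exp₃_mul {k : ZMod 3} {M N : Mat} (hM : k * (M.det : ℤ) = k)
    (hN : k * (N.det : ℤ) = k) : k * exp₃ (M * N) = k * exp₃ M + k * exp₃ N := by
  have : Fact (Nat.Prime 3) := ⟨by norm_num⟩
  rcases eq_or_ne k 0 with rfl | hk
  · simp
  · have h1 := mul_left_cancel₀ hk (hM.trans (mul_one k).symm)
    have h2 := mul_left_cancel₀ hk (hN.trans (mul_one k).symm)
    rw [det_cast] at h1 h2
    rw [← mul_add]
    simp only [exp₃, mul_cast, expThree_mul _ _ _ _ h1 _ _ _ _ h2]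

theorem mul_exp₄_mul {k : ZMod 4} {M N : Mat} (hM : k * (M.det : ℤ) = k)
    (hN : k * (N.det : ℤ) = k) : k * exp₄ (M * N) = k * exp₄ M + k * exp₄ N := by
  have hMN : k * ((M * N).det : ℤ) = k := by
    rw [Matrix.det_mul, Int.cast_mul, ← mul_assoc, hM, hN]
  -- An odd `k` is its own inverse modulo 4, so both determinants are 1 modulo 4.
  have hunit : ∀ u : ZMod 4, u * u = 1 → k = u → k * exp₄ (M * N) = k * exp₄ M + k * exp₄ N := by
    intro u hu hk
    have h1 : ((M.det : ℤ) : ZMod 4) = 1 := by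
      rw [← hk] at hu; linear_combination k * hM + (1 - (M.det : ZMod 4)) * hu
    have h2 : ((N.det : ℤ) : ZMod 4) = 1 := by
      rw [← hk] at hu; linear_combination k * hN + (1 - (N.det : ZMod 4)) * hu
    rw [det_cast] at h1 h2
    rw [← mul_add]
    simp only [exp₄, mul_cast, expFour_mul _ _ _ _ h1 _ _ _ _ h2]
  have hcases : ∀ k : ZMod 4, k = 0 ∨ k = 1 ∨ k = 2 ∨ k = 3 := by decide
  rcases hcases k with h | h | h | h
  · simp [h]
  · exact hunit 1 (by decide) h
  · rw [h] at hM hN hMN ⊢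
    have e1 := hM
    have e2 := hN
    rw [det_cast] at hM hN hMN
    rw [exp₄, exp₄, exp₄, two_mul_expFour _ _ _ _ hM, two_mul_expFour _ _ _ _ hN,
      two_mul_expFour _ _ _ _ hMN, ← mul_add]
    have h1 : ((M.det : ℤ) : ZMod 2) = 1 := by
      have := (two_mul_eq_iff_cast M.det 1).1 (by rw [e1]; decide)
      simpa using this
    have h2 : ((N.det : ℤ) : ZMod 2) = 1 := by
      have := (two_mul_eq_iff_cast N.det 1).1 (by rw [e2]; decide)
      simpa using this
    rw [det_cast] at h1 h2
    have h3 := exp_mod_two_mul _ _ _ _ h1 _ _ _ _ h2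
    simp only [← mul_cast] at h3
    have h4 := two_mul_eq_iff_cast (((M * N) 0 0 + (M * N) 1 1 + 1) * (M * N) 1 0 +
      (1 + (M * N) 1 0) * (M * N) 0 1) (((M 0 0 + M 1 1 + 1) * M 1 0 + (1 + M 1 0) * M 0 1) +
      ((N 0 0 + N 1 1 + 1) * N 1 0 + (1 + N 1 0) * N 0 1))
    push_cast at h4
    exact h4.2 h3
  · exact hunit 3 (by decide) h

theorem cast_of_modEq {k : ℕ} {x y : ℤ} (h : (k : ℤ) * x ≡ y [ZMOD 12]) :
    (k : ZMod 3) * x = y ∧ (k : ZMod 4) * x = y := by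
  constructor
  · have := (ZMod.intCast_eq_intCast_iff _ _ 3).2 (h.of_dvd (by norm_num))
    push_cast at this
    exact this
  · have := (ZMod.intCast_eq_intCast_iff _ _ 4).2 (h.of_dvd (by norm_num))
    push_cast at this
    exact this

theorem nu_mul {k : ℕ} {M N : Mat} (hM : (k : ℤ) * M.det ≡ k [ZMOD 12])
    (hN : (k : ℤ) * N.det ≡ k [ZMOD 12]) : nu k (M * N) = nu k M * nu k N := by
  obtain ⟨m3, m4⟩ := cast_of_modEq hM
  obtain ⟨n3, n4⟩ := cast_of_modEq hN
  rw [Int.cast_natCast] at m3 m4 n3 n4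
  rw [nu, mul_exp₃_mul m3 n3, mul_exp₄_mul m4 n4, neg_add, AddChar.map_add_eq_mul,
    AddChar.map_add_eq_mul, nu, nu]
  ring

theorem norm_nu (k : ℕ) (M : Mat) : ‖nu k M‖ = 1 := by
  rw [nu, norm_mul, AddChar.norm_apply, AddChar.norm_apply, one_mul]

theorem conj_nu (k : ℕ) (M : Mat) : conj (nu k M) = (nu k M)⁻¹ := by
  rw [Complex.inv_def, Complex.normSq_eq_norm_sq, norm_nu]; simp

theorem nu_ne_zero (k : ℕ) (M : Mat) : nu k M ≠ 0 :=
  norm_ne_zero_iff.1 (by rw [norm_nu]; exact one_ne_zero)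

/-- Changing the signs of `b` and `c` negates both exponents once they are multiplied by `k`. For
SL(2, ℤ) this says that reflection conjugates the multiplier. -/
theorem nu_flip {k : ℕ} {M : Mat} (hM : (k : ℤ) * M.det ≡ k [ZMOD 12] ∨
    (k : ℤ) * M.det ≡ -k [ZMOD 12]) : nu k (flip M) = conj (nu k M) := by
  have h3 : exp₃ (flip M) = -exp₃ M := by
    simp only [exp₃, flip, expThree, Matrix.of_apply, Matrix.cons_val', Matrix.cons_val_zero,
      Matrix.cons_val_one, Matrix.cons_val_fin_one]
    push_cast
    ring
  have h4 : (k : ZMod 4) * exp₄ (flip M) = -((k : ZMod 4) * exp₄ M) := by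
    have := expFour_flip (k : ZMod 4) (M 0 0) (M 0 1) (M 1 0) (M 1 1) (by
      rw [← det_cast]
      rcases hM with h | h
      · left; simpa only [Int.cast_natCast] using (cast_of_modEq h).2
      · right; simpa only [Int.cast_natCast, Int.cast_neg] using (cast_of_modEq h).2)
    simpa [exp₄, flip] using this
  rw [conj_nu, nu, nu, h3, h4, mul_inv, mul_neg, AddChar.map_neg_eq_inv, AddChar.map_neg_eq_inv]

/-- The origin of `χ_k`: the two contributions of `bd` combine to a power of `ξ`, and the remaining
`1 - d` modulo 4 gives the power of `i`. -/
theorem exp_tri (k : ℕ) (b d : ℤ) :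
    ZMod.stdAddChar ((k : ZMod 3) * ((b * d : ℤ) : ZMod 3)) *
      ZMod.stdAddChar (-((k : ZMod 4) * ((b * d - d + 1 : ℤ) : ZMod 4))) =
    Complex.I ^ ((k : ℤ) * (d - 1)) * xi k ^ (b * d) := by
  have h3 : (k : ZMod 3) * ((b * d : ℤ) : ZMod 3) = ((k * (b * d) : ℤ) : ZMod 3) := by
    push_cast; ring
  have h4 : -((k : ZMod 4) * ((b * d - d + 1 : ℤ) : ZMod 4)) =
      ((-(k * (b * d - d + 1)) : ℤ) : ZMod 4) := by push_cast; ring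
  have hI : Complex.I = Complex.exp (Real.pi / 2 * Complex.I) := Complex.exp_pi_div_two_mul_I.symm
  rw [h3, h4, ZMod.stdAddChar_coe, ZMod.stdAddChar_coe, xi, hI, ← Complex.exp_int_mul,
    ← Complex.exp_int_mul, ← Complex.exp_add, ← Complex.exp_add, ← hI]
  congr 1
  push_cast
  ring

/-- Upper triangular integral matrices. -/
def tri (a b d : ℤ) : Mat := !![a, b; 0, d]

theorem det_tri (a b d : ℤ) : (tri a b d).det = a * d := by simp [tri, Matrix.det_fin_two]

theorem nu_tri (k : ℕ) (a b d : ℤ) :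
    nu k (tri a b d) = Complex.I ^ ((k : ℤ) * (d - 1)) * xi k ^ (b * d) := by
  rw [← exp_tri, nu]
  congr 2
  · simp [exp₃, tri, expThree]
  · rw [exp₄, tri, expFour, if_neg (by simp; decide)]
    simp

theorem nu_scalar_of_one {k m : ℕ} (hm : (k : ℤ) * m ≡ k [ZMOD 12]) : nu k (tri m 0 m) = 1 := by
  have h : (k : ZMod 4) * exp₄ (tri m 0 m) = 0 := by
    have := (cast_of_modEq hm).2
    push_cast at this
    rw [exp₄, tri, expFour, if_neg (by simp; decide)]
    simp
    linear_combination -this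
  rw [nu, h]
  simp [exp₃, tri, expThree]

/-- The exponent modulo 4 is `k(1 - m) ≡ 2k`. This sign later cancels the one in `petersson_Theta`.
-/
theorem nu_scalar_of_neg_one {k m : ℕ} (hm : (k : ℤ) * m ≡ -k [ZMOD 12]) :
    nu k (tri m 0 m) = (-1) ^ k := by
  have h : -((k : ZMod 4) * exp₄ (tri m 0 m)) = ((-(2 * k) : ℤ) : ZMod 4) := by
    have := (cast_of_modEq hm).2
    push_cast at this ⊢
    rw [exp₄, tri, expFour, if_neg (by simp; decide)]
    simp
    linear_combination -this
  rw [nu, h, ZMod.stdAddChar_coe]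
  have h2 : (2 * Real.pi * Complex.I * ((-(2 * k) : ℤ) : ℂ) / ((4 : ℕ) : ℂ)) =
      (k : ℕ) * (-(Real.pi * Complex.I)) := by push_cast; ring
  rw [h2, Complex.exp_nat_mul, Complex.exp_neg, Complex.exp_pi_mul_I]
  simp [exp₃, tri, expThree]

/-! ### The transformation law of `η²` -/

theorem coe_SL_mul (A B : SL(2, ℤ)) : ((A * B : SL(2, ℤ)) : Mat) = (A : Mat) * B := rfl

theorem nu_SL_mul (k : ℕ) (A B : SL(2, ℤ)) :
    nu k (A * B : SL(2, ℤ)) = nu k A * nu k B := by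
  rw [coe_SL_mul]
  refine nu_mul ?_ ?_ <;> rw [Matrix.SpecialLinearGroup.det_coe, mul_one]

theorem nu_one (k : ℕ) : nu k (1 : SL(2, ℤ)) = 1 := by
  have h := nu_SL_mul k 1 1
  rw [mul_one] at h
  exact (mul_eq_left₀ (nu_ne_zero k _)).1 h.symm

theorem eta_add_one_sq (z : ℂ) :
    ModularForm.eta (1 + z) ^ 2 = xi 1 * ModularForm.eta z ^ 2 := by
  have hq : ∀ (n : ℕ), ModularForm.eta_q n (1 + z) = ModularForm.eta_q n z := by
    intro n
    rw [ModularForm.eta_q_eq_pow, ModularForm.eta_q_eq_pow, mul_add, Complex.exp_add, mul_one,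
      Complex.exp_two_pi_mul_I, one_mul]
  have he : ModularForm.eta (1 + z)
      = Complex.exp (2 * Real.pi * Complex.I / 24) * ModularForm.eta z := by
    simp only [ModularForm.eta, hq, Function.Periodic.qParam]
    rw [← mul_assoc, ← Complex.exp_add]
    congr 2
    push_cast
    ring
  rw [he, mul_pow, ← Complex.exp_nat_mul, xi]
  congr 2
  push_cast
  ring

/-- Squaring removes the choice of a branch of the square root in the transformation of `η`. -/
theorem eta_S_sq (z : ℍ) :
    ModularForm.eta (ModularGroup.S • z : ℍ) ^ 2 =
      -Complex.I * z * ModularForm.eta z ^ 2 := by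
  have h := ModularForm.eta_comp_eq_csqrt_I_inv z.2
  have hs : ∀ w : ℂ, w ≠ 0 → Complex.sqrt w ^ 2 = w := by
    intro w hw
    rw [_root_.sqrt_eq_exp hw, ← Complex.exp_nat_mul]
    rw [show ((2 : ℕ) : ℂ) * (Complex.log w / 2) = Complex.log w by push_cast; ring,
      Complex.exp_log hw]
  have h1 : ((ModularGroup.S • z : ℍ) : ℂ) = -1 / z := by
    rw [UpperHalfPlane.modular_S_smul, UpperHalfPlane.coe_mk, inv_neg, neg_div, one_div]
  simp only [Function.comp_apply, Pi.smul_apply, Pi.mul_apply, smul_eq_mul] at h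
  rw [h1, h, mul_pow, mul_pow, inv_pow, hs _ Complex.I_ne_zero, hs _ z.ne_zero, Complex.inv_I]
  ring

/-- The transformation law of `η²` under the full modular group. -/
theorem eta_sq_act (A : SL(2, ℤ)) : ∀ z : ℍ, ModularForm.eta (act A z) ^ 2 =
    nu 1 A * den A z * ModularForm.eta z ^ 2 := by
  have hA : A ∈ Subgroup.closure {ModularGroup.S, ModularGroup.T} := by
    rw [SpecialLinearGroup.SL2Z_generators]; trivial
  induction hA using Subgroup.closure_induction with
  | mem A hA =>
    intro z
    rcases hA with rfl | rfl
    · rw [act_SL, eta_S_sq]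
      have h1 : nu 1 (ModularGroup.S : SL(2, ℤ)) = -Complex.I := by
        have h : -(((1 : ℕ) : ZMod 4) * exp₄ (ModularGroup.S : SL(2, ℤ))) = ((-1 : ℤ) : ZMod 4) := by
          simp [exp₄, ModularGroup.S, expFour]
        have h' : exp₃ (ModularGroup.S : SL(2, ℤ)) = 0 := by
          simp [exp₃, ModularGroup.S, expThree]
        rw [nu, h, h', mul_zero, AddChar.map_zero_eq_one, one_mul, ZMod.stdAddChar_coe]
        have : (2 * Real.pi * Complex.I * ((-1 : ℤ) : ℂ) / ((4 : ℕ) : ℂ)) =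
          -(Real.pi / 2 * Complex.I) := by push_cast; ring
        rw [this, Complex.exp_neg, Complex.exp_pi_div_two_mul_I, Complex.inv_I]
      rw [h1]
      simp [den, ModularGroup.S]
    · rw [act_SL, UpperHalfPlane.modular_T_smul]
      have h1 : ((ModularGroup.T : SL(2, ℤ)) : Mat) = tri 1 1 1 := by
        ext i j; fin_cases i <;> fin_cases j <;> rfl
      rw [h1, nu_tri]
      have := eta_add_one_sq z
      simp [den, tri, this]
  | one =>
    intro z
    rw [nu_one, act_SL, one_smul]
    simp [den]
  | mul A B _ _ hA hB =>
    intro z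
    rw [nu_SL_mul, coe_SL_mul, act_mul (det_SL A) (det_SL B), hA, hB,
      den_mul (det_SL A) (det_SL B)]
    ring
  -- The law for `A` is used at the point `A⁻¹z`; the factors of `A` and `A⁻¹` multiply to 1.
  | inv A _ hA =>
    intro z
    have h1 : (A : Mat) * (A⁻¹ : SL(2, ℤ)) = (1 : SL(2, ℤ)) := by rw [← coe_SL_mul, mul_inv_cancel]
    have h2 := den_mul (det_SL A) (det_SL A⁻¹) z
    have h3 := nu_SL_mul 1 A A⁻¹
    have h4 := act_mul (det_SL A) (det_SL A⁻¹) z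
    have h5 := hA (act (A⁻¹ : SL(2, ℤ)) z)
    rw [mul_inv_cancel, nu_one] at h3
    rw [h1] at h2 h4
    rw [← h4, act_SL, one_smul] at h5
    have h6 : den (1 : SL(2, ℤ)) z = 1 := by simp [den]
    rw [h6] at h2
    rw [h5]
    linear_combination (ModularForm.eta (act (A⁻¹ : SL(2, ℤ)) z) ^ 2) *
      (h3 + nu 1 A * nu 1 (A⁻¹ : SL(2, ℤ)) * h2)

theorem nu_eq_pow (k : ℕ) (M : Mat) : nu k M = nu 1 M ^ k := by
  rw [nu, nu, mul_pow, ← AddChar.map_nsmul_eq_pow, ← AddChar.map_nsmul_eq_pow]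
  simp

theorem vEta_eq_nu (k : ℕ) (A : SL(2, ℤ)) : vEta k A = nu k A := by
  have h := eta_sq_act A UpperHalfPlane.I
  rw [act_SL] at h
  have h0 : ModularForm.eta Complex.I ≠ 0 := ModularForm.eta_ne_zero (by simp)
  have hd := den_ne_zero (det_SL A) UpperHalfPlane.I
  rw [vEta, nu_eq_pow, h]
  rw [den] at hd ⊢
  rw [UpperHalfPlane.coe_I] at hd ⊢
  congr 1
  field_simp

theorem norm_vEta (k : ℕ) (A : SL(2, ℤ)) : ‖vEta k A‖ = 1 := by rw [vEta_eq_nu, norm_nu]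

theorem vEta_flipSL (k : ℕ) (A : SL(2, ℤ)) : vEta k (flipSL A) = conj (vEta k A) := by
  rw [vEta_eq_nu, vEta_eq_nu, coe_flipSL, nu_flip]
  left
  rw [A.det_coe, mul_one]

/-! ### Integral matrices of determinant `m` modulo `SL(2, ℤ)` -/

/-- Integral `2 × 2` matrices of determinant `m`. -/
abbrev Dm (m : ℤ) := FixedDetMatrix (Fin 2) ℤ m

/-- The quotient of the matrices of determinant `m` by left multiplication with `SL(2, ℤ)`. -/
abbrev Qm (m : ℤ) := MulAction.orbitRel.Quotient SL(2, ℤ) (Dm m)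

/-- The class of a matrix. -/
def qmk {m : ℤ} (M : Dm m) : Qm m := Quotient.mk _ M

theorem qmk_eq_iff {m : ℤ} {M N : Dm m} : qmk M = qmk N ↔ ∃ γ : SL(2, ℤ), γ • N = M := by
  rw [qmk, qmk, Quotient.eq, MulAction.orbitRel_apply]
  rfl

theorem qmk_smul {m : ℤ} (γ : SL(2, ℤ)) (M : Dm m) : qmk (γ • M) = qmk M :=
  qmk_eq_iff.2 ⟨γ, rfl⟩

theorem qmk_out {m : ℤ} (q : Qm m) : qmk q.out = q := Quotient.out_eq q

theorem exists_smul_out {m : ℤ} (M : Dm m) : ∃ γ : SL(2, ℤ), γ • (qmk M).out = M :=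
  qmk_eq_iff.1 (qmk_out (qmk M)).symm

theorem out_apply {m : ℤ} {β : Type*} {Φ : Dm m → β} (hΦ : ∀ (γ : SL(2, ℤ)) M, Φ (γ • M) = Φ M)
    (M : Dm m) : Φ (qmk M).out = Φ M := by
  obtain ⟨γ, hγ⟩ := exists_smul_out M
  conv_rhs => rw [← hγ, hΦ]

/-- The triangular representatives. -/
def triD {m : ℕ} (x : (_ : ℕ) × ℕ) (hx : x ∈ m.divisors.sigma fun d => Finset.range d) :
    Dm (m : ℤ) :=
  ⟨tri ((m / x.1 : ℕ) : ℤ) x.2 x.1, by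
    have := Nat.dvd_of_mem_divisors (Finset.mem_sigma.1 hx).1
    rw [det_tri]
    exact_mod_cast Nat.div_mul_cancel this⟩

/-- An element of SL(2, ℤ) between two such matrices is upper triangular with positive diagonal,
hence unipotent. It shifts `b` by a multiple of `d`, which must be zero as both values of `b` lie in
`[0, d)`. -/
theorem qmk_triD_injective {m : ℕ} (x y : (_ : ℕ) × ℕ)
    (hx : x ∈ m.divisors.sigma fun d => Finset.range d)
    (hy : y ∈ m.divisors.sigma fun d => Finset.range d)
    (h : qmk (triD x hx) = qmk (triD y hy)) : x = y := by
  obtain ⟨γ, hγ⟩ := qmk_eq_iff.1 h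
  obtain ⟨d, b⟩ := x
  obtain ⟨d', b'⟩ := y
  rw [Finset.mem_sigma, Nat.mem_divisors, Finset.mem_range] at hx hy
  obtain ⟨⟨⟨a, ha⟩, hm⟩, hb⟩ := hx
  obtain ⟨⟨⟨a', ha'⟩, -⟩, hb'⟩ := hy
  simp only at ha ha' hb hb'
  have hd : 0 < d := by omega
  have hd' : 0 < d' := by omega
  have e1 : m / d = a := by rw [ha, Nat.mul_div_cancel_left _ hd]
  have e2 : m / d' = a' := by rw [ha', Nat.mul_div_cancel_left _ hd']
  have hγ' : (γ : Mat) * tri (a' : ℤ) b' d' = tri (a : ℤ) b d := by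
    have := congrArg Subtype.val hγ
    rw [FixedDetMatrices.smul_coe] at this
    simpa only [triD, e1, e2] using this
  have h00 := congrFun (congrFun hγ' 0) 0
  have h01 := congrFun (congrFun hγ' 0) 1
  have h10 := congrFun (congrFun hγ' 1) 0
  have h11 := congrFun (congrFun hγ' 1) 1
  have hdet := γ.det_coe
  rw [Matrix.det_fin_two] at hdet
  simp only [Matrix.mul_apply, Fin.sum_univ_two, tri, Matrix.of_apply, Matrix.cons_val',
    Matrix.cons_val_zero, Matrix.cons_val_one, Matrix.cons_val_fin_one, mul_zero, add_zero]
    at h00 h01 h10 h11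
  have ha0 : 0 < a := Nat.pos_of_ne_zero (by rintro rfl; simp at ha; exact hm ha)
  have ha0' : 0 < a' := Nat.pos_of_ne_zero (by rintro rfl; simp at ha'; exact hm ha')
  have hc : (γ : Mat) 1 0 = 0 := by
    rcases mul_eq_zero.1 h10 with h | h
    · exact h
    · omega
  rw [hc, zero_mul, zero_add] at h11
  rw [hc, mul_zero, sub_zero] at hdet
  have hpos : 0 < (γ : Mat) 1 1 := by
    have : 0 < (γ : Mat) 1 1 * d' := by rw [h11]; exact_mod_cast hd
    exact pos_of_mul_pos_left this (by positivity)
  have h1 : (γ : Mat) 1 1 = 1 := Int.eq_one_of_dvd_one hpos.le ⟨_, by rw [mul_comm]; exact hdet.symm⟩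
  have h0 : (γ : Mat) 0 0 = 1 := by rw [h1, mul_one] at hdet; exact hdet
  rw [h1, one_mul] at h11
  rw [h0, one_mul] at h01
  have hdd : d' = d := by exact_mod_cast h11
  subst hdd
  have ht : (γ : Mat) 0 1 = 0 := by
    by_contra hne
    have h2 : (d' : ℤ) ≤ |(γ : Mat) 0 1 * d'| := by
      rw [abs_mul, Nat.abs_cast]
      nlinarith [Int.one_le_abs hne]
    have h3 : (γ : Mat) 0 1 * d' = b - b' := by linarith
    rw [h3, le_abs] at h2
    omega
  rw [ht, zero_mul, add_zero] at h01
  have : b' = b := by exact_mod_cast h01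
  rw [this]

theorem qmk_triD_surjective {m : ℕ} (hm : m ≠ 0) (q : Qm (m : ℤ)) :
    ∃ x, ∃ hx : x ∈ m.divisors.sigma fun d => Finset.range d, qmk (triD x hx) = q := by
  have key : ∀ M : Dm (m : ℤ),
      ∃ x, ∃ hx : x ∈ m.divisors.sigma fun d => Finset.range d, qmk (triD x hx) = qmk M := by
    intro M
    have hm' : (m : ℤ) ≠ 0 := by exact_mod_cast hm
    induction M using FixedDetMatrices.induction_on hm' with
    | h0 A h10 h00 h01 hlt =>
      have hdet := A.2
      rw [Matrix.det_fin_two, h10, mul_zero, sub_zero] at hdet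
      have hm0 : (0 : ℤ) < m := by exact_mod_cast Nat.pos_of_ne_zero hm
      have h11 : 0 < A.1 1 1 := by
        rw [← hdet] at hm0
        exact pos_of_mul_pos_right hm0 h00.le
      rw [abs_of_nonneg h01, abs_of_pos h11] at hlt
      obtain ⟨a, ha⟩ := Int.eq_ofNat_of_zero_le h00.le
      obtain ⟨b, hb⟩ := Int.eq_ofNat_of_zero_le h01
      obtain ⟨d, hd⟩ := Int.eq_ofNat_of_zero_le h11.le
      rw [hd] at hdet hlt h11
      rw [ha] at hdet
      rw [hb] at hlt
      have hdet' : a * d = m := by exact_mod_cast hdet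
      have hd0 : 0 < d := by exact_mod_cast h11
      refine ⟨⟨d, b⟩, ?_, ?_⟩
      · rw [Finset.mem_sigma, Nat.mem_divisors, Finset.mem_range]
        exact ⟨⟨⟨a, by rw [← hdet', mul_comm]⟩, hm⟩, by exact_mod_cast hlt⟩
      · congr 1
        apply FixedDetMatrices.ext'
        rw [triD]
        simp only [← hdet', Nat.mul_div_cancel _ hd0]
        ext i j
        fin_cases i <;> fin_cases j <;> simp [tri, ha, hb, hd, h10]
    | hS B h =>
      obtain ⟨x, hx, h⟩ := h
      exact ⟨x, hx, by rw [h, qmk_smul]⟩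
    | hT B h =>
      obtain ⟨x, hx, h⟩ := h
      exact ⟨x, hx, by rw [h, qmk_smul]⟩
  rw [← qmk_out q]
  exact key _

theorem finite_Qm {m : ℕ} (hm : m ≠ 0) : Finite (Qm (m : ℤ)) :=
  Finite.of_surjective
    (fun x : ↥(m.divisors.sigma fun d => Finset.range d) => qmk (triD x.1 x.2)) fun q => by
      obtain ⟨x, hx, h⟩ := qmk_triD_surjective hm q
      exact ⟨⟨x, hx⟩, h⟩

instance (m : ℕ) [NeZero m] : Fintype (Qm (m : ℤ)) :=
  have := finite_Qm (NeZero.ne m)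
  Fintype.ofFinite _

/-- A left invariant function on the matrices of determinant `m`, summed over triangular
representatives. -/
theorem sum_tri {m : ℕ} [NeZero m] {β : Type*} [AddCommMonoid β] (Φ : Mat → β)
    (hΦ : ∀ (γ : SL(2, ℤ)) (M : Dm (m : ℤ)), Φ (γ * M.1) = Φ M.1) :
    ∑ d ∈ m.divisors, ∑ b ∈ Finset.range d, Φ (tri ((m / d : ℕ) : ℤ) b d) =
      ∑ q : Qm (m : ℤ), Φ q.out.1 := by
  rw [Finset.sum_sigma']
  refine Finset.sum_bij (fun x hx => qmk (triD x hx)) (fun _ _ => Finset.mem_univ _)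
    (fun x hx y hy h => qmk_triD_injective x y hx hy h)
    (fun q _ => qmk_triD_surjective (NeZero.ne m) q) fun x hx => ?_
  rw [out_apply (Φ := fun M : Dm (m : ℤ) => Φ M.1) (fun γ M => by
    rw [FixedDetMatrices.smul_coe, hΦ])]
  rfl

/-! ### Symmetries of the quotient -/

/-- Right multiplication by an element of `SL(2, ℤ)`. -/
def rmul {m : ℤ} (M : Dm m) (γ : SL(2, ℤ)) : Dm m :=
  ⟨M.1 * γ, by rw [Matrix.det_mul, M.2, γ.det_coe, mul_one]⟩

/-- A bijection of matrices which permutes the left cosets permutes the terms of a sum over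
cosets. -/
theorem sum_out_comp {m : ℤ} [Fintype (Qm m)] {β : Type*} [AddCommMonoid β] {Φ : Dm m → β}
    (hΦ : ∀ (γ : SL(2, ℤ)) M, Φ (γ • M) = Φ M) {e e' : Dm m → Dm m}
    (he : ∀ (γ : SL(2, ℤ)) M, qmk (e (γ • M)) = qmk (e M))
    (he' : ∀ (γ : SL(2, ℤ)) M, qmk (e' (γ • M)) = qmk (e' M))
    (h1 : ∀ M, e (e' M) = M) (h2 : ∀ M, e' (e M) = M) :
    ∑ q : Qm m, Φ (e q.out) = ∑ q : Qm m, Φ q.out := by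
  refine Finset.sum_nbij' (fun q => qmk (e q.out)) (fun q => qmk (e' q.out)) (by simp) (by simp)
    (fun q _ => ?_) (fun q _ => ?_) (fun q _ => (out_apply hΦ _).symm)
  · rw [out_apply (Φ := fun M => qmk (e' M)) he', h2, qmk_out]
  · rw [out_apply (Φ := fun M => qmk (e M)) he, h1, qmk_out]

theorem sum_out_rmul {m : ℤ} [Fintype (Qm m)] {β : Type*} [AddCommMonoid β] {Φ : Dm m → β}
    (hΦ : ∀ (γ : SL(2, ℤ)) M, Φ (γ • M) = Φ M) (A : SL(2, ℤ)) :
    ∑ q : Qm m, Φ (rmul q.out A) = ∑ q : Qm m, Φ q.out := by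
  have h : ∀ (A γ : SL(2, ℤ)) (M : Dm m), rmul (γ • M) A = γ • rmul M A := fun A γ M =>
    FixedDetMatrices.ext' _ _ (mul_assoc (γ : Mat) M.1 A)
  refine sum_out_comp (e := fun M => rmul M A) (e' := fun M => rmul M A⁻¹) hΦ (fun γ M => by rw [h, qmk_smul])
    (fun γ M => by rw [h, qmk_smul]) (fun M => ?_) (fun M => ?_)
  all_goals
    apply FixedDetMatrices.ext'
    refine (mul_assoc M.1 _ _).trans ?_
    rw [← coe_SL_mul]
    simp

/-- Conjugation by `diag(-1, 1)`. -/
def flipD {m : ℤ} (M : Dm m) : Dm m := ⟨flip M.1, by rw [det_flip, M.2]⟩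

theorem sum_out_flip {m : ℤ} [Fintype (Qm m)] {β : Type*} [AddCommMonoid β] {Φ : Dm m → β}
    (hΦ : ∀ (γ : SL(2, ℤ)) M, Φ (γ • M) = Φ M) :
    ∑ q : Qm m, Φ (flipD q.out) = ∑ q : Qm m, Φ q.out := by
  have h : ∀ (γ : SL(2, ℤ)) (M : Dm m), flipD (γ • M) = flipSL γ • flipD M := fun γ M =>
    FixedDetMatrices.ext' _ _ (flip_mul (γ : Mat) M.1)
  have h2 : ∀ M : Dm m, flipD (flipD M) = M := fun M =>
    FixedDetMatrices.ext' _ _ (flip_flip M.1)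
  exact sum_out_comp (e := flipD) (e' := flipD) hΦ (fun γ M => by rw [h, qmk_smul])
    (fun γ M => by rw [h, qmk_smul]) h2 h2

/-! ### The slash operation of integral matrices -/

/-- The slash operation `(f|M)(z) = (|cz + d| / (cz + d))^k f(Mz)`. -/
def slashM (k : ℤ) (M : Mat) (f : ℍ → ℂ) (z : ℍ) : ℂ := (uden M z ^ k)⁻¹ * f (act M z)

theorem slashM_mul (k : ℤ) {M N : Mat} (hM : 0 < M.det) (hN : 0 < N.det) (f : ℍ → ℂ) :
    slashM k (M * N) f = slashM k N (slashM k M f) := by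
  ext z
  rw [slashM, slashM, slashM, uden_mul hM hN, act_mul hM hN, mul_zpow, mul_inv]
  ring

theorem slashM_smul (k : ℤ) (M : Mat) (c : ℂ) (f : ℍ → ℂ) :
    slashM k M (c • f) = c • slashM k M f := by
  ext z
  simp only [slashM, Pi.smul_apply, smul_eq_mul]
  ring

theorem slashM_sum (k : ℤ) (M : Mat) {ι : Type*} (s : Finset ι) (f : ι → ℍ → ℂ) :
    slashM k M (∑ i ∈ s, f i) = ∑ i ∈ s, slashM k M (f i) := by
  ext z
  simp only [slashM, Finset.sum_apply, Finset.mul_sum]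

theorem isModular_iff_slashM {k : ℤ} {v : SL(2, ℤ) → ℂ} {f : ℍ → ℂ} :
    IsModular k v f ↔ ∀ A : SL(2, ℤ), slashM k A f = v A • f := by
  refine forall_congr' fun A => ?_
  rw [funext_iff]
  refine forall_congr' fun z => ?_
  have h := zpow_ne_zero k (uden_ne_zero (det_SL A) z)
  rw [slashM, inv_mul_eq_iff_eq_mul₀ h, Pi.smul_apply, smul_eq_mul, mul_left_comm, mul_assoc]

theorem det_pos_Dm {m : ℕ} [NeZero m] (M : Dm (m : ℤ)) : 0 < M.1.det := by
  rw [M.2]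
  exact_mod_cast Nat.pos_of_ne_zero (NeZero.ne m)

/-! ### Hecke operators as sums over cosets -/

/-- The Hecke operator with weights `wt`, as a sum over cosets. -/
def heckeW (k : ℤ) (m : ℕ) [NeZero m] (wt : Mat → ℂ) (f : ℍ → ℂ) : ℍ → ℂ :=
  ((Real.sqrt m : ℝ) : ℂ)⁻¹ • ∑ q : Qm (m : ℤ), wt q.out.1 • slashM k q.out.1 f

/-- `wt` is a system of weights on the matrices of determinant `m` which turns the multiplier `v`
into the multiplier `v'`. -/
structure IsWeight (m : ℕ) (v v' : SL(2, ℤ) → ℂ) (wt : Mat → ℂ) : Prop where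
  left : ∀ (γ : SL(2, ℤ)) (M : Dm (m : ℤ)), v γ * wt (γ * M.1) = wt M.1
  right : ∀ (γ : SL(2, ℤ)) (M : Dm (m : ℤ)), v' γ * wt (M.1 * γ) = wt M.1

section

variable {k : ℤ} {m : ℕ} [NeZero m] {v v' : SL(2, ℤ) → ℂ} {wt : Mat → ℂ} {f : ℍ → ℂ}
  (hw : IsWeight m v v' wt) (hf : IsModular k v f)
include hw hf

/-- The multiplier of `f` cancels against the left law of the weights, so the Hecke summand is a
function of the coset. -/
theorem IsWeight.smul_slashM (γ : SL(2, ℤ)) (M : Dm (m : ℤ)) :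
    wt (γ • M).1 • slashM k (γ • M).1 f = wt M.1 • slashM k M.1 f := by
  rw [FixedDetMatrices.smul_coe, slashM_mul k (det_SL γ) (det_pos_Dm M),
    isModular_iff_slashM.1 hf, slashM_smul, smul_smul, mul_comm, hw.left]

/-- Right multiplication by `A` permutes the left cosets, and the right law of the weights supplies
the new multiplier. -/
theorem IsWeight.isModular_heckeW : IsModular k v' (heckeW k m wt f) := by
  refine isModular_iff_slashM.2 fun A => ?_
  rw [heckeW, slashM_smul, slashM_sum, smul_comm]
  congr 1
  have h := sum_out_rmul (Φ := fun M : Dm (m : ℤ) => wt M.1 • slashM k M.1 f)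
    (hw.smul_slashM hf) A
  refine Eq.trans ?_ (congrArg (v' A • ·) h)
  simp only [Finset.smul_sum]
  refine Finset.sum_congr rfl fun q _ => ?_
  rw [slashM_smul, ← slashM_mul k (det_pos_Dm _) (det_SL A), smul_smul]
  congr 1
  exact (hw.right A q.out).symm

theorem IsWeight.reflect_heckeW :
    reflect (heckeW k m wt f) = heckeW (-k) m (fun M => wt (EtaMaass.flip M)) (reflect f) := by
  have h1 : ∀ M : Dm (m : ℤ), reflect (slashM k (EtaMaass.flip M.1) f) =
      slashM (-k) M.1 (reflect f) := by
    intro M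
    ext z
    have h2 := det_pos_Dm M
    rw [reflect_apply, slashM, slashM, reflect_apply, uden_flip, act_flip h2, conj_uden h2,
      inv_zpow, zpow_neg]
  have h3 : heckeW k m wt f = ((Real.sqrt m : ℝ) : ℂ)⁻¹ • ∑ q : Qm (m : ℤ),
      wt (flipD q.out).1 • slashM k (flipD q.out).1 f := congrArg _
    (sum_out_flip (Φ := fun M : Dm (m : ℤ) => wt M.1 • slashM k M.1 f) (hw.smul_slashM hf)).symm
  rw [h3, heckeW]
  ext z
  rw [reflect_apply, Pi.smul_apply, Pi.smul_apply, Finset.sum_apply, Finset.sum_apply]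
  congr 1
  refine Finset.sum_congr rfl fun q _ => ?_
  rw [Pi.smul_apply, Pi.smul_apply, ← h1]
  rfl

end

/-! ### The Hecke sums over triangular matrices -/

section

variable {a b d : ℤ} (ha : 0 < a) (hd : 0 < d)
include ha hd

theorem det_tri_pos : 0 < (tri a b d).det := by rw [det_tri]; positivity

theorem coe_act_tri (z : ℍ) : (act (tri a b d) z : ℂ) = (a * z + b) / d := by
  rw [coe_act (det_tri_pos ha hd)]
  simp [tri]

omit ha in
theorem uden_tri (z : ℍ) : uden (tri a b d) z = 1 := by
  have h : den (tri a b d) z = ((d : ℝ) : ℂ) := by simp [den, tri]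
  have hd' : (0 : ℝ) < d := by exact_mod_cast hd
  rw [uden, h, Complex.norm_real, Real.norm_of_nonneg hd'.le, ← Complex.ofReal_mul,
    mul_inv_cancel₀ hd'.ne', Complex.ofReal_one]

omit ha in
theorem slashM_tri (k : ℤ) (f : ℍ → ℂ) : slashM k (tri a b d) f = f ∘ act (tri a b d) := by
  ext z
  rw [slashM, uden_tri hd, one_zpow, inv_one, one_mul, Function.comp_apply]

theorem im_act_tri (z : ℍ) : ((act (tri a b d) z).im : ℂ) = a / d * z.im := by
  have h1 : (act (tri a b d) z).im = a / d * z.im := by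
    rw [im_act (det_tri_pos ha hd), det_tri]
    have h : den (tri a b d) z = ((d : ℝ) : ℂ) := by simp [den, tri]
    have hd' : (d : ℝ) ≠ 0 := by exact_mod_cast hd.ne'
    rw [h, Complex.normSq_ofReal]
    push_cast
    field_simp
  rw [h1]
  push_cast
  rfl

theorem deriv₂_comp_tri {f : ℍ → ℂ} (hf : Smooth f) (z : ℍ) (w : ℂ) :
    deriv₂ (f ∘ act (tri a b d)) z w = (a / d : ℂ) * deriv₂ f (act (tri a b d) z) w := by
  rw [deriv₂_comp_act hf (det_tri_pos ha hd), det_tri]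
  have h : den (tri a b d) z = d := by simp [den, tri]
  have hd' : (d : ℂ) ≠ 0 := by exact_mod_cast hd.ne'
  have h2 : ((a * d : ℤ) : ℂ) / den (tri a b d) z ^ 2 * w = (a / d : ℝ) • w := by
    rw [h, Complex.real_smul]
    push_cast
    field_simp
  rw [h2, map_smul, Complex.real_smul]
  push_cast
  rfl

theorem dX_comp_tri {f : ℍ → ℂ} (hf : Smooth f) :
    dX (f ∘ act (tri a b d)) = (a / d : ℂ) • (dX f ∘ act (tri a b d)) :=
  funext fun z => deriv₂_comp_tri ha hd hf z 1

theorem dY_comp_tri {f : ℍ → ℂ} (hf : Smooth f) :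
    dY (f ∘ act (tri a b d)) = (a / d : ℂ) • (dY f ∘ act (tri a b d)) :=
  funext fun z => deriv₂_comp_tri ha hd hf z Complex.I

/-- The substitution multiplies `y` and each derivative by the same real factor `a/d`, and in the
operator every derivative comes with one `y`. -/
theorem lowering_comp_tri (k : ℤ) {f : ℍ → ℂ} (hf : Smooth f) :
    lowering k (f ∘ act (tri a b d)) = lowering k f ∘ act (tri a b d) := by
  ext z
  rw [Function.comp_apply, lowering_apply, lowering_apply, dX_comp_tri ha hd hf,
    dY_comp_tri ha hd hf, im_act_tri ha hd]
  simp only [Pi.smul_apply, Function.comp_apply, smul_eq_mul]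
  ring

theorem laplacian_comp_tri (k : ℤ) {f : ℍ → ℂ} (hf : Smooth f) :
    laplacian k (f ∘ act (tri a b d)) = laplacian k f ∘ act (tri a b d) := by
  have h := det_tri_pos (b := b) ha hd
  ext z
  rw [Function.comp_apply, laplacian, laplacian, dX_comp_tri ha hd hf, dY_comp_tri ha hd hf,
    dX_const_smul (hf.dX.comp_act h), dX_comp_tri ha hd hf.dX,
    dY_const_smul (hf.dY.comp_act h), dY_comp_tri ha hd hf.dY, im_act_tri ha hd]
  simp only [Pi.smul_apply, Function.comp_apply, smul_eq_mul]
  ring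

end

theorem pos_of_mem_divisors {m d : ℕ} (hd : d ∈ m.divisors) :
    (0 : ℤ) < (m / d : ℕ) ∧ (0 : ℤ) < d := by
  have h1 := Nat.pos_of_mem_divisors hd
  have h2 := Nat.div_pos (Nat.divisor_le hd) h1
  exact ⟨by exact_mod_cast h2, by exact_mod_cast h1⟩

theorem heckeSum_eq (k : ℕ) (ζ : ℂ) (m : ℕ) (f : ℍ → ℂ) :
    heckeSum k ζ m f = ((Real.sqrt m : ℝ) : ℂ)⁻¹ • ∑ d ∈ m.divisors, ∑ b ∈ Finset.range d,
      (chi k d * ζ ^ (-((b : ℤ) * (d : ℤ)))) • (f ∘ act (tri ((m / d : ℕ) : ℤ) b d)) := by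
  ext z
  simp only [heckeSum, Pi.smul_apply, Finset.sum_apply, smul_eq_mul, Function.comp_apply]
  congr 1
  refine Finset.sum_congr rfl fun d hd => ?_
  rw [Finset.mul_sum]
  refine Finset.sum_congr rfl fun b _ => ?_
  obtain ⟨h1, h2⟩ := pos_of_mem_divisors hd
  have h3 : act (tri ((m / d : ℕ) : ℤ) b d) z =
      ofComplex ((((m / d : ℕ) : ℂ) * z + (b : ℂ)) / (d : ℂ)) := by
    rw [← UpperHalfPlane.ofComplex_apply (act _ z), coe_act_tri h1 h2]
    simp only [Int.cast_natCast]
  rw [h3]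
  ring

theorem heckeSum_add (k : ℕ) (ζ : ℂ) (m : ℕ) (f g : ℍ → ℂ) :
    heckeSum k ζ m (f + g) = heckeSum k ζ m f + heckeSum k ζ m g := by
  ext z
  simp only [heckeSum, Pi.add_apply, mul_add, Finset.sum_add_distrib]

theorem heckeSum_const_smul (k : ℕ) (ζ : ℂ) (m : ℕ) (c : ℂ) (f : ℍ → ℂ) :
    heckeSum k ζ m (c • f) = c • heckeSum k ζ m f := by
  rw [heckeSum_eq, heckeSum_eq, smul_comm c]
  congr 1
  rw [Finset.smul_sum]
  refine Finset.sum_congr rfl fun d hd => ?_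
  rw [Finset.smul_sum]
  refine Finset.sum_congr rfl fun b _ => ?_
  rw [smul_comm c]
  rfl

theorem Smooth.heckeSum {f : ℍ → ℂ} (hf : Smooth f) (k : ℕ) (ζ : ℂ) (m : ℕ) :
    Smooth (heckeSum k ζ m f) := by
  rw [heckeSum_eq]
  refine (smooth_sum _ fun d hd => smooth_sum _ fun b _ => ?_).const_smul _
  obtain ⟨h1, h2⟩ := pos_of_mem_divisors hd
  exact (hf.comp_act (det_tri_pos h1 h2)).const_smul _

theorem map_sum_of_smooth {D : (ℍ → ℂ) → ℍ → ℂ}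
    (hadd : ∀ f g, Smooth f → Smooth g → D (f + g) = D f + D g)
    (hsmul : ∀ (c : ℂ) f, Smooth f → D (c • f) = c • D f) {ι : Type*} (s : Finset ι)
    {f : ι → ℍ → ℂ} (hf : ∀ i ∈ s, Smooth (f i)) :
    D (∑ i ∈ s, f i) = ∑ i ∈ s, D (f i) := by
  classical
  induction s using Finset.induction_on with
  | empty =>
    have := hsmul 0 0 (smooth_const 0)
    simpa using this
  | insert i s hi ih =>
    rw [Finset.sum_insert hi, Finset.sum_insert hi, hadd _ _ (hf i (by simp))
      (smooth_sum _ fun j hj => hf j (by simp [hj])), ih fun j hj => hf j (by simp [hj])]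

/-- Hecke sums commute with invariant differential operators. -/
theorem map_heckeSum {D : (ℍ → ℂ) → ℍ → ℂ}
    (hadd : ∀ f g, Smooth f → Smooth g → D (f + g) = D f + D g)
    (hsmul : ∀ (c : ℂ) f, Smooth f → D (c • f) = c • D f)
    (htri : ∀ (a b d : ℤ), 0 < a → 0 < d → ∀ f, Smooth f →
      D (f ∘ act (tri a b d)) = D f ∘ act (tri a b d))
    {f : ℍ → ℂ} (hf : Smooth f) (k : ℕ) (ζ : ℂ) (m : ℕ) :
    D (heckeSum k ζ m f) = heckeSum k ζ m (D f) := by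
  have hs : ∀ d ∈ m.divisors, ∀ b : ℕ, Smooth (f ∘ act (tri ((m / d : ℕ) : ℤ) b d)) := by
    intro d hd b
    obtain ⟨h1, h2⟩ := pos_of_mem_divisors hd
    exact hf.comp_act (det_tri_pos h1 h2)
  have hs' : ∀ d ∈ m.divisors, Smooth (∑ b ∈ Finset.range d,
      (chi k d * ζ ^ (-((b : ℤ) * (d : ℤ)))) • (f ∘ act (tri ((m / d : ℕ) : ℤ) b d))) :=
    fun d hd => smooth_sum _ fun b _ => (hs d hd b).const_smul _
  rw [heckeSum_eq, heckeSum_eq, hsmul _ _ (smooth_sum _ hs'), map_sum_of_smooth hadd hsmul _ hs']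
  congr 1
  refine Finset.sum_congr rfl fun d hd => ?_
  obtain ⟨h1, h2⟩ := pos_of_mem_divisors hd
  rw [map_sum_of_smooth hadd hsmul _ fun b _ => (hs d hd b).const_smul _]
  refine Finset.sum_congr rfl fun b _ => ?_
  rw [hsmul _ _ (hs d hd b), htri _ _ _ h1 h2 _ hf]

theorem lowering_heckeSum {f : ℍ → ℂ} (hf : Smooth f) (j : ℤ) (k : ℕ) (ζ : ℂ) (m : ℕ) :
    lowering j (heckeSum k ζ m f) = heckeSum k ζ m (lowering j f) :=
  map_heckeSum (fun _ _ hf hg => lowering_add hf hg j) (fun c _ hf => lowering_const_smul hf j c)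
    (fun _ _ _ ha hd _ hf => lowering_comp_tri ha hd j hf) hf k ζ m

theorem laplacian_heckeSum {f : ℍ → ℂ} (hf : Smooth f) (j : ℤ) (k : ℕ) (ζ : ℂ) (m : ℕ) :
    laplacian j (heckeSum k ζ m f) = heckeSum k ζ m (laplacian j f) :=
  map_heckeSum (fun _ _ hf hg => laplacian_add hf hg j)
    (fun c _ hf => laplacian_const_smul hf j c)
    (fun _ _ _ ha hd _ hf => laplacian_comp_tri ha hd j hf) hf k ζ m

theorem loweringIter_heckeSum {f : ℍ → ℂ} (hf : Smooth f) (j : ℤ) (n k : ℕ) (ζ : ℂ) (m : ℕ) :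
    loweringIter j n (heckeSum k ζ m f) = heckeSum k ζ m (loweringIter j n f) := by
  induction n with
  | zero => rfl
  | succ n ih =>
    rw [loweringIter, ih, lowering_heckeSum (hf.loweringIter j n)]
    rfl

/-- Triangular matrices represent the cosets, and their automorphy factor is 1. One formula of
triangular sums thus serves every weight `j`. -/
theorem heckeSum_eq_heckeW {j : ℤ} {k : ℕ} {ζ : ℂ} {m : ℕ} [NeZero m] {v v' : SL(2, ℤ) → ℂ}
    {wt : Mat → ℂ} {f : ℍ → ℂ} (hw : IsWeight m v v' wt)
    (htri : ∀ a b d : ℕ, a * d = m →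
      wt (tri a b d) = chi k d * ζ ^ (-((b : ℤ) * (d : ℤ))))
    (hf : IsModular j v f) : heckeSum k ζ m f = heckeW j m wt f := by
  rw [heckeSum_eq, heckeW, ← sum_tri (fun M => wt M • slashM j M f) (hw.smul_slashM hf)]
  congr 1
  refine Finset.sum_congr rfl fun d hd => Finset.sum_congr rfl fun b _ => ?_
  obtain ⟨h1, h2⟩ := pos_of_mem_divisors hd
  rw [slashM_tri h2, htri _ _ _ (Nat.div_mul_cancel (Nat.dvd_of_mem_divisors hd))]

/-! ### The weights of the Hecke operators -/

/-- A system of weights that realizes the Hecke sum `heckeSum k ζ m`. -/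
structure IsHeckeWeight (k : ℕ) (ζ : ℂ) (m : ℕ) (v v' : SL(2, ℤ) → ℂ) (wt : Mat → ℂ) : Prop
    extends IsWeight m v v' wt where
  tri : ∀ a b d : ℕ, a * d = m → wt (tri a b d) = chi k d * ζ ^ (-((b : ℤ) * (d : ℤ)))
  flip : ∀ M : Dm (m : ℤ), wt (flip M.1) = conj (wt M.1)
  chi_conj : ∀ a d : ℕ, a * d = m → conj (chi k d) = chi k d
  norm : ∀ M : Dm (m : ℤ), ‖wt M.1‖ = 1

theorem IsHeckeWeight.conj {k : ℕ} {ζ : ℂ} {m : ℕ} {v v' : SL(2, ℤ) → ℂ} {wt : Mat → ℂ}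
    (h : IsHeckeWeight k ζ m v v' wt) :
    IsHeckeWeight k (conj ζ) m (fun A => conj (v A)) (fun A => conj (v' A))
      (fun M => conj (wt M)) where
  left γ M := by rw [← map_mul, h.left]
  right γ M := by rw [← map_mul, h.right]
  tri a b d hd := by rw [h.tri a b d hd, map_mul, h.chi_conj a d hd, map_zpow₀]
  flip M := by rw [h.flip]
  chi_conj := h.chi_conj
  norm M := by rw [RCLike.norm_conj, h.norm]

/-- The weights for `k m ≡ k mod 12`. -/
def wtOne (k : ℕ) (M : Mat) : ℂ := conj (nu k M)

/-- The matrix `diag(-1, 1)`. -/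
def eps : Mat := !![-1, 0; 0, 1]

/-- The weights for `k m ≡ -k mod 12`. -/
def wtNeg (k : ℕ) (M : Mat) : ℂ := conj (nu k (eps * M))

theorem eps_mul_eps : eps * eps = 1 := by
  ext i j; fin_cases i <;> fin_cases j <;> simp [eps]

theorem det_eps : eps.det = -1 := by simp [eps, Matrix.det_fin_two]

theorem flip_eq (M : Mat) : flip M = eps * M * eps := by
  conv_rhs => rw [Matrix.eta_fin_two M]
  simp [flip, eps]

/-- Moving `eps` past a left factor flips it; hence `wtNeg` has the conjugate multiplier on the left
only. -/
theorem eps_mul (M N : Mat) : eps * (M * N) = flip M * (eps * N) := by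
  have : flip M * (eps * N) = eps * M * (eps * eps) * N := by rw [flip_eq]; noncomm_ring
  rw [this, eps_mul_eps, mul_one, mul_assoc]

theorem eps_mul_flip (M : Mat) : eps * flip M = flip (eps * M) := by
  rw [flip_eq, flip_eq]; noncomm_ring

theorem eps_tri (a b d : ℤ) : eps * tri a b d = tri (-a) (-b) d := by
  ext i j; fin_cases i <;> fin_cases j <;> simp [eps, tri]

theorem nu_mul_conj (k : ℕ) (M : Mat) : nu k M * conj (nu k M) = 1 := by
  rw [conj_nu, mul_inv_cancel₀ (nu_ne_zero k M)]

/-- If `k` is odd, the congruence forces `d` to be odd. So `k(d - 1)` is even and `χ_k(d) = ±1`. -/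
theorem chi_conj_of_modEq {k d : ℕ} {a : ℤ} (h : (k : ℤ) * (a * d) ≡ k [ZMOD 12]) :
    conj (chi k d) = chi k d := by
  have h2 : (2 : ℤ) ∣ (k : ℤ) * ((d : ℤ) - 1) := by
    have h1 : ((k * (a * d) : ℤ) : ZMod 2) = ((k : ℤ) : ZMod 2) :=
      (ZMod.intCast_eq_intCast_iff _ _ 2).2 (h.of_dvd (by norm_num))
    have h3 : ((k * (d - 1) : ℤ) : ZMod 2) = 0 := by
      push_cast at h1 ⊢
      revert h1
      generalize (k : ZMod 2) = x
      generalize (a : ZMod 2) = y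
      generalize (d : ZMod 2) = z
      revert x y z
      decide
    exact (ZMod.intCast_zmod_eq_zero_iff_dvd _ 2).1 h3
  obtain ⟨n, hn⟩ := h2
  rw [chi, hn, zpow_mul, map_zpow₀]
  congr 1
  rw [zpow_ofNat, map_pow, Complex.conj_I, neg_sq]

theorem conj_xi (k : ℕ) : conj (xi k) = (xi k)⁻¹ := by
  have h : ‖xi k‖ = 1 := by
    rw [xi, show 2 * (Real.pi : ℂ) * Complex.I * ((k : ℂ) / 12) =
      ((2 * Real.pi * (k / 12) : ℝ) : ℂ) * Complex.I by push_cast; ring]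
    exact Complex.norm_exp_ofReal_mul_I _
  rw [Complex.inv_def, Complex.normSq_eq_norm_sq, h]
  simp

section

variable {k m : ℕ}

theorem modEq_det_Dm {x : ℤ} (hm : (k : ℤ) * m ≡ x [ZMOD 12]) (M : Dm (m : ℤ)) :
    (k : ℤ) * M.1.det ≡ x [ZMOD 12] := by rw [M.2]; exact hm

theorem modEq_det_SL (γ : SL(2, ℤ)) : (k : ℤ) * (γ : Mat).det ≡ k [ZMOD 12] := by
  rw [γ.det_coe, mul_one]

theorem modEq_det_eps_mul {M : Mat} (hm : (k : ℤ) * M.det ≡ -k [ZMOD 12]) :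
    (k : ℤ) * (eps * M).det ≡ k [ZMOD 12] := by
  rw [Matrix.det_mul, det_eps, neg_one_mul, mul_neg]
  simpa using hm.neg

theorem nu_flipSL (γ : SL(2, ℤ)) : nu k (flip (γ : Mat)) = conj (nu k γ) :=
  nu_flip (Or.inl (modEq_det_SL γ))

theorem isHeckeWeight_one (hm : (k : ℤ) * m ≡ k [ZMOD 12]) :
    IsHeckeWeight k (xi k) m (vEta k) (vEta k) (wtOne k) where
  left γ M := by
    rw [wtOne, nu_mul (modEq_det_SL γ) (modEq_det_Dm hm M), vEta_eq_nu, map_mul, ← mul_assoc,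
      nu_mul_conj, one_mul, wtOne]
  right γ M := by
    rw [wtOne, nu_mul (modEq_det_Dm hm M) (modEq_det_SL γ), vEta_eq_nu, map_mul, mul_left_comm,
      nu_mul_conj, mul_one, wtOne]
  tri a b d h := by
    have h1 := chi_conj_of_modEq (k := k) (d := d) (a := a) (by rw [← h] at hm; exact_mod_cast hm)
    rw [chi] at h1
    rw [wtOne, nu_tri, map_mul, h1, map_zpow₀, conj_xi, inv_zpow, ← zpow_neg, chi]
  flip M := by
    rw [wtOne, wtOne, nu_flip (Or.inl (modEq_det_Dm hm M))]
  chi_conj a d h :=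
    chi_conj_of_modEq (a := a) (by rw [← h] at hm; exact_mod_cast hm)
  norm M := by rw [wtOne, RCLike.norm_conj, norm_nu]

/-- The matrix `eps * M` has determinant `-m`, for which `nu` is multiplicative. On triangular
matrices `eps` changes `b` to `-b`, which replaces `ξ` by its conjugate. -/
theorem isHeckeWeight_neg (hm : (k : ℤ) * m ≡ -k [ZMOD 12]) :
    IsHeckeWeight k (conj (xi k)) m (fun A => conj (vEta k A)) (vEta k) (wtNeg k) where
  left γ M := by
    rw [wtNeg, eps_mul, nu_mul (by rw [det_flip]; exact modEq_det_SL γ)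
      (modEq_det_eps_mul (modEq_det_Dm hm M)), nu_flipSL, vEta_eq_nu, map_mul, Complex.conj_conj,
      ← mul_assoc, mul_comm (conj (nu k γ)), nu_mul_conj, one_mul, wtNeg]
  right γ M := by
    rw [wtNeg, ← mul_assoc, nu_mul (modEq_det_eps_mul (modEq_det_Dm hm M)) (modEq_det_SL γ),
      vEta_eq_nu, map_mul, mul_left_comm, nu_mul_conj, mul_one, wtNeg]
  tri a b d h := by
    have h1 := chi_conj_of_modEq (k := k) (d := d) (a := -a) (by
      rw [neg_mul, mul_neg]
      have := hm.neg
      rw [← h] at this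
      simpa using this)
    rw [chi] at h1
    rw [wtNeg, eps_tri, nu_tri, map_mul, h1, map_zpow₀, neg_mul, chi]
  flip M := by
    rw [wtNeg, wtNeg, eps_mul_flip, nu_flip (Or.inl (modEq_det_eps_mul (modEq_det_Dm hm M)))]
  chi_conj a d h :=
    chi_conj_of_modEq (k := k) (d := d) (a := -a) (by
      rw [neg_mul, mul_neg]
      have := hm.neg
      rw [← h] at this
      simpa using this)
  norm M := by rw [wtNeg, RCLike.norm_conj, norm_nu]

/-! ### Weights of adjugate matrices -/

theorem mul_adjugate_eq_tri (M : Dm (m : ℤ)) : M.1.adjugate * M.1 = tri m 0 m := by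
  rw [Matrix.adjugate_mul, M.2]
  ext i j; fin_cases i <;> fin_cases j <;> simp [tri]

theorem det_adjugate (M : Mat) : M.adjugate.det = M.det := by
  rw [Matrix.det_adjugate]; simp

theorem wtOne_adjugate (hm : (k : ℤ) * m ≡ k [ZMOD 12]) (M : Dm (m : ℤ)) :
    conj (wtOne k M.1.adjugate) = wtOne k M.1 := by
  have h := nu_mul (k := k) (M := M.1.adjugate) (N := M.1)
    (by rw [det_adjugate]; exact modEq_det_Dm hm M) (modEq_det_Dm hm M)
  rw [mul_adjugate_eq_tri, nu_scalar_of_one hm] at h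
  rw [wtOne, wtOne, Complex.conj_conj, conj_nu]
  exact eq_inv_of_mul_eq_one_left h.symm

/-- Multiplicativity is applied to `(eps · adj M)(M · eps) = m`, where `M · eps` is the flip of `eps
· M`. The sign is the value of `nu` at the scalar matrix. -/
theorem wtNeg_adjugate (hm : (k : ℤ) * m ≡ -k [ZMOD 12]) (M : Dm (m : ℤ)) :
    conj (wtNeg k M.1.adjugate) = (-1) ^ k * conj (wtNeg k M.1) := by
  have h1 := modEq_det_eps_mul (M := M.1.adjugate) (by rw [det_adjugate]; exact modEq_det_Dm hm M)
  have h2 : flip (eps * M.1) = M.1 * eps := by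
    rw [flip_eq, ← mul_assoc, eps_mul_eps, one_mul]
  have h3 := modEq_det_eps_mul (modEq_det_Dm hm M)
  have h4 : nu k (M.1 * eps) = conj (nu k (eps * M.1)) := by
    rw [← h2, nu_flip (Or.inl h3)]
  have h5 : eps * M.1.adjugate * (M.1 * eps) = tri m 0 m := by
    rw [mul_assoc, ← mul_assoc M.1.adjugate, mul_adjugate_eq_tri]
    ext i j; fin_cases i <;> fin_cases j <;> simp [tri, eps]
  have h := nu_mul (k := k) h1 (N := M.1 * eps) (by rw [← h2, det_flip]; exact h3)
  rw [h5, nu_scalar_of_neg_one hm, h4] at h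
  rw [wtNeg, wtNeg, Complex.conj_conj, Complex.conj_conj, h, mul_assoc, mul_comm (conj _),
    nu_mul_conj, mul_one]

end

section

variable {j : ℤ} {k : ℕ} {ζ : ℂ} {m : ℕ} [NeZero m] {v v' : SL(2, ℤ) → ℂ} {wt : Mat → ℂ}
  {f : ℍ → ℂ} (h : IsHeckeWeight k ζ m v v' wt)
include h

theorem IsHeckeWeight.heckeSum_eq (hf : IsModular j v f) :
    heckeSum k ζ m f = heckeW j m wt f :=
  heckeSum_eq_heckeW h.toIsWeight h.tri hf

theorem IsHeckeWeight.isModular (hf : IsModular j v f) : IsModular j v' (heckeSum k ζ m f) := by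
  rw [h.heckeSum_eq hf]
  exact h.isModular_heckeW hf

theorem IsHeckeWeight.reflect (hv : ∀ A, v (flipSL A) = conj (v A)) (hf : IsModular j v f) :
    heckeSum k (conj ζ) m (reflect f) = EtaMaass.reflect (heckeSum k ζ m f) := by
  have hr := hf.reflect
  simp only [hv] at hr
  rw [h.heckeSum_eq hf, h.reflect_heckeW hf, h.conj.heckeSum_eq hr, heckeW, heckeW]
  simp only [h.flip]

/-- Lowering commutes with every triangular substitution; only the reflection, which flips the
cosets, conjugates `ζ`. -/
theorem IsHeckeWeight.Theta (hv : ∀ A, v (flipSL A) = conj (v A)) (hv1 : ∀ A, ‖v A‖ = 1) {R : ℝ}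
    (hf : IsMaassForm k v R f) :
    EtaMaass.Theta k (heckeSum k ζ m f) = heckeSum k (conj ζ) m (EtaMaass.Theta k f) := by
  rw [EtaMaass.Theta, loweringIter_heckeSum hf.smooth, EtaMaass.Theta,
    h.reflect hv (hf.loweringIter hv1 k).isModular]

end

/-! ### Almost every orbit meets the fundamental domain exactly twice -/

theorem volume_upperHalfPlane_eq_zero {s : Set ℍ} {t : Set ℂ} (ht : volume t = 0)
    (h : ∀ z ∈ s, (z : ℂ) ∈ t) : volume s = 0 := by
  rw [UpperHalfPlane.volume_eq_lintegral]
  exact setLIntegral_measure_zero _ _ (measure_mono_null (Set.image_subset_iff.2 h) ht)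

theorem volume_re_eq (c : ℝ) : volume {w : ℂ | w.re = c} = 0 := by
  have h : {w : ℂ | w.re = c} = Complex.measurableEquivRealProd ⁻¹' ({c} ×ˢ Set.univ) := by
    ext w
    simp [Complex.measurableEquivRealProd_apply]
  rw [h, Complex.volume_preserving_equiv_real_prod.measure_preimage_equiv,
    Measure.volume_eq_prod, Measure.prod_prod]
  simp

theorem volume_fd_sdiff_fdo : volume (ModularGroup.fd \ ModularGroup.fdo) = 0 := by
  refine volume_upperHalfPlane_eq_zero (t := Metric.sphere 0 1 ∪ ({w : ℂ | w.re = 1 / 2} ∪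
    {w : ℂ | w.re = -(1 / 2)})) ?_ ?_
  · rw [measure_union_null_iff, measure_union_null_iff]
    exact ⟨Measure.addHaar_sphere _ _ _, volume_re_eq _, volume_re_eq _⟩
  · rintro z ⟨⟨h1, h2⟩, h3⟩
    by_contra h4
    simp only [Set.mem_union, mem_sphere_zero_iff_norm, Set.mem_ofPred_eq, not_or] at h4
    refine h3 ⟨lt_of_le_of_ne h1 fun h => h4.1 ?_, lt_of_le_of_ne h2 fun h => ?_⟩
    · rw [Complex.normSq_eq_norm_sq] at h
      have := norm_nonneg (z : ℂ)
      nlinarith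
    · rcases (abs_eq (by norm_num)).1 h with h | h
      · exact h4.2.1 h
      · exact h4.2.2 h

theorem measurePreserving_act (M : Mat) : MeasurePreserving (act M) :=
  measurePreserving_smul (glOf M) volume

theorem measurableEmbedding_act (M : Mat) : MeasurableEmbedding (act M) :=
  measurableEmbedding_const_smul (glOf M)

theorem measurable_act (M : Mat) : Measurable (act M) := (measurePreserving_act M).measurable

instance (m : ℤ) : Countable (Dm m) := 
  have : Countable Mat := inferInstanceAs (Countable (Fin 2 → Fin 2 → ℤ))
  inferInstanceAs (Countable {A : Mat // A.det = m})

instance : Countable SL(2, ℤ) := 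
  have : Countable Mat := inferInstanceAs (Countable (Fin 2 → Fin 2 → ℤ))
  inferInstanceAs (Countable {A : Mat // A.det = 1})

/-- For almost all `z`, the orbit of each `Mz` avoids the boundary of the fundamental domain. -/
theorem ae_mem_fdo (m : ℤ) : ∀ᵐ z : ℍ, ∀ (M : Dm m) (γ : SL(2, ℤ)),
    act γ (act M.1 z) ∈ ModularGroup.fd → act γ (act M.1 z) ∈ ModularGroup.fdo := by
  rw [ae_all_iff]
  intro M
  rw [ae_all_iff]
  intro γ
  have h : ∀ᵐ z : ℍ, ¬ z ∈ ModularGroup.fd \ ModularGroup.fdo :=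
    measure_eq_zero_iff_ae_notMem.1 volume_fd_sdiff_fdo
  have h2 := ((measurePreserving_act γ).comp (measurePreserving_act M.1)).quasiMeasurePreserving.ae h
  filter_upwards [h2] with z hz h3
  by_contra h4
  exact hz ⟨h3, h4⟩

/-- Two elements of SL(2, ℤ) that carry `z` into the open fundamental domain differ by a sign. -/
theorem exists_forall_act_mem_fd {z : ℍ} (hz : ∀ γ : SL(2, ℤ),
    act γ z ∈ ModularGroup.fd → act γ z ∈ ModularGroup.fdo) :
    ∃ γ₀ : SL(2, ℤ), ∀ γ : SL(2, ℤ), act γ z ∈ ModularGroup.fd ↔ γ = γ₀ ∨ γ = -γ₀ := by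
  simp only [act_SL] at hz ⊢
  obtain ⟨γ₀, h0⟩ := ModularGroup.exists_smul_mem_fd z
  refine ⟨γ₀, fun γ => ⟨fun h => ?_, ?_⟩⟩
  · have h1 : (γ * γ₀⁻¹) • (γ₀ • z) ∈ ModularGroup.fdo := by
      rw [mul_smul, inv_smul_smul]; exact hz γ h
    rcases ModularGroup.eq_one_or_neg_one_of_mem_fdo_mem_fdo (hz γ₀ h0) h1 with h2 | h2
    · exact Or.inl (mul_inv_eq_one.1 h2)
    · right
      rw [mul_inv_eq_iff_eq_mul] at h2
      rw [h2, neg_one_mul]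
  · rintro (rfl | rfl)
    · exact h0
    · rwa [ModularGroup.SL_neg_smul]

section

variable {m : ℕ} [NeZero m]

theorem smul_left_cancel_Dm {γ γ' : SL(2, ℤ)} {M : Dm (m : ℤ)} (h : γ • M = γ' • M) : γ = γ' := by
  have h1 := congrArg Subtype.val h
  rw [FixedDetMatrices.smul_coe, FixedDetMatrices.smul_coe] at h1
  have h2 := congrArg (· * M.1.adjugate) h1
  simp only [mul_assoc, Matrix.mul_adjugate, M.2] at h2
  rw [mul_smul_comm, mul_smul_comm, mul_one, mul_one] at h2
  exact Subtype.ext (smul_right_injective Mat (r := (m : ℤ))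
    (by exact_mod_cast NeZero.ne m) h2)

theorem SL_ne_neg (γ : SL(2, ℤ)) : γ ≠ -γ := by
  intro h
  have h1 : ∀ i j, γ i j = 0 := by
    intro i j
    have := congrArg (fun A : SL(2, ℤ) => A i j) h
    simp only [Matrix.SpecialLinearGroup.coe_neg, Matrix.neg_apply] at this
    omega
  have h2 := γ.det_coe
  rw [Matrix.det_fin_two, h1, h1, h1] at h2
  simp at h2

/-- Summing a left invariant function over all matrices which map `z` to the fundamental domain
amounts to summing it twice over all cosets. -/
theorem tsum_indicator_fd {β : Type*} [AddCommMonoid β] [TopologicalSpace β]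
    {K : Dm (m : ℤ) → β} (hK : ∀ (γ : SL(2, ℤ)) M, K (γ • M) = K M) {z : ℍ}
    (hz : ∀ (M : Dm (m : ℤ)) (γ : SL(2, ℤ)),
      act γ (act M.1 z) ∈ ModularGroup.fd → act γ (act M.1 z) ∈ ModularGroup.fdo) :
    ∑' M : Dm (m : ℤ), (act M.1 ⁻¹' ModularGroup.fd).indicator (fun _ => K M) z =
      2 • ∑ q : Qm (m : ℤ), K q.out := by
  classical
  choose γ₀ hγ₀ using fun q : Qm (m : ℤ) => exists_forall_act_mem_fd (hz q.out)
  -- A coset and a sign parametrize the matrices that carry `z` into the fundamental domain.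
  let e : Qm (m : ℤ) × Bool → Dm (m : ℤ) := fun x =>
    (if x.2 then γ₀ x.1 else -γ₀ x.1) • x.1.out
  have hact : ∀ (γ : SL(2, ℤ)) (M : Dm (m : ℤ)), act (γ • M).1 z = act γ (act M.1 z) :=
    fun γ M => act_mul (det_SL γ) (det_pos_Dm M) z
  have he : Function.Injective e := by
    rintro ⟨q, b⟩ ⟨q', b'⟩ h
    have h1 : q = q' := by
      have := congrArg qmk h
      simpa only [e, qmk_smul, qmk_out] using this
    subst h1
    have h2 := smul_left_cancel_Dm h
    have h3 := SL_ne_neg (γ₀ q)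
    cases b <;> cases b' <;> simp_all
  have hs : Function.support
      (fun M : Dm (m : ℤ) => (act M.1 ⁻¹' ModularGroup.fd).indicator (fun _ => K M) z) ⊆
      Set.range e := by
    intro M hM
    have h1 : act M.1 z ∈ ModularGroup.fd := by
      by_contra h
      exact hM (Set.indicator_of_notMem (s := act M.1 ⁻¹' ModularGroup.fd) h _)
    obtain ⟨γ, hγ⟩ := exists_smul_out M
    rw [← hγ, hact, hγ₀] at h1
    rcases h1 with h1 | h1
    · exact ⟨⟨qmk M, true⟩, by simp [e, ← h1, hγ]⟩
    · exact ⟨⟨qmk M, false⟩, by simp [e, ← h1, hγ]⟩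
  rw [← he.tsum_eq hs, tsum_fintype, Fintype.sum_prod_type, Finset.smul_sum]
  refine Finset.sum_congr rfl fun q _ => ?_
  have h1 : ∀ b, (act (e ⟨q, b⟩).1 ⁻¹' ModularGroup.fd).indicator (fun _ => K (e ⟨q, b⟩)) z =
      K q.out := by
    intro b
    rw [Set.indicator_of_mem, hK]
    rw [Set.mem_preimage, hact, hγ₀]
    cases b <;> simp
  simp only [h1, Fintype.sum_bool, two_nsmul]

/-! ### Unfolding -/

/-- The adjugate, as an involution of the matrices of determinant `m`. -/
def adjD {m : ℤ} (M : Dm m) : Dm m := ⟨M.1.adjugate, by rw [det_adjugate, M.2]⟩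

theorem adjD_adjD {m : ℤ} (M : Dm m) : adjD (adjD M) = M :=
  FixedDetMatrices.ext' _ _ (by
    simp [adjD, Matrix.adjugate_fin_two, ← Matrix.eta_fin_two])

/-- The adjugate as a permutation of the matrices of determinant `m`. -/
def adjEquiv (m : ℤ) : Dm m ≃ Dm m := ⟨adjD, adjD, adjD_adjD, adjD_adjD⟩

theorem act_scalar (m : ℕ) [NeZero m] (z : ℍ) : act (tri m 0 m) z = z := by
  have hm : (0 : ℤ) < m := by exact_mod_cast Nat.pos_of_ne_zero (NeZero.ne m)
  refine UpperHalfPlane.ext ?_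
  rw [coe_act_tri hm hm]
  have : (m : ℂ) ≠ 0 := by exact_mod_cast NeZero.ne m
  push_cast
  field_simp
  simp

theorem act_adjD_act (M : Dm (m : ℤ)) (z : ℍ) : act (adjD M).1 (act M.1 z) = z := by
  rw [← act_mul (det_pos_Dm _) (det_pos_Dm _), adjD, mul_adjugate_eq_tri, act_scalar]

theorem uden_adjD_mul (M : Dm (m : ℤ)) (z : ℍ) :
    uden (adjD M).1 (act M.1 z) * uden M.1 z = 1 := by
  have hm : (0 : ℤ) < m := by exact_mod_cast Nat.pos_of_ne_zero (NeZero.ne m)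
  rw [← uden_mul (det_pos_Dm _) (det_pos_Dm _), adjD, mul_adjugate_eq_tri, uden_tri hm]

/-- Invariance of a kernel under `SL(2, ℤ)` from both sides. -/
structure IsInvariantKernel {β : Type*} (K : Dm (m : ℤ) → ℍ → β) : Prop where
  left : ∀ (γ : SL(2, ℤ)) M, K (γ • M) = K M
  right : ∀ (γ : SL(2, ℤ)) M z, K (rmul M γ) z = K M (act γ z)

/-- The kernel `K(adj M, Mz)`. -/
def adjKernel {β : Type*} (K : Dm (m : ℤ) → ℍ → β) (M : Dm (m : ℤ)) (z : ℍ) : β :=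
  K (adjD M) (act M.1 z)

/-- The adjugate reverses products, so it exchanges left and right invariance. -/
theorem IsInvariantKernel.adj {β : Type*} {K : Dm (m : ℤ) → ℍ → β} (hK : IsInvariantKernel K) :
    IsInvariantKernel (adjKernel K) where
  left γ M := by
    ext z
    have h1 : adjD (γ • M) = rmul (adjD M) γ⁻¹ := FixedDetMatrices.ext' _ _ (by
      change ((γ : Mat) * M.1).adjugate = M.1.adjugate * ((γ⁻¹ : SL(2, ℤ)) : Mat)
      rw [Matrix.adjugate_mul_distrib, Matrix.SpecialLinearGroup.coe_inv])
    have h2 : act (γ • M).1 z = act γ (act M.1 z) := act_mul (det_SL γ) (det_pos_Dm M) z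
    rw [adjKernel, adjKernel, h1, hK.right, h2, act_SL, act_SL, inv_smul_smul]
  right γ M z := by
    have h1 : adjD (rmul M γ) = γ⁻¹ • adjD M := FixedDetMatrices.ext' _ _ (by
      change (M.1 * (γ : Mat)).adjugate = ((γ⁻¹ : SL(2, ℤ)) : Mat) * M.1.adjugate
      rw [Matrix.adjugate_mul_distrib, Matrix.SpecialLinearGroup.coe_inv])
    have h2 : act (rmul M γ).1 z = act M.1 (act γ z) := act_mul (det_pos_Dm M) (det_SL γ) z
    rw [adjKernel, adjKernel, h1, hK.left, h2]

/-- On `ℍ` the adjugate acts as the inverse, so `w = Mz` interchanges the conditions `z ∈ fd` and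
`Mz ∈ fd`. -/
theorem indicator_adjKernel {β : Type*} [Zero β] (K : Dm (m : ℤ) → ℍ → β) (M : Dm (m : ℤ))
    (z : ℍ) :
    ModularGroup.fd.indicator ((act M.1 ⁻¹' ModularGroup.fd).indicator (adjKernel K M)) z =
      ModularGroup.fd.indicator ((act (adjD M).1 ⁻¹' ModularGroup.fd).indicator (K (adjD M)))
        (act M.1 z) := by
  classical
  simp only [Set.indicator_apply, Set.mem_preimage, act_adjD_act, adjKernel]
  split_ifs <;> rfl

theorem measurableSet_preimage_fd (M : Mat) : MeasurableSet (act M ⁻¹' ModularGroup.fd) :=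
  measurable_act M measurableSet_fd

theorem ae_tsum_indicator {β : Type*} [AddCommMonoid β] [TopologicalSpace β]
    {K : Dm (m : ℤ) → ℍ → β} (hK : IsInvariantKernel K) :
    ∀ᵐ z ∂(volume.restrict ModularGroup.fd),
      ∑' M : Dm (m : ℤ), (act M.1 ⁻¹' ModularGroup.fd).indicator (K M) z =
        2 • ∑ q : Qm (m : ℤ), K q.out z := by
  filter_upwards [ae_restrict_of_ae (ae_mem_fdo m)] with z hz
  exact tsum_indicator_fd (K := fun M => K M z) (fun γ M => by rw [hK.left]) hz

theorem tsum_lintegral_indicator {K : Dm (m : ℤ) → ℍ → ENNReal} (hK : IsInvariantKernel K)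
    (hm : ∀ M, Measurable (K M)) :
    ∑' M : Dm (m : ℤ), ∫⁻ z in ModularGroup.fd,
        (act M.1 ⁻¹' ModularGroup.fd).indicator (K M) z =
      2 * ∑ q : Qm (m : ℤ), ∫⁻ z in ModularGroup.fd, K q.out z := by
  rw [← lintegral_tsum fun M => ((hm M).indicator (measurableSet_preimage_fd _)).aemeasurable,
    lintegral_congr_ae (ae_tsum_indicator hK)]
  simp only [nsmul_eq_mul, Nat.cast_ofNat]
  rw [lintegral_const_mul' _ _ (by simp), lintegral_finsetSum _ fun q _ => hm _]

theorem tsum_lintegral_adjKernel (K : Dm (m : ℤ) → ℍ → ENNReal) :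
    ∑' M : Dm (m : ℤ), ∫⁻ z in ModularGroup.fd,
        (act M.1 ⁻¹' ModularGroup.fd).indicator (adjKernel K M) z =
      ∑' M : Dm (m : ℤ), ∫⁻ z in ModularGroup.fd,
        (act M.1 ⁻¹' ModularGroup.fd).indicator (K M) z := by
  refine (tsum_congr fun M => ?_).trans ((adjEquiv m).tsum_eq fun M : Dm (m : ℤ) =>
    ∫⁻ z in ModularGroup.fd, (act M.1 ⁻¹' ModularGroup.fd).indicator (K M) z)
  rw [← lintegral_indicator measurableSet_fd, ← lintegral_indicator measurableSet_fd]
  simp only [indicator_adjKernel]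
  exact (measurePreserving_act M.1).lintegral_comp_emb (measurableEmbedding_act M.1) _

/-- The unfolding identity for nonnegative kernels. -/
theorem sum_lintegral_adjKernel {K : Dm (m : ℤ) → ℍ → ENNReal} (hK : IsInvariantKernel K)
    (hm : ∀ M, Measurable (K M)) :
    ∑ q : Qm (m : ℤ), ∫⁻ z in ModularGroup.fd, adjKernel K q.out z =
      ∑ q : Qm (m : ℤ), ∫⁻ z in ModularGroup.fd, K q.out z := by
  have h := tsum_lintegral_adjKernel K
  rw [tsum_lintegral_indicator hK hm, tsum_lintegral_indicator hK.adj fun M =>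
    (hm _).comp (measurable_act M.1)] at h
  exact (ENNReal.mul_right_inj (by simp) (by simp)).1 h

omit [NeZero m] in
theorem IsInvariantKernel.enorm {K : Dm (m : ℤ) → ℍ → ℂ} (hK : IsInvariantKernel K) :
    IsInvariantKernel fun M z => ‖K M z‖ₑ where
  left γ M := by simp only [hK.left]
  right γ M z := by rw [hK.right]

theorem tsum_integral_indicator {K : Dm (m : ℤ) → ℍ → ℂ} (hK : IsInvariantKernel K)
    (hm : ∀ M, Measurable (K M)) (hi : ∀ M, IntegrableOn (K M) ModularGroup.fd) :
    ∑' M : Dm (m : ℤ), ∫ z in ModularGroup.fd,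
        (act M.1 ⁻¹' ModularGroup.fd).indicator (K M) z =
      2 * ∑ q : Qm (m : ℤ), ∫ z in ModularGroup.fd, K q.out z := by
  rw [← integral_tsum fun M =>
      ((hm M).indicator (measurableSet_preimage_fd _)).aestronglyMeasurable,
    integral_congr_ae (ae_tsum_indicator hK)]
  · simp only [nsmul_eq_mul, Nat.cast_ofNat]
    rw [integral_const_mul, integral_finsetSum _ fun q _ => hi _]
  -- Absolute convergence, needed to exchange sum and integral, is the nonnegative identity for the
  -- norm of the kernel.
  · have h := tsum_lintegral_indicator hK.enorm fun M => (hm M).enorm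
    simp only [enorm_indicator_eq_indicator_enorm]
    rw [h]
    exact ENNReal.mul_ne_top (by simp) (ENNReal.sum_ne_top.2 fun q _ => (hi _).2.ne)

theorem tsum_integral_adjKernel (K : Dm (m : ℤ) → ℍ → ℂ) :
    ∑' M : Dm (m : ℤ), ∫ z in ModularGroup.fd,
        (act M.1 ⁻¹' ModularGroup.fd).indicator (adjKernel K M) z =
      ∑' M : Dm (m : ℤ), ∫ z in ModularGroup.fd,
        (act M.1 ⁻¹' ModularGroup.fd).indicator (K M) z := by
  refine (tsum_congr fun M => ?_).trans ((adjEquiv m).tsum_eq fun M : Dm (m : ℤ) =>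
    ∫ z in ModularGroup.fd, (act M.1 ⁻¹' ModularGroup.fd).indicator (K M) z)
  rw [← integral_indicator measurableSet_fd, ← integral_indicator measurableSet_fd]
  simp only [indicator_adjKernel]
  exact (measurePreserving_act M.1).integral_comp (measurableEmbedding_act M.1) _

/-- The unfolding identity for integrable kernels. -/
theorem sum_integral_adjKernel {K : Dm (m : ℤ) → ℍ → ℂ} (hK : IsInvariantKernel K)
    (hm : ∀ M, Measurable (K M)) (hi : ∀ M, IntegrableOn (K M) ModularGroup.fd)
    (hi' : ∀ M, IntegrableOn (adjKernel K M) ModularGroup.fd) :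
    ∑ q : Qm (m : ℤ), ∫ z in ModularGroup.fd, adjKernel K q.out z =
      ∑ q : Qm (m : ℤ), ∫ z in ModularGroup.fd, K q.out z := by
  have h := tsum_integral_adjKernel K
  rw [tsum_integral_indicator hK hm hi, tsum_integral_indicator hK.adj (fun M =>
    (hm _).comp (measurable_act M.1)) hi'] at h
  exact mul_left_cancel₀ two_ne_zero h

end

/-! ### Square integrability and adjoints of Hecke operators -/

theorem Smooth.slashM {f : ℍ → ℂ} (hf : Smooth f) (k : ℤ) {M : Mat} (hM : 0 < M.det) :
    Smooth (slashM k M f) := by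
  have h : EtaMaass.slashM k M f = (fun z => uden M z ^ (-k)) * (f ∘ act M) := by
    ext z
    rw [EtaMaass.slashM, ← zpow_neg]; rfl
  rw [h]
  exact (smooth_zpow (smooth_uden hM) (uden_ne_zero hM) _).mul (hf.comp_act hM)

theorem norm_slashM (k : ℤ) {M : Mat} (hM : 0 < M.det) (f : ℍ → ℂ) (z : ℍ) :
    ‖slashM k M f z‖ = ‖f (act M z)‖ := by
  rw [slashM, norm_mul, norm_inv, norm_zpow, norm_uden hM, one_zpow, inv_one, one_mul]

theorem IsModular.norm_act {k : ℤ} {v : SL(2, ℤ) → ℂ} (hv : ∀ A, ‖v A‖ = 1) {f : ℍ → ℂ}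
    (hf : IsModular k v f) (A : SL(2, ℤ)) (z : ℍ) : ‖f (act A z)‖ = ‖f z‖ := by
  rw [hf, norm_mul, norm_mul, hv, norm_zpow, norm_uden (det_SL A), one_zpow, one_mul, one_mul]

section

variable {k : ℤ} {m : ℕ} [NeZero m] {v : SL(2, ℤ) → ℂ} (hv : ∀ A, ‖v A‖ = 1) {f : ℍ → ℂ}
  (hs : Smooth f) (hf : IsModular k v f) (hL : MemLp f 2 (volume.restrict ModularGroup.fd))
include hv hs hf hL

/-- Unfold the kernel `|f(Mz)|²`. Its adjoint kernel is `|f(z)|²`, so the integrals over all cosets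
add up to finitely many copies of the norm of `f`. -/
theorem memLp_slashM (M : Dm (m : ℤ)) :
    MemLp (slashM k M.1 f) 2 (volume.restrict ModularGroup.fd) := by
  let K : Dm (m : ℤ) → ℍ → ENNReal := fun M z => ‖f (act M.1 z)‖ₑ ^ (2 : ℝ)
  have hnorm : ∀ (A : SL(2, ℤ)) z, ‖f (act A z)‖ₑ = ‖f z‖ₑ := fun A z => by
    rw [← ofReal_norm, hf.norm_act hv, ofReal_norm]
  have hK : IsInvariantKernel K := by
    constructor
    · intro γ M
      ext z
      have h2 : act (γ • M).1 z = act γ (act M.1 z) := act_mul (det_SL γ) (det_pos_Dm M) z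
      simp only [K, h2, hnorm]
    · intro γ M z
      have h2 : act (rmul M γ).1 z = act M.1 (act γ z) := act_mul (det_pos_Dm M) (det_SL γ) z
      simp only [K, h2]
  have hm : ∀ M, Measurable (K M) := fun M =>
    (hs.continuous.measurable.comp (measurable_act M.1)).enorm.pow_const _
  have hfin : ∫⁻ z in ModularGroup.fd, ‖f z‖ₑ ^ (2 : ℝ) < ⊤ := by
    have := (eLpNorm_lt_top_iff_lintegral_rpow_enorm_lt_top (by simp) (by simp)).1 hL.2
    simpa using this
  have hsum := sum_lintegral_adjKernel hK hm
  have hadj : ∀ M : Dm (m : ℤ), adjKernel K M = fun z => ‖f z‖ₑ ^ (2 : ℝ) := fun M => by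
    ext z
    simp only [adjKernel, K, act_adjD_act]
  simp only [hadj] at hsum
  have hlt : ∑ q : Qm (m : ℤ), ∫⁻ z in ModularGroup.fd, K q.out z < ⊤ := by
    rw [← hsum]
    exact ENNReal.sum_lt_top.2 fun q _ => hfin
  have h1 := ENNReal.sum_lt_top.1 hlt (qmk M) (Finset.mem_univ _)
  rw [out_apply (Φ := K) hK.left] at h1
  refine ⟨(hs.slashM k (det_pos_Dm M)).continuous.aestronglyMeasurable, ?_⟩
  rw [eLpNorm_lt_top_iff_lintegral_rpow_enorm_lt_top (by simp) (by simp)]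
  refine lt_of_le_of_lt (le_of_eq ?_) h1
  refine lintegral_congr fun z => ?_
  rw [← ofReal_norm, norm_slashM k (det_pos_Dm M), ofReal_norm]
  rfl

theorem memLp_heckeW (wt : Mat → ℂ) :
    MemLp (heckeW k m wt f) 2 (volume.restrict ModularGroup.fd) := by
  have h : ∀ q ∈ (Finset.univ : Finset (Qm (m : ℤ))),
      MemLp (wt q.out.1 • slashM k q.out.1 f) 2 (volume.restrict ModularGroup.fd) :=
    fun q _ => (memLp_slashM hv hs hf hL q.out).const_smul (wt q.out.1)
  exact (memLp_finsetSum' _ h).const_smul (((Real.sqrt m : ℝ) : ℂ)⁻¹)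

/-- The adjoint of a Hecke operator. -/
theorem petersson_heckeW {v' : SL(2, ℤ) → ℂ} (hv' : ∀ A, ‖v' A‖ = 1) {g : ℍ → ℂ}
    (hgs : Smooth g) (hg : IsModular k v' g) (hgL : MemLp g 2 (volume.restrict ModularGroup.fd))
    {wt wt' : Mat → ℂ} (hw : IsWeight m v v' wt)
    (hw' : ∀ M : Dm (m : ℤ), wt' M.1 = conj (wt M.1.adjugate)) :
    petersson (heckeW k m wt f) g = petersson f (heckeW k m wt' g) := by
  let K : Dm (m : ℤ) → ℍ → ℂ := fun M z => wt M.1 * slashM k M.1 f z * conj (g z)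
  have hadj : ∀ M : Dm (m : ℤ), adjKernel K M =
      fun z => f z * conj (wt' M.1 * slashM k M.1 g z) := by
    intro M
    ext z
    have h1 := uden_adjD_mul M z
    have h2 : uden (adjD M).1 (act M.1 z) = conj (uden M.1 z) := by
      rw [conj_uden (det_pos_Dm M)]
      exact eq_inv_of_mul_eq_one_left h1
    simp only [adjKernel, K, slashM, act_adjD_act, h2, hw', map_mul, Complex.conj_conj,
      map_inv₀, map_zpow₀]
    change wt M.1.adjugate * _ * _ = _
    ring
  have hK : IsInvariantKernel K := by
    constructor
    · intro γ M
      ext z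
      have := congrFun (hw.smul_slashM hf γ M) z
      simp only [Pi.smul_apply, smul_eq_mul] at this
      simp only [K, this]
    · intro γ M z
      have h2 : slashM k (rmul M γ).1 f z = (uden γ z ^ k)⁻¹ * slashM k M.1 f (act γ z) :=
        congrFun (slashM_mul k (det_pos_Dm M) (det_SL γ) f) z
      have h3 : wt M.1 = v' γ * wt (rmul M γ).1 := (hw.right γ M).symm
      have h4 : v' γ * conj (v' γ) = 1 := by
        rw [Complex.mul_conj, Complex.normSq_eq_norm_sq, hv']; simp
      simp only [K, h2, hg γ z, h3, map_mul, map_zpow₀, conj_uden (det_SL γ), inv_zpow]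
      linear_combination (-(wt (rmul M γ).1 * (uden γ z ^ k)⁻¹ * slashM k M.1 f (act γ z) *
        conj (g z))) * h4
  have hcs : ∀ M : Dm (m : ℤ), Continuous (slashM k M.1 f) := fun M =>
    (hs.slashM k (det_pos_Dm M)).continuous
  have hi : ∀ M, IntegrableOn (K M) ModularGroup.fd := fun M =>
    ((memLp_slashM hv hs hf hL M).const_mul (wt M.1)).integrable_mul hgL.star
  have hi' : ∀ M, IntegrableOn (adjKernel K M) ModularGroup.fd := fun M => by
    rw [hadj]
    exact hL.integrable_mul ((memLp_slashM hv' hgs hg hgL M).const_mul (wt' M.1)).star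
  have hsum := sum_integral_adjKernel hK (fun M =>
    ((continuous_const.mul (hcs M)).mul
      (Complex.continuous_conj.comp hgs.continuous)).measurable) hi hi'
  simp only [hadj] at hsum
  have e1 : ∀ z, heckeW k m wt f z * conj (g z) =
      ((Real.sqrt m : ℝ) : ℂ)⁻¹ * ∑ q : Qm (m : ℤ), K q.out z := by
    intro z
    simp only [heckeW, Pi.smul_apply, Finset.sum_apply, smul_eq_mul, K, Finset.sum_mul, mul_assoc]
  have e2 : ∀ z, f z * conj (heckeW k m wt' g z) = ((Real.sqrt m : ℝ) : ℂ)⁻¹ *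
      ∑ q : Qm (m : ℤ), f z * conj (wt' q.out.1 * slashM k q.out.1 g z) := by
    intro z
    simp only [heckeW, Pi.smul_apply, Finset.sum_apply, smul_eq_mul, map_mul, map_sum, map_inv₀,
      Complex.conj_ofReal, Finset.mul_sum]
    refine Finset.sum_congr rfl fun q _ => ?_
    ring
  simp only [petersson, e1, e2]
  rw [integral_const_mul, integral_const_mul, integral_finsetSum _ fun q _ => hi _,
    integral_finsetSum _ fun q _ => ?_, hsum]
  have := hi' q.out
  rwa [hadj] at this

end

/-! ### Reduction to diagonal matrices -/

section

variable {m : ℕ} [NeZero m]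

/-- A triangular matrix as a matrix of determinant `m`. -/
def triOf (a b d : ℤ) (h : a * d = m) : Dm (m : ℤ) := ⟨tri a b d, by rw [det_tri, h]⟩

theorem exists_eq_smul_tri (M : Dm (m : ℤ)) : ∃ (γ : SL(2, ℤ)) (a b d : ℤ) (h : a * d = m),
    0 < a ∧ M = γ • triOf a b d h := by
  obtain ⟨x, hx, h⟩ := qmk_triD_surjective (NeZero.ne m) (qmk M)
  obtain ⟨γ, hγ⟩ := qmk_eq_iff.1 h.symm
  have hd := (Finset.mem_sigma.1 hx).1
  refine ⟨γ, _, _, _, ?_, (pos_of_mem_divisors hd).1, hγ.symm⟩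
  exact_mod_cast Nat.div_mul_cancel (Nat.dvd_of_mem_divisors hd)

theorem coe_T_zpow_eq (n : ℤ) : ((ModularGroup.T ^ n : SL(2, ℤ)) : Mat) = !![1, n; 0, 1] :=
  ModularGroup.coe_T_zpow n

/-- A property of matrices of determinant `m` which is invariant under `SL(2, ℤ)` on both sides
holds as soon as it holds for diagonal matrices. -/
theorem induction_diagonal {P : Dm (m : ℤ) → Prop}
    (hl : ∀ (γ : SL(2, ℤ)) M, P M → P (γ • M)) (hr : ∀ (γ : SL(2, ℤ)) M, P (rmul M γ) → P M)
    (hd : ∀ M : Dm (m : ℤ), M.1 0 1 = 0 → M.1 1 0 = 0 → P M) (M : Dm (m : ℤ)) : P M := by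
  -- Euclid's algorithm on the first row: a power of `T` reduces `b` modulo `a`, then `S` brings the
  -- remainder to the corner. The corner of the new triangular form divides that remainder, so it is
  -- smaller than `a`.
  have key : ∀ (n : ℕ) (a b d : ℤ) (h : a * d = m), 0 < a → a.toNat = n →
      P (triOf a b d h) := by
    intro n
    induction n using Nat.strong_induction_on with
    | _ n ih =>
      intro a b d h ha hn
      refine hr (ModularGroup.T ^ (-(b / a))) _ ?_
      have h1 : rmul (triOf a b d h) (ModularGroup.T ^ (-(b / a))) =
          triOf a (b % a) d h := by
        refine FixedDetMatrices.ext' _ _ ?_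
        change tri a b d * ((ModularGroup.T ^ (-(b / a)) : SL(2, ℤ)) : Mat) = tri a (b % a) d
        rw [coe_T_zpow_eq]
        have := Int.emod_add_mul_ediv b a
        ext i j
        fin_cases i <;> fin_cases j <;> simp [tri]
        linarith
      rw [h1]
      rcases eq_or_ne (b % a) 0 with h0 | h0
      · exact hd _ (by simp [triOf, tri, h0]) (by simp [triOf, tri])
      · have hpos : 0 < b % a := lt_of_le_of_ne (Int.emod_nonneg b ha.ne') h0.symm
        have hlt : b % a < a := Int.emod_lt_of_pos b ha
        refine hr ModularGroup.S _ ?_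
        obtain ⟨γ, a', b', d', h', ha', hM⟩ := exists_eq_smul_tri
          (rmul (triOf a (b % a) d h) ModularGroup.S)
        rw [hM]
        refine hl γ _ (ih a'.toNat ?_ a' b' d' h' ha' rfl)
        have h2 := congrFun (congrFun (congrArg Subtype.val hM) 0) 0
        have h3 : (γ : Mat) 0 0 * a' = b % a := by
          have h4 : (γ • triOf a' b' d' h').1 0 0 =
              (γ : Mat) 0 0 * a' := by
            rw [FixedDetMatrices.smul_coe, Matrix.mul_apply, Fin.sum_univ_two]
            simp [triOf, tri]
          have h5 : (rmul (triOf a (b % a) d h)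
              ModularGroup.S).1 0 0 = b % a := by
            change (tri a (b % a) d * (ModularGroup.S : Mat)) 0 0 = b % a
            rw [ModularGroup.coe_S, Matrix.mul_apply, Fin.sum_univ_two]
            simp [tri]
          rw [← h4, ← h5, h2]
        have h4 : a' ≤ b % a := Int.le_of_dvd hpos ⟨_, by rw [mul_comm]; exact h3.symm⟩
        omega
  obtain ⟨γ, a, b, d, h, ha, rfl⟩ := exists_eq_smul_tri M
  exact hl γ _ (key _ a b d h ha rfl)

end

/-! ### Right divisors -/

/-- `M` is a right divisor of `D`. -/
def RightDvd (M D : Mat) : Prop := ∃ N : Mat, N * M = D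

theorem SL_inv_mul (γ : SL(2, ℤ)) (M : Mat) :
    ((γ⁻¹ : SL(2, ℤ)) : Mat) * ((γ : Mat) * M) = M := by
  rw [← mul_assoc, ← coe_SL_mul, inv_mul_cancel]
  simp

theorem mul_SL_inv (γ : SL(2, ℤ)) (M : Mat) :
    M * (γ : Mat) * ((γ⁻¹ : SL(2, ℤ)) : Mat) = M := by
  rw [mul_assoc, ← coe_SL_mul, mul_inv_cancel]
  simp

theorem rightDvd_smul (γ : SL(2, ℤ)) (M D : Mat) : RightDvd (γ * M) D ↔ RightDvd M D := by
  constructor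
  · rintro ⟨N, rfl⟩
    exact ⟨N * γ, by rw [mul_assoc]⟩
  · rintro ⟨N, rfl⟩
    exact ⟨N * ((γ⁻¹ : SL(2, ℤ)) : Mat), by rw [mul_assoc, SL_inv_mul]⟩

theorem rightDvd_smul_right (γ : SL(2, ℤ)) (M D : Mat) : RightDvd M (γ * D) ↔ RightDvd M D := by
  constructor
  · rintro ⟨N, h⟩
    exact ⟨((γ⁻¹ : SL(2, ℤ)) : Mat) * N, by rw [mul_assoc, h, SL_inv_mul]⟩
  · rintro ⟨N, rfl⟩
    exact ⟨γ * N, by rw [mul_assoc]⟩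

theorem rightDvd_mul (γ : SL(2, ℤ)) (M D : Mat) : RightDvd (M * γ) (D * γ) ↔ RightDvd M D := by
  constructor
  · rintro ⟨N, h⟩
    refine ⟨N, ?_⟩
    rw [← mul_SL_inv γ (N * M), mul_assoc N, h, mul_SL_inv]
  · rintro ⟨N, rfl⟩
    exact ⟨N, by rw [mul_assoc]⟩

theorem mul_left_cancel_of_det {N M M' : Mat} (hN : N.det ≠ 0) (h : N * M = N * M') : M = M' := by
  have h1 := congrArg (N.adjugate * ·) h
  simp only [← mul_assoc, Matrix.adjugate_mul] at h1
  rw [smul_mul_assoc, smul_mul_assoc, one_mul, one_mul] at h1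
  exact smul_right_injective Mat (r := N.det) hN h1

theorem mul_right_cancel_of_det {N M M' : Mat} (hN : N.det ≠ 0) (h : M * N = M' * N) : M = M' := by
  have h1 := congrArg (· * N.adjugate) h
  simp only [mul_assoc, Matrix.mul_adjugate] at h1
  rw [mul_smul_comm, mul_smul_comm, mul_one, mul_one] at h1
  exact smul_right_injective Mat (r := N.det) hN h1

section

open Classical in
/-- The number of classes of right divisors of determinant `m`. -/
def divCount (m : ℕ) [NeZero m] (D : Mat) : ℕ :=
  ∑ q : Qm (m : ℤ), if RightDvd q.out.1 D then 1 else 0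

variable {m n l : ℕ} [NeZero m] [NeZero n] [NeZero l]

theorem divCount_smul (γ : SL(2, ℤ)) (D : Mat) : divCount m (γ * D) = divCount m D := by
  classical
  rw [divCount, divCount]
  exact Finset.sum_congr rfl fun q _ => if_congr (rightDvd_smul_right γ _ D) rfl rfl

theorem divCount_mul (γ : SL(2, ℤ)) (D : Mat) : divCount m (D * γ) = divCount m D := by
  classical
  have h := sum_out_rmul (m := (m : ℤ))
    (Φ := fun M : Dm (m : ℤ) => if RightDvd M.1 (D * γ) then 1 else 0)
    (fun γ' M => by rw [FixedDetMatrices.smul_coe]; simp only [rightDvd_smul]) γ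
  refine Eq.trans h.symm (Finset.sum_congr rfl fun q _ => ?_)
  have h2 : RightDvd (rmul q.out γ).1 (D * γ) ↔ RightDvd q.out.1 D := rightDvd_mul γ _ _
  simp only [h2]

omit [NeZero l] in
-- If `D = NM` is symmetric then `D = MᵀNᵀ`, so `Nᵀ` is a right divisor of determinant `n`. Its
-- class determines that of `M`.
theorem divCount_le_of_symmetric (hl : m * n = l) (D : Dm (l : ℤ)) (hD : D.1.transpose = D.1) :
    divCount m D.1 ≤ divCount n D.1 := by
  classical
  rw [divCount, divCount, ← Finset.card_filter, ← Finset.card_filter]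
  have hm0 : (m : ℤ) ≠ 0 := by exact_mod_cast NeZero.ne m
  have hn0 : (n : ℤ) ≠ 0 := by exact_mod_cast NeZero.ne n
  -- A relation replaces the map from `M` to `Nᵀ`, so no quotient `N` has to be chosen.
  refine Finset.card_le_card_of_forall_subsingleton
    (fun p q => ∃ N : Dm (n : ℤ), N.1.transpose * p.out.1 = D.1 ∧ qmk N = q) ?_ ?_
  · intro p hp
    obtain ⟨N, hN⟩ := (Finset.mem_filter.1 hp).2
    have hdet : N.det = n := by
      have := congrArg Matrix.det hN
      rw [Matrix.det_mul, D.2, p.out.2, ← hl] at this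
      push_cast at this
      rw [mul_comm] at this
      exact mul_left_cancel₀ hm0 this
    let N' : Dm (n : ℤ) := ⟨N.transpose, by rw [Matrix.det_transpose, hdet]⟩
    refine ⟨qmk N', Finset.mem_filter.2 ⟨Finset.mem_univ _, ?_⟩, N', ?_, rfl⟩
    · rw [out_apply (Φ := fun M : Dm (n : ℤ) => RightDvd M.1 D.1) fun γ M => by
        rw [FixedDetMatrices.smul_coe, rightDvd_smul]]
      exact ⟨p.out.1.transpose, by rw [← Matrix.transpose_mul, hN, hD]⟩
    · exact (congrArg (· * p.out.1) (Matrix.transpose_transpose N)).trans hN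
  · rintro q - p ⟨-, N, hN, rfl⟩ p' ⟨-, N', hN', hq⟩
    obtain ⟨γ, hγ⟩ := qmk_eq_iff.1 hq
    have h1 : N'.1 = γ * N.1 := by rw [← hγ, FixedDetMatrices.smul_coe]
    rw [h1, Matrix.transpose_mul, mul_assoc, ← hN] at hN'
    have h2 := mul_left_cancel_of_det (by rw [Matrix.det_transpose, N.2]; exact hn0) hN'
    rw [← qmk_out p, ← qmk_out p']
    refine qmk_eq_iff.2 ⟨γ.transpose, FixedDetMatrices.ext' _ _ ?_⟩
    rw [FixedDetMatrices.smul_coe]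
    exact h2

/-- Both counts are invariant under SL(2, ℤ) on either side, so `D` may be taken diagonal, hence
symmetric. -/
theorem divCount_eq (hl : m * n = l) (D : Dm (l : ℤ)) : divCount m D.1 = divCount n D.1 := by
  induction D using induction_diagonal with
  | hl γ M h => rw [FixedDetMatrices.smul_coe, divCount_smul, divCount_smul, h]
  | hr γ M h =>
    have h1 : (rmul M γ).1 = M.1 * γ := rfl
    rwa [h1, divCount_mul, divCount_mul] at h
  | hd M h01 h10 =>
    have hM : M.1.transpose = M.1 := by
      ext i j; fin_cases i <;> fin_cases j <;> simp [h01, h10]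
    exact le_antisymm (divCount_le_of_symmetric hl M hM)
      (divCount_le_of_symmetric (by rw [mul_comm, hl]) M hM)

/-- A double sum over cosets, collected according to the product. -/
theorem sum_sum_mul (hl : m * n = l) {β : Type*} [AddCommMonoid β] {Ψ : Mat → β}
    (hΨ : ∀ (γ : SL(2, ℤ)) (D : Dm (l : ℤ)), Ψ (γ * D.1) = Ψ D.1) :
    ∑ p : Qm (m : ℤ), ∑ q : Qm (n : ℤ), Ψ (q.out.1 * p.out.1) =
      ∑ r : Qm (l : ℤ), divCount m r.out.1 • Ψ r.out.1 := by
  classical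
  have hm0 : (m : ℤ) ≠ 0 := by exact_mod_cast NeZero.ne m
  have hΨ' : ∀ D : Dm (l : ℤ), Ψ (qmk D).out.1 = Ψ D.1 :=
    out_apply (Φ := fun D : Dm (l : ℤ) => Ψ D.1) fun γ D => by
      rw [FixedDetMatrices.smul_coe, hΨ]
  -- For a fixed right factor, multiplication by it is a bijection from the cosets of determinant
  -- `n` to the cosets that it divides on the right.
  have h1 : ∀ p : Qm (m : ℤ), ∑ q : Qm (n : ℤ), Ψ (q.out.1 * p.out.1) =
      ∑ r : Qm (l : ℤ), if RightDvd p.out.1 r.out.1 then Ψ r.out.1 else 0 := by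
    intro p
    let pr : Dm (n : ℤ) → Dm (l : ℤ) := fun N => ⟨N.1 * p.out.1, by
      rw [Matrix.det_mul, N.2, p.out.2, ← hl]; push_cast; ring⟩
    rw [← Finset.sum_filter]
    refine Finset.sum_bij (fun q _ => qmk (pr q.out)) (fun q _ => ?_) (fun q _ q' _ h => ?_)
      (fun r hr => ?_) (fun q _ => (hΨ' (pr q.out)).symm)
    · refine Finset.mem_filter.2 ⟨Finset.mem_univ _, ?_⟩
      rw [out_apply (Φ := fun D : Dm (l : ℤ) => RightDvd p.out.1 D.1) fun γ D => by
        rw [FixedDetMatrices.smul_coe, rightDvd_smul_right]]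
      exact ⟨q.out.1, rfl⟩
    · obtain ⟨γ, hγ⟩ := qmk_eq_iff.1 h
      have h2 := congrArg Subtype.val hγ
      rw [FixedDetMatrices.smul_coe] at h2
      have h3 : (γ : Mat) * q'.out.1 = q.out.1 :=
        mul_right_cancel_of_det (N := p.out.1) (by rw [p.out.2]; exact hm0)
          (by rw [mul_assoc]; exact h2)
      rw [← qmk_out q, ← qmk_out q']
      exact qmk_eq_iff.2 ⟨γ, FixedDetMatrices.ext' _ _ (by
        rw [FixedDetMatrices.smul_coe, h3])⟩
    · obtain ⟨N, hN⟩ := (Finset.mem_filter.1 hr).2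
      have hdet : N.det = n := by
        have := congrArg Matrix.det hN
        rw [Matrix.det_mul, r.out.2, p.out.2, ← hl] at this
        push_cast at this
        rw [mul_comm] at this
        exact mul_left_cancel₀ hm0 this
      let N' : Dm (n : ℤ) := ⟨N, hdet⟩
      refine ⟨qmk N', Finset.mem_univ _, ?_⟩
      obtain ⟨γ, hγ⟩ := exists_smul_out N'
      rw [← qmk_out r]
      refine (qmk_eq_iff.2 ⟨γ, FixedDetMatrices.ext' _ _ ?_⟩).symm
      rw [FixedDetMatrices.smul_coe]
      change (γ : Mat) * ((qmk N').out.1 * p.out.1) = r.out.1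
      rw [← mul_assoc, ← FixedDetMatrices.smul_coe, hγ]
      exact hN
  simp only [h1]
  rw [Finset.sum_comm]
  refine Finset.sum_congr rfl fun r _ => ?_
  rw [divCount, Finset.sum_smul]
  refine Finset.sum_congr rfl fun p _ => ?_
  split_ifs <;> simp

/-- The double sum over cosets is symmetric. -/
theorem sum_sum_mul_comm {β : Type*} [AddCommMonoid β] {Ψ : Mat → β}
    (hΨ : ∀ (γ : SL(2, ℤ)) (D : Dm ((m * n : ℕ) : ℤ)), Ψ (γ * D.1) = Ψ D.1) :
    ∑ p : Qm (m : ℤ), ∑ q : Qm (n : ℤ), Ψ (q.out.1 * p.out.1) =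
      ∑ q : Qm (n : ℤ), ∑ p : Qm (m : ℤ), Ψ (p.out.1 * q.out.1) := by
  rw [sum_sum_mul rfl hΨ, sum_sum_mul (mul_comm n m) hΨ]
  exact Finset.sum_congr rfl fun r _ => by rw [divCount_eq rfl r.out]

/-- Commutation of Hecke operators with multiplicative weights. -/
theorem heckeW_comm {k : ℤ} {v : SL(2, ℤ) → ℂ} {wm wm' wn wn' Ω : Mat → ℂ} {f : ℍ → ℂ}
    (hf : IsModular k v f)
    (h1 : ∀ (M : Dm (m : ℤ)) (N : Dm (n : ℤ)), wm M.1 * wn N.1 = Ω (N.1 * M.1))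
    (h2 : ∀ (M : Dm (m : ℤ)) (N : Dm (n : ℤ)), wn' N.1 * wm' M.1 = Ω (M.1 * N.1))
    (hΩ : ∀ (γ : SL(2, ℤ)) (D : Dm ((m * n : ℕ) : ℤ)), v γ * Ω (γ * D.1) = Ω D.1) :
    heckeW k m wm (heckeW k n wn f) = heckeW k n wn' (heckeW k m wm' f) := by
  have hexp : ∀ {m n : ℕ} [NeZero m] [NeZero n] {wm wn : Mat → ℂ},
      (∀ (M : Dm (m : ℤ)) (N : Dm (n : ℤ)), wm M.1 * wn N.1 = Ω (N.1 * M.1)) →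
      heckeW k m wm (heckeW k n wn f) =
        (((Real.sqrt m : ℝ) : ℂ)⁻¹ * ((Real.sqrt n : ℝ) : ℂ)⁻¹) •
          ∑ p : Qm (m : ℤ), ∑ q : Qm (n : ℤ),
            Ω (q.out.1 * p.out.1) • slashM k (q.out.1 * p.out.1) f := by
    intro m n _ _ wm wn h
    have hp : ∀ p : Qm (m : ℤ), wm p.out.1 • slashM k p.out.1 (heckeW k n wn f) =
        ((Real.sqrt n : ℝ) : ℂ)⁻¹ • ∑ q : Qm (n : ℤ),
          Ω (q.out.1 * p.out.1) • slashM k (q.out.1 * p.out.1) f := by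
      intro p
      rw [heckeW, slashM_smul, slashM_sum, smul_comm]
      refine congrArg _ ((Finset.smul_sum).trans (Finset.sum_congr rfl fun q _ => ?_))
      rw [slashM_smul, ← slashM_mul k (det_pos_Dm _) (det_pos_Dm _), smul_smul, h]
    have h3 : heckeW k m wm (heckeW k n wn f) = ((Real.sqrt m : ℝ) : ℂ)⁻¹ •
        ∑ p : Qm (m : ℤ), wm p.out.1 • slashM k p.out.1 (heckeW k n wn f) := rfl
    rw [h3, Finset.sum_congr rfl fun p _ => hp p, ← Finset.smul_sum, smul_smul]
  rw [hexp h1, hexp (fun N M => h2 M N), mul_comm ((Real.sqrt m : ℝ) : ℂ)⁻¹]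
  congr 1
  refine sum_sum_mul_comm (Ψ := fun D => Ω D • slashM k D f) fun γ D => ?_
  rw [slashM_mul k (det_SL γ) (det_pos_Dm D), isModular_iff_slashM.1 hf, slashM_smul, smul_smul,
    mul_comm, hΩ]

end

/-! ### Hecke operators on Maass forms -/

theorem IsHeckeWeight.isMaassForm {j : ℤ} {k : ℕ} {ζ : ℂ} {m : ℕ} [NeZero m]
    {v v' : SL(2, ℤ) → ℂ} {wt : Mat → ℂ} (h : IsHeckeWeight k ζ m v v' wt)
    (hv : ∀ A, ‖v A‖ = 1) {R : ℝ} {f : ℍ → ℂ} (hf : IsMaassForm j v R f) :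
    IsMaassForm j v' R (heckeSum k ζ m f) where
  smooth := hf.smooth.heckeSum k ζ m
  slash := (h.isModular hf.isModular).slash
  eigen := eigen_of_laplacian_eq (by
    rw [laplacian_heckeSum hf.smooth, hf.laplacian_eq, heckeSum_const_smul])
  memLp := by
    rw [h.heckeSum_eq hf.isModular]
    exact memLp_heckeW hv hf.smooth hf.isModular hf.memLp wt

theorem petersson_const_smul (f g : ℍ → ℂ) (c : ℂ) :
    petersson f (c • g) = conj c * petersson f g := by
  rw [petersson, petersson, ← integral_const_mul]
  refine integral_congr_ae (Eventually.of_forall fun z => ?_)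
  simp only [Pi.smul_apply, smul_eq_mul, map_mul]
  ring

theorem petersson_smul_const (f g : ℍ → ℂ) (c : ℂ) :
    petersson (c • f) g = c * petersson f g := by
  rw [petersson, petersson, ← integral_const_mul]
  refine integral_congr_ae (Eventually.of_forall fun z => ?_)
  simp only [Pi.smul_apply, smul_eq_mul, mul_assoc]

/-- The conjugate of the multiplier system. -/
def vBar (k : ℕ) (A : SL(2, ℤ)) : ℂ := conj (vEta k A)

theorem norm_vBar (k : ℕ) (A : SL(2, ℤ)) : ‖vBar k A‖ = 1 := by
  rw [vBar, RCLike.norm_conj, norm_vEta]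

theorem vEta_comp_flipSL (k : ℕ) : (fun A => vEta k (flipSL A)) = vBar k :=
  funext fun A => vEta_flipSL k A

theorem vBar_flipSL (k : ℕ) (A : SL(2, ℤ)) : vBar k (flipSL A) = vEta k A := by
  rw [vBar, vEta_flipSL, Complex.conj_conj]

theorem vBar_comp_flipSL (k : ℕ) : (fun A => vBar k (flipSL A)) = vEta k :=
  funext fun A => vBar_flipSL k A

section

variable {k m n : ℕ} {R R' : ℝ} {f g : ℍ → ℂ}

theorem IsMaassForm.Theta_vEta (hf : IsMaassForm k (vEta k) R f) :
    IsMaassForm k (vBar k) R (EtaMaass.Theta k f) := by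
  have := hf.Theta (norm_vEta k)
  rwa [vEta_comp_flipSL] at this

theorem IsMaassForm.Theta_vBar (hf : IsMaassForm k (vBar k) R f) :
    IsMaassForm k (vEta k) R (EtaMaass.Theta k f) := by
  have := hf.Theta (norm_vBar k)
  rwa [vBar_comp_flipSL] at this

theorem isHeckeWeight_one_conj (hm : (k : ℤ) * m ≡ k [ZMOD 12]) :
    IsHeckeWeight k (conj (xi k)) m (vBar k) (vBar k) (fun M => conj (wtOne k M)) :=
  (isHeckeWeight_one hm).conj

theorem isHeckeWeight_neg' (hm : (k : ℤ) * m ≡ -k [ZMOD 12]) :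
    IsHeckeWeight k (conj (xi k)) m (vBar k) (vEta k) (wtNeg k) := isHeckeWeight_neg hm

theorem isHeckeWeight_neg_conj (hm : (k : ℤ) * m ≡ -k [ZMOD 12]) :
    IsHeckeWeight k (xi k) m (vEta k) (vBar k) (fun M => conj (wtNeg k M)) := by
  have h := (isHeckeWeight_neg hm).conj
  simp only [Complex.conj_conj] at h
  exact h

/-- Insert `eps² = 1` between `N` and `M`: `N · eps` is the flip of `eps · N`, and `nu` is
multiplicative on the two resulting factors. -/
theorem wtNeg_mul_conj (hm : (k : ℤ) * m ≡ -k [ZMOD 12]) (hn : (k : ℤ) * n ≡ -k [ZMOD 12])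
    (M : Dm (m : ℤ)) (N : Dm (n : ℤ)) :
    wtNeg k M.1 * conj (wtNeg k N.1) = wtOne k (N.1 * M.1) := by
  have h1 := modEq_det_eps_mul (modEq_det_Dm hn N)
  have h2 : N.1 * M.1 = flip (eps * N.1) * (eps * M.1) := by
    have : flip (eps * N.1) * (eps * M.1) = eps * eps * N.1 * (eps * eps) * M.1 := by
      rw [flip_eq]; noncomm_ring
    rw [this, eps_mul_eps, one_mul, mul_one]
  rw [wtOne, h2, nu_mul (by rw [det_flip]; exact h1) (modEq_det_eps_mul (modEq_det_Dm hm M)),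
    nu_flip (Or.inl h1), wtNeg, wtNeg, map_mul, mul_comm]

variable [NeZero m] [NeZero n]

theorem petersson_heckeT (hm : (k : ℤ) * m ≡ k [ZMOD 12])
    (hf : IsMaassForm k (vEta k) R f) (hg : IsMaassForm k (vEta k) R' g) :
    petersson (heckeT k m f) g = petersson f (heckeT k m g) := by
  have h := isHeckeWeight_one hm
  rw [heckeT, heckeT, h.heckeSum_eq hf.isModular, h.heckeSum_eq hg.isModular]
  exact petersson_heckeW (norm_vEta k) hf.smooth hf.isModular hf.memLp (norm_vEta k) hg.smooth
    hg.isModular hg.memLp h.toIsWeight fun M => (wtOne_adjugate hm M).symm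

theorem Theta_heckeSum_neg (hm : (k : ℤ) * m ≡ -k [ZMOD 12])
    (hf : IsMaassForm k (vEta k) R f) :
    Theta k (heckeSum k (xi k) m f) = heckeSum k (conj (xi k)) m (Theta k f) :=
  (isHeckeWeight_neg_conj hm).Theta (vEta_flipSL k) (norm_vEta k) hf

/-- The sign from `wtNeg_adjugate` cancels the one from moving `Θ`. What remains on the right is `Θ`
after a Hecke sum, and they are interchanged by `Theta_heckeSum_neg`. -/
theorem petersson_heckeTheta (hm : (k : ℤ) * m ≡ -k [ZMOD 12])
    (hf : IsMaassForm k (vEta k) R f) (hg : IsMaassForm k (vEta k) R' g) :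
    petersson (heckeTheta k m f) g = petersson f (heckeTheta k m g) := by
  have h := isHeckeWeight_neg' hm
  have h' := isHeckeWeight_neg_conj hm
  have hF := hf.Theta_vEta
  have hG := h'.isMaassForm (norm_vEta k) hg
  have h1 : heckeW k m (fun M => (-1) ^ k * conj (wtNeg k M)) g =
      ((-1 : ℂ) ^ k) • heckeSum k (xi k) m g := by
    rw [h'.heckeSum_eq hg.isModular, heckeW, heckeW, smul_comm]
    congr 1
    rw [Finset.smul_sum]
    exact Finset.sum_congr rfl fun q _ => mul_smul _ _ _
  have h2 := petersson_heckeW (norm_vBar k) hF.smooth hF.isModular hF.memLp (norm_vEta k)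
    hg.smooth hg.isModular hg.memLp h.toIsWeight
    (wt' := fun M => (-1) ^ k * conj (wtNeg k M)) fun M => (wtNeg_adjugate hm M).symm
  rw [h1, petersson_const_smul, ← h.heckeSum_eq hF.isModular,
    petersson_Theta (norm_vEta k) hf (by rw [vEta_comp_flipSL]; exact hG),
    Theta_heckeSum_neg hm hg, map_pow, map_neg, map_one, ← mul_assoc, ← mul_pow] at h2
  simpa [heckeTheta, heckeTbar] using h2

theorem heckeT_comm (hm : (k : ℤ) * m ≡ k [ZMOD 12]) (hn : (k : ℤ) * n ≡ k [ZMOD 12])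
    (hf : IsMaassForm k (vEta k) R f) :
    heckeT k m (heckeT k n f) = heckeT k n (heckeT k m f) := by
  have hM := isHeckeWeight_one hm
  have hN := isHeckeWeight_one hn
  have hMN : (k : ℤ) * (m * n : ℕ) ≡ k [ZMOD 12] := by
    push_cast
    rw [← mul_assoc]
    exact (hm.mul_right _).trans hn
  have hf' := hf.isModular
  simp only [heckeT]
  rw [hM.heckeSum_eq (hN.isModular hf'), hN.heckeSum_eq hf', hN.heckeSum_eq (hM.isModular hf'),
    hM.heckeSum_eq hf']
  refine heckeW_comm (Ω := wtOne k) hf' (fun M N => ?_) (fun M N => ?_)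
    (isHeckeWeight_one hMN).left
  · rw [wtOne, wtOne, wtOne, nu_mul (modEq_det_Dm hn N) (modEq_det_Dm hm M), map_mul, mul_comm]
  · rw [wtOne, wtOne, wtOne, nu_mul (modEq_det_Dm hm M) (modEq_det_Dm hn N), map_mul, mul_comm]

/-- Once `Θ` is moved inside, both sides are compositions of Hecke sums applied to `Θf`, with
product weight `wtNeg` in determinant `mn`. -/
theorem heckeT_heckeTheta_comm (hm : (k : ℤ) * m ≡ k [ZMOD 12])
    (hn : (k : ℤ) * n ≡ -k [ZMOD 12]) (hf : IsMaassForm k (vEta k) R f) :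
    heckeT k m (heckeTheta k n f) = heckeTheta k n (heckeT k m f) := by
  have hM := isHeckeWeight_one hm
  have hM' := isHeckeWeight_one_conj hm
  have hN := isHeckeWeight_neg' hn
  have hMN : (k : ℤ) * (m * n : ℕ) ≡ -k [ZMOD 12] := by
    push_cast
    rw [← mul_assoc]
    exact (hm.mul_right _).trans hn
  have hg := hf.Theta_vEta.isModular
  simp only [heckeT, heckeTheta, heckeTbar]
  rw [hM.Theta (vEta_flipSL k) (norm_vEta k) hf, hM.heckeSum_eq (hN.isModular hg),
    hN.heckeSum_eq hg, hN.heckeSum_eq (hM'.isModular hg), hM'.heckeSum_eq hg]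
  refine heckeW_comm (Ω := wtNeg k) hg (fun M N => ?_) (fun M N => ?_)
    (isHeckeWeight_neg' hMN).left
  · rw [wtOne, wtNeg, wtNeg, ← mul_assoc, nu_mul (modEq_det_eps_mul (modEq_det_Dm hn N))
      (modEq_det_Dm hm M), map_mul, mul_comm]
  · rw [wtOne, wtNeg, wtNeg, eps_mul, nu_mul (by rw [det_flip]; exact modEq_det_Dm hm M)
      (modEq_det_eps_mul (modEq_det_Dm hn N)), nu_flip (Or.inl (modEq_det_Dm hm M)), map_mul,
      mul_comm]

/-- Both sides become Hecke sums applied to `Θ²f`. The inner one leads from `v` to `v̄`, the outer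
one back, and the product weight is `wtOne`. -/
theorem heckeTheta_comm (hm : (k : ℤ) * m ≡ -k [ZMOD 12]) (hn : (k : ℤ) * n ≡ -k [ZMOD 12])
    (hf : IsMaassForm k (vEta k) R f) :
    heckeTheta k m (heckeTheta k n f) = heckeTheta k n (heckeTheta k m f) := by
  have hMN : (k : ℤ) * (m * n : ℕ) ≡ k [ZMOD 12] := by
    push_cast
    rw [← mul_assoc]
    exact (hm.mul_right _).trans (by simpa using hn.neg)
  have hF := hf.Theta_vEta
  have hg := hF.Theta_vBar.isModular
  have hT : ∀ {n : ℕ} [NeZero n], (k : ℤ) * n ≡ -k [ZMOD 12] →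
      Theta k (heckeSum k (conj (xi k)) n (Theta k f)) =
        heckeSum k (xi k) n (Theta k (Theta k f)) := by
    intro n _ hn
    have := (isHeckeWeight_neg' hn).Theta
      (fun A => by rw [vBar_flipSL, vBar, Complex.conj_conj]) (norm_vBar k) hF
    rwa [Complex.conj_conj] at this
  have hM := isHeckeWeight_neg' hm
  have hM' := isHeckeWeight_neg_conj hm
  have hN := isHeckeWeight_neg' hn
  have hN' := isHeckeWeight_neg_conj hn
  simp only [heckeTheta, heckeTbar]
  rw [hT hn, hT hm, hM.heckeSum_eq (hN'.isModular hg), hN'.heckeSum_eq hg,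
    hN.heckeSum_eq (hM'.isModular hg), hM'.heckeSum_eq hg]
  exact heckeW_comm (Ω := wtOne k) hg (wtNeg_mul_conj hm hn)
    (fun M N => wtNeg_mul_conj hn hm N M) (isHeckeWeight_one hMN).left

end

/-! ### The family of Hecke operators on the space of Maass forms -/

theorem smooth_of_mem_maassSpace {k : ℤ} {v : SL(2, ℤ) → ℂ} {f : ℍ → ℂ}
    (hf : f ∈ maassSpace k v) : Smooth f := by
  induction hf using Submodule.span_induction with
  | mem f hf => exact hf.choose_spec.smooth
  | zero => exact smooth_const 0
  | add f g _ _ hf hg => exact hf.add hg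
  | smul c f _ hf => exact hf.const_smul c

section

variable {k : ℕ} {F G : (ℍ → ℂ) → ℍ → ℂ} (hF : F ∈ heckeFamily k)
include hF

theorem map_add_of_mem_heckeFamily {f g : ℍ → ℂ} (hf : Smooth f) (hg : Smooth g) :
    F (f + g) = F f + F g := by
  rcases hF with ⟨n, -, -, rfl⟩ | ⟨m, -, -, rfl⟩
  · exact heckeSum_add _ _ _ _ _
  · rw [heckeTheta, Theta_add hf hg, heckeTbar, heckeSum_add]; rfl

theorem map_smul_of_mem_heckeFamily {f : ℍ → ℂ} (hf : Smooth f) (c : ℂ) :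
    F (c • f) = c • F f := by
  rcases hF with ⟨n, -, -, rfl⟩ | ⟨m, -, -, rfl⟩
  · exact heckeSum_const_smul _ _ _ _ _
  · rw [heckeTheta, Theta_const_smul hf, heckeTbar, heckeSum_const_smul]; rfl

theorem map_zero_of_mem_heckeFamily : F 0 = 0 := by
  simpa using map_smul_of_mem_heckeFamily hF (smooth_const 0) 0

theorem isMaassForm_of_mem_heckeFamily {R : ℝ} {f : ℍ → ℂ} (hf : IsMaassForm k (vEta k) R f) :
    IsMaassForm k (vEta k) R (F f) := by
  rcases hF with ⟨n, hn0, hn, rfl⟩ | ⟨m, hm0, hm, rfl⟩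
  · have : NeZero n := ⟨hn0.ne'⟩
    exact (isHeckeWeight_one hn).isMaassForm (norm_vEta k) hf
  · have : NeZero m := ⟨hm0.ne'⟩
    exact (isHeckeWeight_neg' hm).isMaassForm (norm_vBar k) hf.Theta_vEta

theorem petersson_of_mem_heckeFamily {R R' : ℝ} {f g : ℍ → ℂ}
    (hf : IsMaassForm k (vEta k) R f) (hg : IsMaassForm k (vEta k) R' g) :
    petersson (F f) g = petersson f (F g) := by
  rcases hF with ⟨n, hn0, hn, rfl⟩ | ⟨m, hm0, hm, rfl⟩
  · have : NeZero n := ⟨hn0.ne'⟩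
    exact petersson_heckeT hn hf hg
  · have : NeZero m := ⟨hm0.ne'⟩
    exact petersson_heckeTheta hm hf hg

theorem comm_of_mem_heckeFamily (hG : G ∈ heckeFamily k) {R : ℝ} {f : ℍ → ℂ}
    (hf : IsMaassForm k (vEta k) R f) : F (G f) = G (F f) := by
  rcases hF with ⟨m, hm0, hm, rfl⟩ | ⟨m, hm0, hm, rfl⟩ <;>
    rcases hG with ⟨n, hn0, hn, rfl⟩ | ⟨n, hn0, hn, rfl⟩ <;>
    have : NeZero m := ⟨hm0.ne'⟩ <;> have : NeZero n := ⟨hn0.ne'⟩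
  · exact heckeT_comm hm hn hf
  · exact heckeT_heckeTheta_comm hm hn hf
  · exact (heckeT_heckeTheta_comm hn hm hf).symm
  · exact heckeTheta_comm hm hn hf

theorem mem_maassSpace_of_mem_heckeFamily {f : ℍ → ℂ} (hf : f ∈ maassSpace k (vEta k)) :
    F f ∈ maassSpace k (vEta k) := by
  induction hf using Submodule.span_induction with
  | mem f hf =>
    obtain ⟨R, hf⟩ := hf
    exact Submodule.subset_span ⟨R, isMaassForm_of_mem_heckeFamily hF hf⟩
  | zero => rw [map_zero_of_mem_heckeFamily hF]; exact Submodule.zero_mem _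
  | add f g hf hg ihf ihg =>
    rw [map_add_of_mem_heckeFamily hF (smooth_of_mem_maassSpace hf) (smooth_of_mem_maassSpace hg)]
    exact Submodule.add_mem _ ihf ihg
  | smul c f hf ih =>
    rw [map_smul_of_mem_heckeFamily hF (smooth_of_mem_maassSpace hf)]
    exact Submodule.smul_mem _ _ ih

end

section

variable {k : ℤ} {v : SL(2, ℤ) → ℂ} {f g h : ℍ → ℂ}

theorem petersson_add_left (hf : f ∈ maassSpace k v) (hg : g ∈ maassSpace k v)
    (hh : h ∈ maassSpace k v) : petersson (f + g) h = petersson f h + petersson g h := by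
  rw [petersson, petersson, petersson,
    ← integral_add (integrableOn_petersson hf hh) (integrableOn_petersson hg hh)]
  simp only [Pi.add_apply, add_mul]

theorem petersson_add_right (hf : f ∈ maassSpace k v) (hg : g ∈ maassSpace k v)
    (hh : h ∈ maassSpace k v) : petersson f (g + h) = petersson f g + petersson f h := by
  rw [petersson, petersson, petersson,
    ← integral_add (integrableOn_petersson hf hg) (integrableOn_petersson hf hh)]
  simp only [Pi.add_apply, map_add, mul_add]

theorem petersson_zero_left (f : ℍ → ℂ) : petersson 0 f = 0 := by simp [petersson]

theorem petersson_zero_right (f : ℍ → ℂ) : petersson f 0 = 0 := by simp [petersson]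

end

section

variable {k : ℕ} {F : (ℍ → ℂ) → ℍ → ℂ} (hF : F ∈ heckeFamily k)
include hF

theorem petersson_of_mem_maassSpace {f g : ℍ → ℂ} (hf : f ∈ maassSpace k (vEta k))
    (hg : g ∈ maassSpace k (vEta k)) : petersson (F f) g = petersson f (F g) := by
  have hmem := fun {f} => mem_maassSpace_of_mem_heckeFamily hF (f := f)
  have hsm := fun {f} (hf : f ∈ maassSpace k (vEta k)) => smooth_of_mem_maassSpace hf
  induction hf using Submodule.span_induction with
  | mem f hf =>
    obtain ⟨R, hf⟩ := hf
    have hf0 : f ∈ maassSpace k (vEta k) := Submodule.subset_span ⟨R, hf⟩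
    induction hg using Submodule.span_induction with
    | mem g hg =>
      obtain ⟨R', hg⟩ := hg
      exact petersson_of_mem_heckeFamily hF hf hg
    | zero => rw [map_zero_of_mem_heckeFamily hF, petersson_zero_right, petersson_zero_right]
    | add g h hg hh ihg ihh =>
      rw [map_add_of_mem_heckeFamily hF (hsm hg) (hsm hh),
        petersson_add_right (hmem hf0) hg hh, petersson_add_right hf0 (hmem hg) (hmem hh), ihg,
        ihh]
    | smul c g hg ih =>
      rw [map_smul_of_mem_heckeFamily hF (hsm hg), petersson_const_smul, petersson_const_smul, ih]
  | zero => rw [map_zero_of_mem_heckeFamily hF, petersson_zero_left, petersson_zero_left]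
  | add f h hf hh ihf ihh =>
    rw [map_add_of_mem_heckeFamily hF (hsm hf) (hsm hh),
      petersson_add_left (hmem hf) (hmem hh) hg, petersson_add_left hf hh (hmem hg), ihf, ihh]
  | smul c f hf ih =>
    rw [map_smul_of_mem_heckeFamily hF (hsm hf), petersson_smul_const, petersson_smul_const, ih]

theorem isSelfAdjointOn_of_mem_heckeFamily : IsSelfAdjointOn (maassSpace k (vEta k)) F where
  mapsTo _ hf := mem_maassSpace_of_mem_heckeFamily hF hf
  map_add _ hf _ hg := map_add_of_mem_heckeFamily hF (smooth_of_mem_maassSpace hf)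
    (smooth_of_mem_maassSpace hg)
  map_smul c _ hf := map_smul_of_mem_heckeFamily hF (smooth_of_mem_maassSpace hf) c
  adjoint _ hf _ hg := petersson_of_mem_maassSpace hF hf hg

theorem comm_of_mem_maassSpace {G : (ℍ → ℂ) → ℍ → ℂ} (hG : G ∈ heckeFamily k) {f : ℍ → ℂ}
    (hf : f ∈ maassSpace k (vEta k)) : F (G f) = G (F f) := by
  induction hf using Submodule.span_induction with
  | mem f hf => exact comm_of_mem_heckeFamily hF hG hf.choose_spec
  | zero =>
    rw [map_zero_of_mem_heckeFamily hF, map_zero_of_mem_heckeFamily hG,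
      map_zero_of_mem_heckeFamily hF]
  | add f g hf hg ihf ihg =>
    have hs := fun {H f} (hH : H ∈ heckeFamily k) (hf : f ∈ maassSpace k (vEta k)) =>
      smooth_of_mem_maassSpace (mem_maassSpace_of_mem_heckeFamily hH hf)
    have hf' := smooth_of_mem_maassSpace hf
    have hg' := smooth_of_mem_maassSpace hg
    rw [map_add_of_mem_heckeFamily hF hf' hg', map_add_of_mem_heckeFamily hG hf' hg',
      map_add_of_mem_heckeFamily hG (hs hF hf) (hs hF hg),
      map_add_of_mem_heckeFamily hF (hs hG hf) (hs hG hg), ihf, ihg]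
  | smul c f hf ih =>
    have hf' := smooth_of_mem_maassSpace hf
    rw [map_smul_of_mem_heckeFamily hF hf', map_smul_of_mem_heckeFamily hG hf',
      map_smul_of_mem_heckeFamily hG
        (smooth_of_mem_maassSpace (mem_maassSpace_of_mem_heckeFamily hF hf)),
      map_smul_of_mem_heckeFamily hF
        (smooth_of_mem_maassSpace (mem_maassSpace_of_mem_heckeFamily hG hf)), ih]

/-- On a generator of the span the Laplacian is a scalar, and it is the same scalar on the image
because `R` is preserved. -/
theorem laplacian_comm_of_mem_maassSpace {f : ℍ → ℂ} (hf : f ∈ maassSpace k (vEta k)) :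
    F (laplacian k f) = laplacian k (F f) := by
  have hs := fun {f} (hf : f ∈ maassSpace k (vEta k)) =>
    smooth_of_mem_maassSpace (mem_maassSpace_of_mem_heckeFamily hF hf)
  have h0 := fun {f} (hf : f ∈ maassSpace k (vEta k)) => smooth_of_mem_maassSpace hf
  induction hf using Submodule.span_induction with
  | mem f hf =>
    obtain ⟨R, hf⟩ := hf
    rw [hf.laplacian_eq, map_smul_of_mem_heckeFamily hF hf.smooth,
      (isMaassForm_of_mem_heckeFamily hF hf).laplacian_eq]
  | zero =>
    have h : laplacian k (0 : ℍ → ℂ) = 0 := by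
      simpa using laplacian_const_smul (smooth_const 0) k 0
    rw [h, map_zero_of_mem_heckeFamily hF, h]
  | add f g hf hg ihf ihg =>
    rw [laplacian_add (h0 hf) (h0 hg), map_add_of_mem_heckeFamily hF ((h0 hf).laplacian k)
      ((h0 hg).laplacian k), map_add_of_mem_heckeFamily hF (h0 hf) (h0 hg),
      laplacian_add (hs hf) (hs hg), ihf, ihg]
  | smul c f hf ih =>
    rw [laplacian_const_smul (h0 hf), map_smul_of_mem_heckeFamily hF ((h0 hf).laplacian k),
      map_smul_of_mem_heckeFamily hF (h0 hf), laplacian_const_smul (hs hf), ih]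

end

end EtaMaass

end

theorem mainTheorem10 (k : ℕ) (hk : 0 < k) (hk12 : ¬ 12 ∣ k) :
    (∀ F ∈ EtaMaass.heckeFamily k,
      EtaMaass.IsSelfAdjointOn (EtaMaass.maassSpace k (EtaMaass.vEta k)) F ∧
      ∀ (R : ℝ) (f : UpperHalfPlane → ℂ), EtaMaass.IsMaassForm k (EtaMaass.vEta k) R f →
        EtaMaass.IsMaassForm k (EtaMaass.vEta k) R (F f)) ∧
    (∀ F ∈ EtaMaass.heckeFamily k, ∀ G ∈ EtaMaass.heckeFamily k,
      ∀ f ∈ EtaMaass.maassSpace k (EtaMaass.vEta k), F (G f) = G (F f)) ∧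
    (∀ F ∈ EtaMaass.heckeFamily k,
      ∀ f ∈ EtaMaass.maassSpace k (EtaMaass.vEta k),
        F (EtaMaass.laplacian k f) = EtaMaass.laplacian k (F f)) :=
  ⟨fun _ hF => ⟨EtaMaass.isSelfAdjointOn_of_mem_heckeFamily hF,
      fun _ _ hf => EtaMaass.isMaassForm_of_mem_heckeFamily hF hf⟩,
    fun _ hF _ hG _ hf => EtaMaass.comm_of_mem_maassSpace hF hG hf,
    fun _ hF _ hf => EtaMaass.laplacian_comm_of_mem_maassSpace hF hf⟩
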